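/- Let $C$ be a smooth, projective, geometrically irreducible curve over a finite field $\mathbb F_q$, and let $\mathbb K=\mathbb F_q(C)$ be its function field. For each place $v$ of $\mathbb K$ let $\mathbb K_v$ be the completion, $n_v=[\kappa(v):\mathbb F_q]$ the degree of $v$ and $|x|_v=q^{-n_v\,\mathrm{ord}_v(x)}$ the normalized absolute value. Let $\mathbb A_{\mathbb K}$ be the adele ring, $C_{\mathbb K}=\mathbb A_{\mathbb K}^*/\mathbb K^*$ the idele class group, $|\cdot|:C_{\mathbb K}\to\mathbb R_+^*$ the norm induced by $|a|=\prod_v|a_v|_v$, $C_{\mathbb K,1}$ its kernel, $N$ its range, and $N_v=|\mathbb K_v^*|_v$. Let $a^{(v)}\in\mathbb A_{\mathbb K}$ be the adele with component $0$ at $v$ and $1$ at all other places, and let $$\Xi_{\mathbb K}=\bigcup_v C_{\mathbb K}\,a^{(v)}\subset\mathbb A_{\mathbb K}/\mathbb K^*$$ be the set of periodic classical points of the adele class space. Let $\mathrm{Fr}$ be the $q$-Frobenius permutation of $C(\bar{\mathbb F}_q)$. A point of $C(\bar{\mathbb F}_q)$ lies over the place $v$ if the local ring of $C$ at the underlying point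 is the valuation ring of $v$. Then: 1. $\mathbb K^*$ embeds diagonally in $\mathbb A_{\mathbb K}^*$, the norm of ideles is trivial on $\mathbb K^*$ (so that it induces $|\cdot|$ on $C_{\mathbb K}$), and $N=q^{\mathbb Z}$. 2. For every place $v$ one has $n_v>0$, $N_v=q^{n_v\mathbb Z}$ and $N/N_v\simeq\mathbb Z/n_v\mathbb Z$. The stabilizer in $C_{\mathbb K}$ of the class of $a^{(v)}$ in $\Xi_{\mathbb K}/C_{\mathbb K,1}$ is $\{c : |c|\in N_v\}$, so that the orbit of this class is a copy of $N/N_v$. 3. Every point of $C(\bar{\mathbb F}_q)$ lies over exactly one place. For every place $v$ the points over $v$ form exactly one orbit of the integer powers of $\mathrm{Fr}$, and this orbit has $n_v$ elements. 4. There is a bijection $\Phi:\Xi_{\mathbb K}/C_{\mathbb K,1}\to C(\bar{\mathbb F}_q)$ which is equivariant for the action of $C_{\mathbb K}/C_{\mathbb K,1}\simeq q^{\mathbb Z}$ on the left and of $\mathrm{Fr}^{\mathbb Z}$ on the right, that is, $\Phi(c\,x)=\mathrm{Fr}^n(\Phi(x))$ whenever $|c|=q^n$, and for which $\Phi(a^{(v)})$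 lies over $v$ for every place $v$. 5. The identification is non-canonical exactly up to the choice of a point in each Frobenius orbit: for every choice of a point $s(v)\in C(\bar{\mathbb F}_q)$ over each place $v$ there is exactly one such equivariant bijection $\Phi$ with $\Phi(a^{(v)})=s(v)$ for all $v$. -/

import Mathlib

open CategoryTheory AlgebraicGeometry
open scoped NNReal WithZero RestrictedProduct

universe u

namespace AdeleClass

noncomputable section

/-! ### Places, completions, degrees -/

/-- A place of the function field `K`, given by its normalized discrete valuation
`v : K → ℤ ∪ {∞}`, written multiplicatively, so that `v f = exp (- ord_v f)`.  Over a finite field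
every nontrivial absolute value of a function field is equivalent to exactly one of these, and they
are automatically trivial on the constants. -/
structure Place (K : Type*) [Field K] where
  /-- the normalized discrete valuation -/
  val : Valuation K ℤᵐ⁰
  /-- its value group is all of `ℤ` -/
  surjective : Function.Surjective val

namespace Place

variable {K : Type*} [Field K] (v : Place K)

/-- The local field `K_v`. -/
abbrev Completion : Type _ := v.val.Completion

/-- The ring of integers `𝒪_v` of `K_v`. -/
abbrev integers : ValuationSubring v.Completion :=
  (Valued.v : Valuation v.Completion ℤᵐ⁰).valuationSubring

/-- The residue field `κ(v)` of the place `v`. -/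
abbrev Residue : Type _ := IsLocalRing.ResidueField v.val.valuationSubring

variable (Fq : Type*) [Field Fq] [Fintype Fq] [Algebra Fq K]

/-- Constants are integral at every place. -/
lemma val_algebraMap_le_one (c : Fq) : v.val (algebraMap Fq K c) ≤ 1 := by
  have h : v.val (algebraMap Fq K c) ^ Fintype.card Fq = v.val (algebraMap Fq K c) := by
    rw [← map_pow, ← map_pow, FiniteField.pow_card]
  by_contra! hc
  have h2 := lt_self_pow₀ hc (Fintype.one_lt_card (α := Fq))
  rw [h] at h2
  exact lt_irrefl _ h2

/-- The inclusion of the constants into the valuation ring of `v`. -/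
def constants : Fq →+* v.val.valuationSubring :=
  (algebraMap Fq K).codRestrict v.val.valuationSubring.toSubring
    (fun c => v.val_algebraMap_le_one Fq c)

/-- `κ(v)` as an extension of `𝔽_q`. -/
instance : Algebra Fq v.Residue :=
  ((IsLocalRing.residue v.val.valuationSubring).comp (v.constants Fq)).toAlgebra

/-- The degree `n_v = [κ(v) : 𝔽_q]` of the place `v`. -/
def deg : ℕ := Module.finrank Fq v.Residue

/-- The normalized absolute value of `K_v`: `|x|_v = q ^ (- n_v * ord_v x)`, and `|0|_v = 0`. -/
def absVal : v.Completion →*₀ ℝ≥0 :=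
  (WithZeroMulInt.toNNReal (e := (Fintype.card Fq : ℝ≥0) ^ v.deg Fq)
    (pow_ne_zero _ (Nat.cast_ne_zero.2 Fintype.card_ne_zero))).comp
    (Valued.v : Valuation v.Completion ℤᵐ⁰).toMonoidWithZeroHom

/-- The range `N_v ⊆ ℝ_+^*` of the absolute value on `K_v^*`. -/
def normRange : Subgroup ℝ≥0ˣ :=
  (Units.map (v.absVal Fq : v.Completion →* ℝ≥0)).range

end Place

/-- The number `q`, as an element of `ℝ_+^*`. -/
def qUnit (Fq : Type*) [Field Fq] [Fintype Fq] : ℝ≥0ˣ :=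
  Units.mk0 (Fintype.card Fq : ℝ≥0) (Nat.cast_ne_zero.2 Fintype.card_ne_zero)

/-! ### Adeles, ideles, idele classes, adele classes -/

section Adeles

variable (K : Type*) [Field K]

/-- The adele ring `𝔸_K`: the restricted product of the `K_v` with respect to the `𝒪_v`. -/
def Adele : Type _ := Πʳ v : Place K, [v.Completion, v.integers]

instance : CommRing (Adele K) :=
  inferInstanceAs (CommRing (Πʳ v : Place K, [v.Completion, v.integers]))

instance : DFunLike (Adele K) (Place K) (fun v => v.Completion) :=
  inferInstanceAs (DFunLike (Πʳ v : Place K, [v.Completion, v.integers]) _ _)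

@[simp] lemma Adele.one_apply (v : Place K) : (1 : Adele K) v = 1 := rfl

@[simp] lemma Adele.mul_apply (a b : Adele K) (v : Place K) : (a * b) v = a v * b v := rfl

lemma Idele.mul_inv_apply (a : (Adele K)ˣ) (v : Place K) :
    (a : Adele K) v * ((a⁻¹ : (Adele K)ˣ) : Adele K) v = 1 := by
  rw [← Adele.mul_apply, Units.mul_inv, Adele.one_apply]

/-- The group of ideles `𝔸_K^*`. -/
abbrev Idele : Type _ := (Adele K)ˣ

/-- The subgroup `K^*` of principal ideles: all components are one and the same element
of `K^*`. -/
def principal : Subgroup (Idele K) where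
  carrier := {u | ∃ k : Kˣ, ∀ v : Place K, (u : Adele K) v = ((k : K) : v.Completion)}
  one_mem' := ⟨1, fun v => (UniformSpace.Completion.coe_one (WithVal v.val)).symm⟩
  mul_mem' := by
    rintro a b ⟨k, hk⟩ ⟨l, hl⟩
    exact ⟨k * l, fun v => by simp [hk, hl, UniformSpace.Completion.coe_mul]⟩
  inv_mem' := by
    rintro a ⟨k, hk⟩
    refine ⟨k⁻¹, fun v => ?_⟩
    have h1 := Idele.mul_inv_apply K a v
    have h2 : (a : Adele K) v * (((k⁻¹ : Kˣ) : K) : v.Completion) = 1 := by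
      rw [hk, ← UniformSpace.Completion.coe_mul, ← map_mul, Units.mul_inv]
      simp
    exact mul_left_cancel₀ (left_ne_zero_of_mul_eq_one h1) (h1.trans h2.symm)

/-- The idele class group `C_K = 𝔸_K^* / K^*`. -/
abbrev IdeleClass : Type _ := Idele K ⧸ principal K

/-- The adele class space `X_K = 𝔸_K / K^*` (as a set). -/
abbrev AdeleClassSpace : Type _ := MulAction.orbitRel.Quotient (principal K) (Adele K)

/-- `C_K` acts on `X_K` by multiplication. -/
instance : MulAction (IdeleClass K) (AdeleClassSpace K) where
  smul := Quotient.map₂ (fun (u : Idele K) (a : Adele K) => u • a) (by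
    intro u u' hu a a' ha
    obtain ⟨k, rfl⟩ := ha
    have hu' : u⁻¹ * u' ∈ principal K := QuotientGroup.leftRel_apply.1 hu
    refine ⟨⟨u⁻¹ * u', hu'⟩⁻¹ * k, ?_⟩
    simp only [Subgroup.smul_def, Subgroup.coe_mul, Subgroup.coe_inv, smul_smul]
    congr 1
    simp [mul_comm, mul_left_comm])
  one_smul x := by
    induction x using Quotient.inductionOn with
    | _ a => exact congrArg (Quotient.mk _) (one_smul (Idele K) a)
  mul_smul c d x := by
    induction c using Quotient.inductionOn with
    | _ u =>
      induction d using Quotient.inductionOn with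
      | _ w =>
        induction x using Quotient.inductionOn with
        | _ a => exact congrArg (Quotient.mk _) (mul_smul u w a)

variable {K}

open Classical in
/-- The adele `a^(v)` with component `0` at `v` and `1` at all other places. -/
def puncturedOne (v : Place K) : Adele K :=
  ⟨fun w => if w = v then 0 else 1, Filter.Eventually.of_forall fun w => by
    by_cases h : w = v <;> simp [h]⟩

/-- The class of `a^(v)` in `X_K`. -/
def puncturedClass (v : Place K) : AdeleClassSpace K := Quotient.mk _ (puncturedOne v)

variable (K)

/-- The periodic classical points `Ξ_K = ⋃_v C_K a^(v) ⊆ X_K`, with the action of `C_K`. -/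
def Xi : SubMulAction (IdeleClass K) (AdeleClassSpace K) where
  carrier := ⋃ v : Place K, MulAction.orbit (IdeleClass K) (puncturedClass v)
  smul_mem' := by
    intro c x hx
    obtain ⟨v, hv⟩ := Set.mem_iUnion.1 hx
    exact Set.mem_iUnion.2 ⟨v, MulAction.mem_orbit_of_mem_orbit c hv⟩

variable {K}

/-- The class of `a^(v)`, as a point of `Ξ_K`. -/
def Xi.base (v : Place K) : Xi K :=
  ⟨puncturedClass v, Set.mem_iUnion.2 ⟨v, MulAction.mem_orbit_self _⟩⟩

variable (K) (Fq : Type*) [Field Fq] [Fintype Fq] [Algebra Fq K]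

lemma finite_mulSupport_absVal (a : Idele K) :
    (Function.mulSupport fun v : Place K => v.absVal Fq ((a : Adele K) v)).Finite := by
  have h1 := (a : Adele K).2
  have h2 := ((a⁻¹ : Idele K) : Adele K).2
  have h := h1.and h2
  rw [Filter.eventually_cofinite] at h
  refine h.subset fun v hv hc => hv ?_
  have h3 := Idele.mul_inv_apply K a v
  have h4 : Valued.v ((a : Adele K) v) = (1 : ℤᵐ⁰) := by
    refine le_antisymm hc.1 ?_
    have h5 := congrArg (Valued.v : Valuation v.Completion ℤᵐ⁰) h3
    rw [map_mul, map_one] at h5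
    rw [← h5]
    exact mul_le_of_le_one_right' hc.2
  simp only [Place.absVal, MonoidWithZeroHom.comp_apply]
  exact (congrArg _ h4).trans (map_one _)

/-- The norm `|a| = ∏_v |a_v|_v ∈ ℝ_+^*` of an idele. -/
def ideleNorm : Idele K →* ℝ≥0ˣ :=
  MonoidHom.toHomUnits
    { toFun := fun a => ∏ᶠ v : Place K, v.absVal Fq ((a : Adele K) v)
      map_one' := by simp
      map_mul' := fun a b => by
        rw [← finprod_mul_distrib (finite_mulSupport_absVal K Fq a)
          (finite_mulSupport_absVal K Fq b)]
        simp }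

/-- The subgroup `C_{K,1} ⊆ C_K` of idele classes of norm one. -/
def normOne : Subgroup (IdeleClass K) :=
  (ideleNorm K Fq).ker.map (QuotientGroup.mk' (principal K))

/-- The quotient `Ξ_K / C_{K,1}`. -/
abbrev XiQuotient : Type _ := MulAction.orbitRel.Quotient (normOne K Fq) (Xi K)

/-- `C_K` acts on `Ξ_K / C_{K,1}`; the subgroup `C_{K,1}` acts trivially. -/
instance : MulAction (IdeleClass K) (XiQuotient K Fq) where
  smul c := Quotient.map (fun x : Xi K => c • x) (by
    rintro x y ⟨d, rfl⟩
    refine ⟨d, ?_⟩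
    change (d : IdeleClass K) • c • y = c • (d : IdeleClass K) • y
    exact (mul_smul (d : IdeleClass K) c y).symm.trans
      ((congrArg (· • y) (mul_comm (d : IdeleClass K) c)).trans (mul_smul c (d : IdeleClass K) y)))
  one_smul x := by
    induction x using Quotient.inductionOn with
    | _ x => exact congrArg (Quotient.mk _) (one_smul (IdeleClass K) x)
  mul_smul c d x := by
    induction x using Quotient.inductionOn with
    | _ x => exact congrArg (Quotient.mk _) (mul_smul c d x)

variable {K}

/-- The class of `a^(v)` in `Ξ_K / C_{K,1}`. -/
def XiQuotient.base (v : Place K) : XiQuotient K Fq := Quotient.mk _ (Xi.base v)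

end Adeles

/-! ### Curves over a finite field and their geometric points -/

section Curve

variable (Fq : Type u) [Field Fq] (C : Scheme.{u}) [C.Over (Spec (.of Fq))]

/-- The function field `𝔽_q(C)` as an extension of `𝔽_q`, through the structure morphism. -/
instance [IsIntegral C] : Algebra Fq C.functionField :=
  RingHom.toAlgebra
    ((C.presheaf.germ ⊤ (genericPoint C) trivial).hom.comp
      (((C ↘ Spec (.of Fq)).appTop).hom.comp (Scheme.ΓSpecIso (.of Fq)).inv.hom))

/-- `C(𝔽̄_q)`: the morphisms `Spec 𝔽̄_q ⟶ C` over `Spec 𝔽_q`. -/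
def GeomPoint : Type u :=
  {x : Spec (.of (AlgebraicClosure Fq)) ⟶ C //
    x ≫ (C ↘ Spec (.of Fq)) =
      Spec.map (CommRingCat.ofHom (algebraMap Fq (AlgebraicClosure Fq)))}

namespace GeomPoint

variable {Fq C}

/-- An automorphism `σ` of `𝔽̄_q` over `𝔽_q` acts on `C(𝔽̄_q)`: it applies `σ` to the coordinates
of a point. -/
def galois (σ : AlgebraicClosure Fq ≃ₐ[Fq] AlgebraicClosure Fq) (x : GeomPoint Fq C) :
    GeomPoint Fq C :=
  ⟨Spec.map (CommRingCat.ofHom (σ : AlgebraicClosure Fq →+* AlgebraicClosure Fq)) ≫ x.1, by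
    rw [Category.assoc, x.2, ← Spec.map_comp, ← CommRingCat.ofHom_comp]
    congr 2
    ext c
    simp⟩

lemma galois_refl (x : GeomPoint Fq C) : galois AlgEquiv.refl x = x :=
  Subtype.ext ((congrArg (· ≫ x.1) (Spec.map_id _)).trans (Category.id_comp x.1))

lemma galois_galois (σ τ : AlgebraicClosure Fq ≃ₐ[Fq] AlgebraicClosure Fq) (x : GeomPoint Fq C) :
    galois σ (galois τ x) = galois (τ.trans σ) x := by
  apply Subtype.ext
  simp only [galois]
  rw [← Category.assoc, ← Spec.map_comp, ← CommRingCat.ofHom_comp]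
  rfl

variable (Fq C)

/-- The Frobenius permutation of `C(𝔽̄_q)`: it raises the coordinates of a point to the
power `q`. -/
def frobenius [Fintype Fq] : Equiv.Perm (GeomPoint Fq C) where
  toFun := galois (FiniteField.frobeniusAlgEquivOfAlgebraic Fq (AlgebraicClosure Fq))
  invFun := galois (FiniteField.frobeniusAlgEquivOfAlgebraic Fq (AlgebraicClosure Fq)).symm
  left_inv x := by
    rw [galois_galois, AlgEquiv.self_trans_symm, galois_refl]
  right_inv x := by
    rw [galois_galois, AlgEquiv.symm_trans_self, galois_refl]

variable {Fq C}

/-- The point of the scheme `C` underlying a geometric point. -/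
def center (x : GeomPoint Fq C) : C := x.1 (IsLocalRing.closedPoint (AlgebraicClosure Fq))

/-- The geometric point `x` lies over the place `v`: the local ring of `C` at the point
underlying `x` is the valuation ring of `v`, inside the function field. -/
def LiesOver [IsIntegral C] (x : GeomPoint Fq C) (v : Place C.functionField) : Prop :=
  ∀ f : C.functionField, v.val f ≤ 1 ↔
    f ∈ Set.range (algebraMap (C.presheaf.stalk x.center) C.functionField)

end GeomPoint

end Curve

end

end AdeleClass

open AdeleClass

/-!
By the product formula the norm descends to the idele classes, and its range is `q^ℤ` exactly if the
degrees of the places have no common divisor `ℓ > 1` (F. K. Schmidt). If they had one, every place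
of `K` would split in the extension of constants of degree `ℓ`, and pairs of effective divisors of
`K` would give effective divisors of the extension, about `k q ^ k` of them in degree `k`. Riemann's
inequality allows only `O(q ^ k)`.

The valuative criterion of properness gives every place `v` a center on `C`, whose local ring is
the valuation ring of `v`. The points over `v` are therefore the embeddings of the residue field
`κ(v)` into `𝔽̄_q`, and they form one Frobenius orbit of length `n_v`. The orbit of `a^(v)` modulo
`C_{K,1}` is `N / N_v = q^ℤ / q^(n_v ℤ)`, so that an equivariant bijection compatible with the
places amounts to the choice of one point over each place.
-/

namespace AdeleClass

open IntermediateField IntermediateField.algebraAdjoinAdjoin Polynomial WithZero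

noncomputable section

/-! ### Function fields of curves -/

/-- Algebraic function fields of one variable over `F`: finitely generated field extensions of
transcendence degree one. -/
class IsFunctionFieldOfCurve (F K : Type*) [Field F] [Field K] [Algebra F K] : Prop extends
    Algebra.EssFiniteType F K where
  trdeg_eq_one : Algebra.trdeg F K = 1

section FunctionField

variable {F K : Type*} [Field F] [Field K] [Algebra F K]

lemma IsFunctionFieldOfCurve.exists_transcendental [IsFunctionFieldOfCurve F K] :
    ∃ t : K, Transcendental F t := by
  have := trdeg_ne_zero_iff.1 ((trdeg_eq_one (F := F) (K := K)).symm ▸ one_ne_zero)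
  exact this.transcendental

lemma IsFunctionFieldOfCurve.finiteDimensional_adjoin [IsFunctionFieldOfCurve F K] {t : K}
    (ht : Transcendental F t) : FiniteDimensional F⟮t⟯ K := by
  have hind : AlgebraicIndependent F ![t] := algebraicIndependent_unique_type_iff.2 ht
  have hbasis : IsTranscendenceBasis F ![t] :=
    hind.isTranscendenceBasis_of_lift_trdeg_le (by simp [trdeg_eq_one])
      (by simp [trdeg_eq_one])
  have : Algebra.IsAlgebraic F⟮t⟯ K := by
    have := hbasis.isAlgebraic_field
    rwa [Matrix.range_cons, Matrix.range_empty, Set.union_empty] at this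
  have : Algebra.EssFiniteType F⟮t⟯ K := Algebra.EssFiniteType.of_comp F F⟮t⟯ K
  exact Algebra.finite_of_essFiniteType_of_isAlgebraic

variable {R : Type*} [CommRing R] [Algebra F R] {W : Type*} [AddCommGroup W] [Module F W]

lemma eq_zero_of_sum_aeval_mul_eq_zero [IsDomain R] {s : R} (hs : s ≠ 0) {φ : R →ₗ[F] W}
    (hφ : ∀ r, φ (s * r) = 0) {I : Type*} [Fintype I] {a : I → R}
    (ha : LinearIndependent F (φ ∘ a)) {p : I → F[X]} (h : ∑ i, aeval s (p i) * a i = 0) (i : I) :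
    p i = 0 := by
  have divides {p : I → F[X]} (h : ∑ i, aeval s (p i) * a i = 0) :
      (∀ i, (p i).coeff 0 = 0) ∧ ∑ i, aeval s (p i).divX * a i = 0 := by
    have split (i : I) :
        aeval s (p i) * a i = (p i).coeff 0 • a i + s * (aeval s (p i).divX * a i) := by
      conv_lhs => rw [← divX_mul_X_add (p i), map_add, map_mul, aeval_X, aeval_C]
      rw [Algebra.smul_def]
      ring
    simp only [split, Finset.sum_add_distrib, ← Finset.mul_sum] at h
    have hcoeff : ∀ i, (p i).coeff 0 = 0 :=
      Fintype.linearIndependent_iff.1 ha _ (by simpa [hφ] using congrArg φ h)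
    exact ⟨hcoeff, by simpa [hcoeff, hs] using h⟩
  ext n
  induction n generalizing p with
  | zero => exact (divides h).1 i
  | succ n ih => simpa using ih (divides h).2

variable [Algebra R K] [IsScalarTower F R K] [FaithfulSMul R K]

lemma linearIndependent_adjoin {s : R} (hs : s ≠ 0) {φ : R →ₗ[F] W} (hφ : ∀ r, φ (s * r) = 0)
    {I : Type*} [Finite I] {a : I → R} (ha : LinearIndependent F (φ ∘ a)) :
    LinearIndependent F⟮algebraMap R K s⟯ fun i => algebraMap R K (a i) := by
  have := Fintype.ofFinite I
  have : IsDomain R := (FaithfulSMul.algebraMap_injective R K).isDomain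
  generalize ht : algebraMap R K s = t
  rw [← LinearIndependent.iff_fractionRing (Algebra.adjoin F {t}) F⟮t⟯,
    Fintype.linearIndependent_iff]
  intro g hg
  have hpoly (i : I) : ∃ p : F[X], aeval t p = g i :=
    (AlgHom.mem_range _).1 ((Algebra.adjoin_singleton_eq_range_aeval F t).le (g i).2)
  choose p hp using hpoly
  have hsum : ∑ i, aeval s (p i) * a i = 0 := by
    apply FaithfulSMul.algebraMap_injective R K
    simpa only [map_sum, map_mul, ← aeval_algebraMap_apply, ht, hp, map_zero, Subalgebra.smul_def,
      smul_eq_mul] using hg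
  intro i
  apply Subtype.ext
  rw [← hp, eq_zero_of_sum_aeval_mul_eq_zero hs hφ ha hsum i, map_zero, ZeroMemClass.coe_zero]

variable [IsFunctionFieldOfCurve F K] {s : R} (hs : Transcendental F (algebraMap R K s))
  {φ : R →ₗ[F] W} (hsurj : Function.Surjective φ) (hφ : ∀ r, φ (s * r) = 0)

include hs hsurj hφ

lemma rank_le_finrank_adjoin : Module.rank F W ≤ Module.finrank F⟮algebraMap R K s⟯ K := by
  have := IsFunctionFieldOfCurve.finiteDimensional_adjoin hs
  have hs0 : s ≠ 0 := fun h => hs (by rw [h, map_zero]; exact isAlgebraic_zero)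
  refine rank_le fun t ht => ?_
  choose a ha using fun x : t => hsurj x
  have hind : LinearIndependent F (φ ∘ a) := by
    simpa only [Function.comp_def, ha] using ht
  simpa using (linearIndependent_adjoin (K := K) hs0 hφ hind).fintype_card_le_finrank

lemma finite_of_surjective_of_map_mul_eq_zero : Module.Finite F W :=
  Module.rank_lt_aleph0_iff.1
    ((rank_le_finrank_adjoin hs hsurj hφ).trans_lt Cardinal.natCast_lt_aleph0)

lemma finrank_le_finrank_adjoin :
    Module.finrank F W ≤ Module.finrank F⟮algebraMap R K s⟯ K :=
  Module.finrank_le_of_rank_le (rank_le_finrank_adjoin hs hsurj hφ)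

end FunctionField

-- A nonzero element `s` of an ideal is a unit or transcendental, and in the second case the ideal
-- is generated by `s` and finitely many lifts, as `R / (s)` has finite dimension.
lemma isNoetherianRing_of_faithfulSMul (F K R : Type*) [Field F] [Field K] [Algebra F K]
    [IsFunctionFieldOfCurve F K] [CommRing R] [Algebra F R] [Algebra R K] [IsScalarTower F R K]
    [FaithfulSMul R K] : IsNoetherianRing R := by
  have hinj := FaithfulSMul.algebraMap_injective R K
  have : IsDomain R := hinj.isDomain
  refine (isNoetherianRing_iff_ideal_fg R).2 fun I => ?_
  rcases eq_or_ne I ⊥ with rfl | hI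
  · exact Submodule.fg_bot
  obtain ⟨s, hsI, hs0⟩ := Submodule.exists_mem_ne_zero_of_ne_bot hI
  by_cases hs : IsAlgebraic F s
  · obtain ⟨t, ht0, ht⟩ := hs.exists_nonzero_dvd (mem_nonZeroDivisors_of_ne_zero hs0)
    rw [Ideal.eq_top_of_isUnit_mem I hsI (isUnit_of_dvd_unit ht (ht0.isUnit.map (algebraMap F R)))]
    exact Ideal.fg_top R
  have : Module.Finite F (R ⧸ Ideal.span {s}) :=
    finite_of_surjective_of_map_mul_eq_zero (K := K) (mt (isAlgebraic_algebraMap_iff hinj).1 hs)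
      (φ := (Ideal.Quotient.mkₐ F (Ideal.span {s})).toLinearMap) Ideal.Quotient.mk_surjective
      fun r => Ideal.Quotient.eq_zero_iff_mem.2
        (Ideal.mul_mem_right r _ (Ideal.mem_span_singleton_self s))
  have : IsNoetherianRing (R ⧸ Ideal.span {s}) := isNoetherian_of_tower F inferInstance
  refine Ideal.fg_of_fg_map_of_fg_inf_ker_of_surjective
    (f := Ideal.Quotient.mk (Ideal.span {s})) (IsNoetherian.noetherian _) ?_
    Ideal.Quotient.mk_surjective
  rw [Ideal.mk_ker, inf_eq_right.2 ((Ideal.span_singleton_le_iff_mem I).2 hsI)]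
  exact ⟨{s}, by simp⟩

/-! ### Places -/

lemma exp_lt_one_iff {n : ℤ} : (exp n : ℤᵐ⁰) < 1 ↔ n < 0 := by
  rw [← exp_zero, exp_lt_exp]

lemma exp_le_one_iff {n : ℤ} : (exp n : ℤᵐ⁰) ≤ 1 ↔ n ≤ 0 := by
  rw [← exp_zero, exp_le_exp]

lemma lt_exp_iff_le {x : ℤᵐ⁰} {n : ℤ} : x < exp n ↔ x ≤ exp (n - 1) := by
  rcases eq_or_ne x 0 with rfl | hx
  · simp only [exp_pos, zero_le]
  · rw [← log_lt_iff_lt_exp hx, ← log_le_iff_le_exp hx]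
    exact Int.le_sub_one_iff.symm

lemma lt_one_iff_le_exp {x : ℤᵐ⁰} : x < 1 ↔ x ≤ exp (-1) := by
  rw [← exp_zero, lt_exp_iff_le, zero_sub]

namespace Place

section Basic

variable {K : Type*} [Field K] (v : Place K)

/-- A chosen uniformizer at `v`. -/
def uniformizer : K := (v.surjective (exp (-1))).choose

lemma val_uniformizer : v.val v.uniformizer = exp (-1) := (v.surjective (exp (-1))).choose_spec

lemma val_uniformizer_lt_one : v.val v.uniformizer < 1 := by
  rw [val_uniformizer, exp_lt_one_iff]
  exact neg_one_lt_zero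

lemma uniformizer_ne_zero : v.uniformizer ≠ 0 := by
  rw [← v.val.ne_zero_iff, val_uniformizer]
  exact exp_ne_zero

lemma val_uniformizer_zpow (n : ℤ) : v.val (v.uniformizer ^ n) = exp (-n) := by
  rw [map_zpow₀, val_uniformizer, ← exp_zsmul, smul_eq_mul, mul_neg_one]

lemma eq_of_isEquiv {v w : Place K} (h : v.val.IsEquiv w.val) : v = w := by
  have hπ : w.val v.uniformizer = exp (-1) := by
    apply le_antisymm
    · rw [← lt_one_iff_le_exp, ← Valuation.isEquiv_iff_val_lt_one.1 h]
      exact v.val_uniformizer_lt_one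
    · rw [← w.val_uniformizer, ← h w.uniformizer, v.val_uniformizer, ← lt_one_iff_le_exp,
        Valuation.isEquiv_iff_val_lt_one.1 h]
      exact w.val_uniformizer_lt_one
  suffices v.val = w.val by
    cases v
    congr
  ext f
  rcases eq_or_ne f 0 with rfl | hf
  · simp only [map_zero]
  have hv : v.val f = v.val (v.uniformizer ^ (-log (v.val f))) := by
    rw [val_uniformizer_zpow, neg_neg, exp_log (v.val.ne_zero_iff.2 hf)]
  rw [h.eq_iff.1 hv, map_zpow₀, hπ, ← v.val_uniformizer, ← map_zpow₀]
  exact hv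

lemma eq_of_le_one_iff {v w : Place K} (h : ∀ f, v.val f ≤ 1 ↔ w.val f ≤ 1) : v = w :=
  eq_of_isEquiv (Valuation.isEquiv_iff_val_le_one.2 fun {f} => h f)

/-- The absolute value `f ↦ 2 ^ (- ord_v f)`. The base is irrelevant: the absolute value only serves
to apply the weak approximation theorem. -/
def abv : AbsoluteValue K ℝ where
  toFun f := WithZeroMulInt.toNNReal (e := 2) two_ne_zero (v.val f)
  map_mul' a b := by simp
  nonneg' a := by simp
  eq_zero' a := by simp
  add_le' a b := by
    have hmono := (WithZeroMulInt.toNNReal_strictMono (e := 2) one_lt_two).monotone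
    have hadd := hmono (v.val.map_add a b)
    rw [hmono.map_max] at hadd
    exact_mod_cast hadd.trans (max_le_add_of_nonneg zero_le zero_le)

lemma abv_lt_iff (f g : K) : v.abv f < v.abv g ↔ v.val f < v.val g :=
  NNReal.coe_lt_coe.trans (WithZeroMulInt.toNNReal_strictMono (e := 2) one_lt_two).lt_iff_lt

lemma abv_isNontrivial : v.abv.IsNontrivial := by
  refine ⟨v.uniformizer, v.uniformizer_ne_zero, ne_of_lt ?_⟩
  rw [← map_one v.abv, abv_lt_iff, map_one]
  exact v.val_uniformizer_lt_one

lemma eq_of_abv_isEquiv {v w : Place K} (h : v.abv.IsEquiv w.abv) : v = w := by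
  refine eq_of_isEquiv fun f g => ?_
  rw [← not_lt, ← not_lt, ← abv_lt_iff, ← abv_lt_iff, h.lt_iff_lt]

lemma exists_val_sub_lt {ι : Type*} [Finite ι] {p : ι → Place K} (hp : Function.Injective p)
    (a : ι → K) (n : ι → ℤ) : ∃ x : K, ∀ i, (p i).val (x - a i) < exp (n i) := by
  have hdense : DenseRange (algebraMap K ((i : ι) → WithAbs (p i).abv)) :=
    AbsoluteValue.denseRange_algebraMap_pi (fun i => (p i).abv_isNontrivial)
      fun i j hij h => hij (hp (eq_of_abv_isEquiv h))
  choose y hy using fun i => (p i).surjective (exp (n i))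
  have hpos (i : ι) : 0 < (p i).abv (y i) := by
    rw [← map_zero (p i).abv, abv_lt_iff, map_zero, hy]
    exact exp_pos
  let U : Set ((i : ι) → WithAbs (p i).abv) :=
    Set.univ.pi fun i => Metric.ball (WithAbs.toAbs _ (a i)) ((p i).abv (y i))
  have hU : IsOpen U := isOpen_set_pi Set.finite_univ fun i _ => Metric.isOpen_ball
  obtain ⟨x, hx⟩ := hdense.exists_mem_open hU
    ⟨fun i => WithAbs.toAbs _ (a i), fun i _ => Metric.mem_ball_self (hpos i)⟩
  refine ⟨x, fun i => ?_⟩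
  rw [← hy, ← abv_lt_iff]
  exact mem_ball_iff_norm.1 (hx i trivial)

lemma residue_eq_zero_iff (x : v.val.valuationSubring) :
    IsLocalRing.residue _ x = 0 ↔ v.val (x : K) < 1 := by
  rw [IsLocalRing.residue_eq_zero_iff, ValuationSubring.valuation_lt_one_iff]
  exact (Valuation.isEquiv_iff_val_lt_one.1 v.val.isEquiv_valuation_valuationSubring).symm

end Basic

end Place

/-! ### Laurent tails -/

namespace Place

section Constants

variable {K : Type*} [Field K] (v : Place K)

section Integral

variable {Fq : Type*} [Field Fq] [Finite Fq] [Algebra Fq K]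

lemma val_le_one_of_isIntegral_adjoin {f x : K} (hf : v.val f ≤ 1)
    (hx : IsIntegral (Algebra.adjoin Fq {f}) x) : v.val x ≤ 1 := by
  have := Fintype.ofFinite Fq
  have hle : (Algebra.adjoin Fq {f}).toSubring ≤ v.val.valuationSubring.toSubring := by
    intro y hy
    induction hy using Algebra.adjoin_induction with
    | mem y hy => rwa [Set.mem_singleton_iff.1 hy]
    | algebraMap c => exact v.val_algebraMap_le_one Fq c
    | add a b _ _ ha hb => exact add_mem ha hb
    | mul a b _ _ ha hb => exact mul_mem ha hb
  have hint : IsIntegral v.val.valuationSubring x :=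
    IsIntegral.map_of_comp_eq (Subring.inclusion hle) (RingHom.id K) rfl hx
  obtain ⟨y, rfl⟩ := IsIntegrallyClosed.isIntegral_iff.1 hint
  exact y.2

lemma val_le_one_of_isAlgebraic {f : K} (hf : IsAlgebraic Fq f) : v.val f ≤ 1 :=
  v.val_le_one_of_isIntegral_adjoin (Fq := Fq) (f := 0) (by simp) hf.isIntegral.tower_top

lemma val_eq_one_of_isAlgebraic {f : K} (h0 : f ≠ 0) (hf : IsAlgebraic Fq f) : v.val f = 1 := by
  refine (v.val_le_one_of_isAlgebraic hf).antisymm ?_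
  have hinv := v.val_le_one_of_isAlgebraic hf.inv
  rwa [map_inv₀, inv_le_one₀ (zero_lt_iff.2 (v.val.ne_zero_iff.2 h0))] at hinv

lemma transcendental_of_val_ne_one {f : K} (h0 : f ≠ 0) (h : v.val f ≠ 1) :
    Transcendental Fq f :=
  fun hf => h (v.val_eq_one_of_isAlgebraic h0 hf)

variable (Fq) in
lemma transcendental_uniformizer : Transcendental Fq v.uniformizer :=
  v.transcendental_of_val_ne_one v.uniformizer_ne_zero v.val_uniformizer_lt_one.ne

end Integral

variable (Fq : Type*) [Field Fq] [Fintype Fq] [Algebra Fq K]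

/-- The fractional ideal of the functions with a pole of order at most `n` at `v`. -/
def ball (n : ℤ) : Submodule Fq K where
  carrier := {f | v.val f ≤ exp n}
  add_mem' ha hb := v.val.map_add_le ha hb
  zero_mem' := by simp
  smul_mem' c f hf := by
    rw [Set.mem_ofPred_eq, Algebra.smul_def, map_mul]
    exact (mul_le_of_le_one_left' (v.val_algebraMap_le_one Fq c)).trans hf

variable {Fq} in
lemma mem_ball {n : ℤ} {f : K} : f ∈ v.ball Fq n ↔ v.val f ≤ exp n := Iff.rfl

lemma ball_mono {m n : ℤ} (h : m ≤ n) : v.ball Fq m ≤ v.ball Fq n :=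
  fun _ hf => v.mem_ball.2 ((v.mem_ball.1 hf).trans (exp_le_exp.2 h))

/-- The coefficient of `π ^ (-n)` in the Laurent expansion at `v`, with respect to the chosen
uniformizer `π`. -/
def leadingCoeff (n : ℤ) : v.ball Fq n →ₗ[Fq] v.Residue where
  toFun f := IsLocalRing.residue v.val.valuationSubring ⟨f * v.uniformizer ^ n, by
    rw [Valuation.mem_valuationSubring_iff, map_mul, val_uniformizer_zpow]
    calc v.val f.1 * exp (-n) ≤ exp n * exp (-n) := mul_le_mul_left (v.mem_ball.1 f.2) _
      _ = 1 := by rw [← exp_add, add_neg_cancel, exp_zero]⟩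
  map_add' f g := by
    rw [← map_add]
    exact congrArg _ (Subtype.ext (add_mul _ _ _))
  map_smul' c f := by
    rw [RingHom.id_apply, Algebra.smul_def]
    refine (congrArg (IsLocalRing.residue _) (Subtype.ext ?_)).trans
      (map_mul (IsLocalRing.residue _) (v.constants Fq c) _)
    change (c • (f : K)) * _ = algebraMap Fq K c * (f * _)
    rw [Algebra.smul_def, mul_assoc]

lemma leadingCoeff_eq_zero_iff {n : ℤ} (f : v.ball Fq n) :
    v.leadingCoeff Fq n f = 0 ↔ (f : K) ∈ v.ball Fq (n - 1) := by
  change IsLocalRing.residue _ _ = 0 ↔ _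
  rw [residue_eq_zero_iff, mem_ball, ← lt_exp_iff_le, map_mul, val_uniformizer_zpow, exp_neg,
    ← div_eq_mul_inv, div_lt_one₀ exp_pos]

lemma leadingCoeff_surjective (n : ℤ) : Function.Surjective (v.leadingCoeff Fq n) := by
  intro y
  obtain ⟨x, rfl⟩ := IsLocalRing.residue_surjective y
  refine ⟨⟨x * v.uniformizer ^ (-n), ?_⟩, congrArg (IsLocalRing.residue _) (Subtype.ext ?_)⟩
  · rw [mem_ball, map_mul, val_uniformizer_zpow, neg_neg]
    exact mul_le_of_le_one_left' x.2
  · simp [zpow_ne_zero _ v.uniformizer_ne_zero]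

/-- The functions without pole at the places `p i`. -/
def regularAt {ι : Type*} (p : ι → Place K) : Subalgebra Fq K where
  carrier := {f | ∀ i, (p i).val f ≤ 1}
  mul_mem' hx hy i := by
    rw [map_mul]
    exact mul_le_one' (hx i) (hy i)
  add_mem' hx hy i := (p i).val.map_add_le (hx i) (hy i)
  algebraMap_mem' c i := (p i).val_algebraMap_le_one Fq c

variable {Fq} in
lemma mem_regularAt {ι : Type*} {p : ι → Place K} {f : K} :
    f ∈ regularAt Fq p ↔ ∀ i, (p i).val f ≤ 1 := Iff.rfl

/-- The truncated Laurent tails at `v`: the Laurent expansions in the terms of pole order in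
`(m, n]`. -/
def LaurentTail (m n : ℤ) : Type _ := v.ball Fq n ⧸ (v.ball Fq m).submoduleOf (v.ball Fq n)

instance (m n : ℤ) : AddCommGroup (v.LaurentTail Fq m n) :=
  inferInstanceAs (AddCommGroup (v.ball Fq n ⧸ (v.ball Fq m).submoduleOf (v.ball Fq n)))

instance (m n : ℤ) : Module Fq (v.LaurentTail Fq m n) :=
  inferInstanceAs (Module Fq (v.ball Fq n ⧸ (v.ball Fq m).submoduleOf (v.ball Fq n)))

/-- The truncated Laurent tail of a function with a pole of order at most `n`. -/
def tail (m n : ℤ) : v.ball Fq n →ₗ[Fq] v.LaurentTail Fq m n :=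
  ((v.ball Fq m).submoduleOf (v.ball Fq n)).mkQ

lemma tail_surjective (m n : ℤ) : Function.Surjective (v.tail Fq m n) :=
  Submodule.mkQ_surjective _

lemma tail_eq_zero_iff {m n : ℤ} {f : v.ball Fq n} :
    v.tail Fq m n f = 0 ↔ (f : K) ∈ v.ball Fq m :=
  Submodule.Quotient.mk_eq_zero _

section Regular

variable {ι : Type*} {p : ι → Place K} {Fq}

/-- The tails of order in `(-e i, 0]` of a function which is regular at the places `p i`. -/
def regularTail (p : ι → Place K) (e : ι → ℕ) :
    regularAt Fq p →ₗ[Fq] (i : ι) → (p i).LaurentTail Fq (-(e i : ℤ)) 0 :=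
  LinearMap.pi fun i => (p i).tail Fq (-(e i : ℤ)) 0 ∘ₗ
    (regularAt Fq p).val.toLinearMap.codRestrict ((p i).ball Fq 0) fun f => by
      rw [mem_ball, exp_zero]
      exact mem_regularAt.1 f.2 i

lemma regularTail_surjective [Finite ι] (hp : Function.Injective p) (e : ι → ℕ) :
    Function.Surjective (regularTail (Fq := Fq) p e) := by
  intro y
  choose z hz using fun i => (p i).tail_surjective Fq (-(e i : ℤ)) 0 (y i)
  obtain ⟨x, hx⟩ := exists_val_sub_lt hp (fun i => (z i : K)) (fun i => -(e i : ℤ))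
  have hsub (i : ι) : x - z i ∈ (p i).ball Fq (-(e i : ℤ)) := (hx i).le
  have hreg : x ∈ regularAt Fq p := fun i => by
    rw [← exp_zero, ← mem_ball (Fq := Fq), ← sub_add_cancel x (z i)]
    exact add_mem (ball_mono _ _ (by simp) (hsub i)) (z i).2
  refine ⟨⟨x, hreg⟩, funext fun i => ?_⟩
  rw [← hz, ← sub_eq_zero]
  exact (map_sub ((p i).tail Fq (-(e i : ℤ)) 0) _ _).symm.trans
    (((p i).tail_eq_zero_iff Fq).2 (hsub i))

lemma regularTail_mul_eq_zero {e : ι → ℕ} {s : regularAt Fq p}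
    (hs : ∀ i, (p i).val s ≤ exp (-(e i : ℤ))) (f : regularAt Fq p) :
    regularTail p e (s * f) = 0 := by
  ext i
  refine ((p i).tail_eq_zero_iff Fq).2 ?_
  change (p i).val (s * f : K) ≤ _
  rw [map_mul]
  exact (mul_le_of_le_one_right' (f.2 i)).trans (hs i)

end Regular

end Constants

end Place

namespace Place

section Tail

variable {K : Type*} [Field K] (v : Place K) (Fq : Type*) [Field Fq] [Fintype Fq] [Algebra Fq K]

/-- The leading coefficient of a truncated Laurent tail. -/
def tailCoeff {m n : ℤ} (h : m < n) : v.LaurentTail Fq m n →ₗ[Fq] v.Residue :=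
  Submodule.liftQ _ (v.leadingCoeff Fq n) fun f hf =>
    (v.leadingCoeff_eq_zero_iff Fq f).2 (v.ball_mono Fq (Int.le_sub_one_of_lt h) hf)

lemma tailCoeff_tail {m n : ℤ} (h : m < n) (f : v.ball Fq n) :
    v.tailCoeff Fq h (v.tail Fq m n f) = v.leadingCoeff Fq n f := rfl

lemma tailCoeff_surjective {m n : ℤ} (h : m < n) : Function.Surjective (v.tailCoeff Fq h) :=
  fun y =>
    let ⟨f, hf⟩ := v.leadingCoeff_surjective Fq n y
    ⟨v.tail Fq m n f, hf⟩

/-- The Laurent tails of smaller pole order, among all truncated Laurent tails. -/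
def tailInclusion (m : ℤ) {n n' : ℤ} (h : n ≤ n') :
    v.LaurentTail Fq m n →ₗ[Fq] v.LaurentTail Fq m n' :=
  Submodule.mapQ _ _ (Submodule.inclusion (v.ball_mono Fq h)) fun _ hf => hf

lemma tailInclusion_tail (m : ℤ) {n n' : ℤ} (h : n ≤ n') (f : v.ball Fq n) :
    v.tailInclusion Fq m h (v.tail Fq m n f) =
      v.tail Fq m n' (Submodule.inclusion (v.ball_mono Fq h) f) := rfl

lemma tailInclusion_injective (m : ℤ) {n n' : ℤ} (h : n ≤ n') :
    Function.Injective (v.tailInclusion Fq m h) := by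
  rw [← LinearMap.ker_eq_bot, LinearMap.ker_eq_bot']
  intro x hx
  obtain ⟨f, rfl⟩ := v.tail_surjective Fq m n x
  rw [tailInclusion_tail, tail_eq_zero_iff] at hx
  exact (v.tail_eq_zero_iff Fq).2 hx

lemma ker_tailCoeff {m n : ℤ} (h : m < n + 1) :
    (v.tailCoeff Fq h).ker = (v.tailInclusion Fq m (Int.le_add_one le_rfl)).range := by
  ext x
  constructor
  · intro hx
    obtain ⟨f, rfl⟩ := v.tail_surjective Fq m _ x
    rw [LinearMap.mem_ker, tailCoeff_tail, leadingCoeff_eq_zero_iff, add_sub_cancel_right] at hx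
    exact ⟨v.tail Fq m n ⟨f, hx⟩, rfl⟩
  · rintro ⟨y, rfl⟩
    obtain ⟨f, rfl⟩ := v.tail_surjective Fq m _ y
    rw [LinearMap.mem_ker, tailInclusion_tail, tailCoeff_tail, leadingCoeff_eq_zero_iff,
      add_sub_cancel_right]
    exact f.2

variable [IsFunctionFieldOfCurve Fq K]

instance finite_residue : Module.Finite Fq v.Residue := by
  let p : Unit → Place K := fun _ => v
  let s : regularAt Fq p := ⟨v.uniformizer, fun _ => v.val_uniformizer_lt_one.le⟩
  have : Module.Finite Fq (Unit → v.LaurentTail Fq (-1) 0) :=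
    finite_of_surjective_of_map_mul_eq_zero (K := K) (s := s) (φ := regularTail p fun _ => 1)
      (v.transcendental_uniformizer Fq)
      (regularTail_surjective (Function.injective_of_subsingleton p) _)
      (regularTail_mul_eq_zero fun _ => v.val_uniformizer.le)
  have : Module.Finite Fq (v.LaurentTail Fq (-1) 0) :=
    Module.Finite.of_surjective
      (LinearMap.proj (R := Fq) (φ := fun _ : Unit => v.LaurentTail Fq (-1) 0) ())
      (Function.surjective_eval ())
  exact Module.Finite.of_surjective (v.tailCoeff Fq neg_one_lt_zero)
    (v.tailCoeff_surjective Fq neg_one_lt_zero)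

lemma deg_pos : 0 < v.deg Fq := Module.finrank_pos

lemma finite_laurentTail_and_finrank_eq {m n : ℤ} (h : m ≤ n) :
    Module.Finite Fq (v.LaurentTail Fq m n) ∧
      (Module.finrank Fq (v.LaurentTail Fq m n) : ℤ) = (n - m) * v.deg Fq := by
  induction n, h using Int.leInduction with
  | base =>
    have : Subsingleton (v.LaurentTail Fq m m) :=
      Submodule.Quotient.subsingleton_iff.2 (Submodule.submoduleOf_self _)
    exact ⟨inferInstance, by rw [Module.finrank_zero_of_subsingleton, sub_self, zero_mul]; rfl⟩
  | succ n h ih =>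
    obtain ⟨_, hrank⟩ := ih
    let φ := v.tailCoeff Fq (Int.lt_add_one_of_le h)
    let ι := v.tailInclusion Fq m (Int.le_add_one (le_refl n))
    have hker : φ.ker = ι.range := v.ker_tailCoeff Fq _
    have : Module.Finite Fq φ.ker := by
      rw [hker]
      infer_instance
    have : Module.Finite Fq (_ ⧸ φ.ker) := Module.Finite.equiv φ.quotKerEquivRange.symm
    have hfin := Module.Finite.of_submodule_quotient φ.ker
    refine ⟨hfin, ?_⟩
    rw [← φ.finrank_range_add_finrank_ker, hker,
      LinearMap.range_eq_top.2 (v.tailCoeff_surjective Fq _), finrank_top,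
      LinearMap.finrank_range_of_inj (v.tailInclusion_injective Fq m _), Nat.cast_add, hrank, deg]
    ring

lemma sum_mul_deg_le {ι : Type*} [Fintype ι] {p : ι → Place K} (hp : Function.Injective p)
    {s : K} (hs : Transcendental Fq s) (e : ι → ℕ) (he : ∀ i, (p i).val s ≤ exp (-(e i : ℤ))) :
    ∑ i, e i * (p i).deg Fq ≤ Module.finrank Fq⟮s⟯ K := by
  have htail (i : ι) := (p i).finite_laurentTail_and_finrank_eq Fq
    (Int.neg_nonpos_of_nonneg (Int.natCast_nonneg (e i)))
  have (i : ι) := (htail i).1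
  have hrank (i : ι) : Module.finrank Fq ((p i).LaurentTail Fq (-(e i : ℤ)) 0) =
      e i * (p i).deg Fq := by
    have := (htail i).2
    rw [zero_sub, neg_neg] at this
    exact_mod_cast this
  have hreg : s ∈ regularAt Fq p := fun i =>
    (he i).trans (exp_le_one_iff.2 (Int.neg_nonpos_of_nonneg (Int.natCast_nonneg (e i))))
  simp only [← hrank]
  rw [← Module.finrank_pi_fintype Fq]
  exact finrank_le_finrank_adjoin (K := K) (s := (⟨s, hreg⟩ : regularAt Fq p)) hs
    (regularTail_surjective hp e) (regularTail_mul_eq_zero he)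

end Tail

section Finiteness

variable {K : Type*} [Field K] (Fq : Type*) [Field Fq] [Finite Fq] [Algebra Fq K]
  [IsFunctionFieldOfCurve Fq K] {f : K} (hf : f ≠ 0)

include Fq hf

lemma finite_val_lt_one : {v : Place K | v.val f < 1}.Finite := by
  have := Fintype.ofFinite Fq
  by_contra hinf
  obtain ⟨v, hv⟩ := Set.Infinite.nonempty hinf
  have hs : Transcendental Fq f := v.transcendental_of_val_ne_one hf hv.ne
  obtain ⟨t, ht, hcard⟩ :=
    Set.Infinite.exists_subset_card_eq hinf (Module.finrank Fq⟮f⟯ K + 1)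
  have hle := sum_mul_deg_le Fq (p := fun i : t => i.1) Subtype.val_injective hs (fun _ => 1)
    fun i => lt_one_iff_le_exp.1 (ht i.2)
  have hge : ∑ _i : t, 1 ≤ ∑ i : t, 1 * i.1.deg Fq :=
    Finset.sum_le_sum fun i _ => (i.1.deg_pos Fq).trans_eq (one_mul _).symm
  rw [Finset.sum_const, Finset.card_univ, Fintype.card_coe, hcard, smul_eq_mul, mul_one] at hge
  exact (hge.trans hle).not_gt (Nat.lt_succ_self _)

lemma finite_val_ne_one : {v : Place K | v.val f ≠ 1}.Finite := by
  refine ((finite_val_lt_one Fq hf).union (finite_val_lt_one Fq (inv_ne_zero hf))).subset ?_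
  intro v hv
  refine (lt_or_gt_of_ne hv).imp id fun h => ?_
  rw [Set.mem_ofPred_eq, map_inv₀]
  exact inv_lt_one_of_one_lt₀ h

end Finiteness

section DVR

variable (A K : Type*) [CommRing A] [IsDomain A] [IsDiscreteValuationRing A] [Field K]
  [Algebra A K] [IsFractionRing A K]

/-- The place of the fraction field of a discrete valuation ring. -/
def ofDVR : Place K where
  val := (IsDiscreteValuationRing.maximalIdeal A).valuation K
  surjective := IsDedekindDomain.HeightOneSpectrum.valuation_surjective K _

lemma ofDVR_val_le_one_iff (f : K) : (ofDVR A K).val f ≤ 1 ↔ f ∈ Set.range (algebraMap A K) := by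
  refine ⟨IsDiscreteValuationRing.exists_lift_of_le_one, ?_⟩
  rintro ⟨a, rfl⟩
  exact IsDedekindDomain.HeightOneSpectrum.valuation_le_one _ a

end DVR

end Place

section Zeros

variable {F K : Type*} [Field F] [Field K] [Algebra F K]

lemma not_isUnit_gen_adjoin {s : K} (hs : Transcendental F s) :
    ¬ IsUnit (⟨s, Algebra.self_mem_adjoin_singleton F s⟩ : Algebra.adjoin F {s}) := by
  intro hunit
  obtain ⟨⟨y, hy⟩, hsy⟩ := hunit.exists_right_inv
  rw [Algebra.adjoin_singleton_eq_range_aeval] at hy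
  obtain ⟨p, rfl⟩ := hy
  refine not_isUnit_X (IsUnit.of_mul_eq_one p (transcendental_iff_injective.1 hs ?_))
  simpa using congrArg Subtype.val hsy

lemma exists_valuationSubring_lt_one {s : K} (hs : Transcendental F s) :
    ∃ V : ValuationSubring K, (∀ c, algebraMap F K c ∈ V) ∧ V.valuation s < 1 := by
  obtain ⟨V, hAV, hIV⟩ := Ideal.image_subset_nonunits_valuationSubring
    (A := (Algebra.adjoin F {s}).toSubring) _
      (mt Ideal.span_singleton_eq_top.1 (not_isUnit_gen_adjoin hs))
  exact ⟨V, fun c => hAV (Subalgebra.algebraMap_mem (Algebra.adjoin F {s}) c),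
    V.mem_nonunits_iff.1 (hIV ⟨_, Ideal.mem_span_singleton_self _, rfl⟩)⟩

variable [IsFunctionFieldOfCurve F K]

lemma isDiscreteValuationRing_of_valuation_lt_one {V : ValuationSubring K}
    (hF : ∀ c, algebraMap F K c ∈ V) {s : K} (hs0 : s ≠ 0) (hsV : V.valuation s < 1) :
    IsDiscreteValuationRing V := by
  let : Algebra F V := ((algebraMap F K).codRestrict V hF).toAlgebra
  have : IsScalarTower F V K := IsScalarTower.of_algebraMap_eq fun _ => rfl
  have : IsNoetherianRing V := isNoetherianRing_of_faithfulSMul F K V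
  let s' : V := ⟨s, (V.valuation_le_one_iff s).1 hsV.le⟩
  have hfield : ¬ IsField V := fun h =>
    let ⟨_, ht⟩ := h.mul_inv_cancel (a := s') (mt (congrArg Subtype.val) hs0)
    hsV.ne ((V.valuation_eq_one_iff s').1 (IsUnit.of_mul_eq_one _ ht))
  have htfae : IsDiscreteValuationRing V ↔ ValuationRing V :=
    (IsDiscreteValuationRing.TFAE V hfield).out 0 1
  exact htfae.2 inferInstance

theorem exists_place_val_lt_one {s : K} (hs : Transcendental F s) :
    ∃ v : Place K, v.val s < 1 := by
  obtain ⟨V, hF, hsV⟩ := exists_valuationSubring_lt_one hs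
  have hs0 : s ≠ 0 := fun h => hs (h ▸ isAlgebraic_zero)
  have := isDiscreteValuationRing_of_valuation_lt_one hF hs0 hsV
  have hequiv : (Place.ofDVR V K).val.IsEquiv V.valuation :=
    Valuation.isEquiv_iff_val_le_one.2 fun {f} => by
      rw [Place.ofDVR_val_le_one_iff, V.valuation_le_one_iff]
      exact ⟨fun ⟨y, hy⟩ => hy ▸ y.2, fun h => ⟨⟨f, h⟩, rfl⟩⟩
  exact ⟨Place.ofDVR V K, (Valuation.isEquiv_iff_val_lt_one.1 hequiv).2 hsV⟩

end Zeros

/-! ### Divisors and Riemann's inequality -/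

/-- Divisors, as finitely supported functions on the places. -/
abbrev Divisor (K : Type*) [Field K] : Type _ := Place K →₀ ℤ

namespace Divisor
open Place

section Space

variable {K : Type*} [Field K] (Fq : Type*) [Field Fq] [Fintype Fq] [Algebra Fq K]

/-- The degree of a divisor. -/
def degree : Divisor K →ₗ[ℤ] ℤ := Finsupp.linearCombination ℤ fun v => (v.deg Fq : ℤ)

lemma degree_single (v : Place K) (n : ℤ) :
    degree Fq (Finsupp.single v n) = n * v.deg Fq :=
  Finsupp.linearCombination_single ..

/-- The Riemann-Roch space `L(D)`. -/
def space (D : Divisor K) : Submodule Fq K := ⨅ v : Place K, v.ball Fq (D v)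

variable {Fq} in
lemma mem_space {D : Divisor K} {f : K} : f ∈ space Fq D ↔ ∀ v : Place K, v.val f ≤ exp (D v) :=
  Submodule.mem_iInf _

lemma space_le_ball (D : Divisor K) (v : Place K) : space Fq D ≤ v.ball Fq (D v) := iInf_le _ v

lemma space_mono {D E : Divisor K} (h : D ≤ E) : space Fq D ≤ space Fq E :=
  iInf_mono fun v => v.ball_mono Fq (h v)

/-- The Laurent tails of the functions in `L(E)` at the places where `D` and `E` differ. -/
def spaceTail (D E : Divisor K) :
    space Fq E →ₗ[Fq] (v : (E - D).support) → v.1.LaurentTail Fq (D v) (E v) :=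
  LinearMap.pi fun v => v.1.tail Fq (D v) (E v) ∘ₗ Submodule.inclusion (space_le_ball Fq E v)

lemma ker_spaceTail_le (D E : Divisor K) :
    (spaceTail Fq D E).ker ≤ (space Fq D).submoduleOf (space Fq E) := by
  intro f hf
  refine mem_space.2 fun v => ?_
  by_cases hv : v ∈ (E - D).support
  · exact (v.tail_eq_zero_iff Fq).1 (congrFun hf ⟨v, hv⟩)
  · rw [Finsupp.notMem_support_iff, Finsupp.sub_apply, sub_eq_zero] at hv
    exact hv ▸ mem_space.1 f.2 v

variable [IsFunctionFieldOfCurve Fq K]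

lemma finite_tail_and_finrank_eq {D E : Divisor K} (h : D ≤ E) :
    Module.Finite Fq ((v : (E - D).support) → v.1.LaurentTail Fq (D v) (E v)) ∧
      (Module.finrank Fq ((v : (E - D).support) → v.1.LaurentTail Fq (D v) (E v)) : ℤ) =
        degree Fq (E - D) := by
  have htail (v : (E - D).support) := v.1.finite_laurentTail_and_finrank_eq Fq (h v)
  have (v : (E - D).support) := (htail v).1
  refine ⟨inferInstance, ?_⟩
  rw [Module.finrank_pi_fintype, Nat.cast_sum, degree, Finsupp.linearCombination_apply,
    Finsupp.sum, ← Finset.sum_coe_sort (E - D).support]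
  exact Finset.sum_congr rfl fun v _ => (htail v).2

lemma finite_space_and_finrank_le {D E : Divisor K} (h : D ≤ E) [Module.Finite Fq (space Fq D)] :
    Module.Finite Fq (space Fq E) ∧
      (Module.finrank Fq (space Fq E) : ℤ) ≤
        Module.finrank Fq (space Fq D) + degree Fq (E - D) := by
  obtain ⟨_, hrank⟩ := finite_tail_and_finrank_eq Fq h
  let φ := spaceTail Fq D E
  let ι : φ.ker →ₗ[Fq] space Fq D :=
    (Submodule.comapSubtypeEquivOfLe (space_mono Fq h)).toLinearMap ∘ₗ
      Submodule.inclusion (ker_spaceTail_le Fq D E)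
  have hι : Function.Injective ι :=
    (Submodule.comapSubtypeEquivOfLe (space_mono Fq h)).injective.comp
      (Submodule.inclusion_injective (ker_spaceTail_le Fq D E))
  have : Module.Finite Fq φ.ker := Module.Finite.of_injective ι hι
  have : Module.Finite Fq (_ ⧸ φ.ker) := Module.Finite.equiv φ.quotKerEquivRange.symm
  have hfin := Module.Finite.of_submodule_quotient φ.ker
  refine ⟨hfin, ?_⟩
  rw [← hrank, ← φ.finrank_range_add_finrank_ker, add_comm]
  exact_mod_cast add_le_add (LinearMap.finrank_le_finrank_of_injective hι)
    (Submodule.finrank_le φ.range)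

end Space
end Divisor

lemma isAlgebraic_of_forall_val_le_one {F K : Type*} [Field F] [Field K] [Algebra F K]
    [IsFunctionFieldOfCurve F K] {f : K} (h : ∀ v : Place K, v.val f ≤ 1) : IsAlgebraic F f := by
  by_contra hf
  obtain ⟨v, hv⟩ := exists_place_val_lt_one (F := F) (s := f⁻¹) (mt IsAlgebraic.inv_iff.1 hf)
  have hf0 : v.val f ≠ 0 := v.val.ne_zero_iff.2 fun h => hf (h ▸ isAlgebraic_zero)
  rw [map_inv₀, inv_lt_one₀ (zero_lt_iff.2 hf0)] at hv
  exact (h v).not_gt hv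

lemma nonempty_place (F K : Type*) [Field F] [Field K] [Algebra F K] [IsFunctionFieldOfCurve F K] :
    Nonempty (Place K) :=
  let ⟨_, ht⟩ := IsFunctionFieldOfCurve.exists_transcendental (F := F) (K := K)
  let ⟨v, _⟩ := exists_place_val_lt_one ht
  ⟨v⟩

namespace Divisor
open Place

section Finite

variable {K : Type*} [Field K] (Fq : Type*) [Field Fq] [Fintype Fq] [Algebra Fq K]
  [IsFunctionFieldOfCurve Fq K]

lemma finite_space_zero : Module.Finite Fq (space Fq (0 : Divisor K)) := by
  obtain ⟨w⟩ := nonempty_place Fq K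
  refine Module.Finite.of_injective
    (w.leadingCoeff Fq 0 ∘ₗ Submodule.inclusion (space_le_ball Fq 0 w)) ?_
  rw [← LinearMap.ker_eq_bot, LinearMap.ker_eq_bot']
  intro f hf
  have hf' : w.val f ≤ exp (0 - 1) :=
    (w.leadingCoeff_eq_zero_iff Fq (Submodule.inclusion (space_le_ball Fq 0 w) f)).1 hf
  have halg : IsAlgebraic Fq (f : K) :=
    isAlgebraic_of_forall_val_le_one fun v => mem_space.1 f.2 v
  by_contra hf0
  rw [w.val_eq_one_of_isAlgebraic (fun h => hf0 (Subtype.ext h)) halg, ← lt_exp_iff_le] at hf'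
  exact hf'.false

instance finite_space (D : Divisor K) : Module.Finite Fq (space Fq D) := by
  have := finite_space_zero (K := K) Fq
  have := (finite_space_and_finrank_le Fq (le_sup_right : 0 ≤ D ⊔ 0)).1
  exact Module.Finite.of_injective (Submodule.inclusion (space_mono Fq (le_sup_left : D ≤ D ⊔ 0)))
    (Submodule.inclusion_injective _)

lemma finrank_space_le_add {D E : Divisor K} (h : D ≤ E) :
    (Module.finrank Fq (space Fq E) : ℤ) ≤
      Module.finrank Fq (space Fq D) + degree Fq (E - D) :=
  (finite_space_and_finrank_le Fq h).2

lemma finite_coe_space (D : Divisor K) : (space Fq D : Set K).Finite :=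
  Module.finite_of_finite Fq (M := space Fq D)

lemma ncard_space (D : Divisor K) :
    (space Fq D : Set K).ncard = Fintype.card Fq ^ Module.finrank Fq (space Fq D) :=
  (Module.natCard_eq_pow_finrank (K := Fq) (V := space Fq D)).trans
    (by rw [Nat.card_eq_fintype_card])

end Finite
end Divisor

lemma IsFunctionFieldOfCurve.exists_isIntegral_basis {F K : Type*} [Field F] [Field K] [Algebra F K]
    [IsFunctionFieldOfCurve F K] {f : K} (hf : Transcendental F f) :
    ∃ y : Fin (Module.finrank F⟮f⟯ K) → K, LinearIndependent F⟮f⟯ y ∧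
      ∀ j, IsIntegral (Algebra.adjoin F {f}) (y j) := by
  have := IsFunctionFieldOfCurve.finiteDimensional_adjoin hf
  obtain ⟨s, b, hb⟩ :=
    FiniteDimensional.exists_is_basis_integral (Algebra.adjoin F {f}) F⟮f⟯ K
  let e := Fintype.equivFinOfCardEq (Module.finrank_eq_card_basis b).symm
  exact ⟨b.reindex e, (b.reindex e).linearIndependent, fun j => by
    rw [Module.Basis.reindex_apply]
    exact hb _⟩

namespace Divisor
open Place

lemma exists_forall_apply_le_natCast {K : Type*} [Field K] (D : Divisor K) :
    ∃ n : ℕ, ∀ v, D v ≤ n := by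
  obtain ⟨b, hb⟩ := (D.finite_range).bddAbove
  exact ⟨b.toNat, fun v => (hb (Set.mem_range_self v)).trans b.self_le_toNat⟩

section Div

variable {K : Type*} [Field K] (Fq : Type*) [Field Fq] [Fintype Fq] [Algebra Fq K]
  [IsFunctionFieldOfCurve Fq K]

/-- The divisor of a nonzero function. The divisor of the zero function is zero, as `log 0 = 0`. -/
def div (f : K) : Divisor K :=
  Finsupp.ofSupportFinite (fun v => -log (v.val f)) (by
    rcases eq_or_ne f 0 with rfl | hf
    · simp [Function.support]
    · refine (finite_val_ne_one Fq hf).subset fun v hv h => hv ?_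
      simp [h])

lemma div_apply (f : K) (v : Place K) : div Fq f v = -log (v.val f) := rfl

lemma val_eq_exp {f : K} (hf : f ≠ 0) (v : Place K) : v.val f = exp (-(div Fq f v)) := by
  rw [div_apply, neg_neg, exp_log (v.val.ne_zero_iff.2 hf)]

@[simp] lemma div_zero : div Fq (0 : K) = 0 := by
  ext v
  simp [div_apply]

lemma div_mul {f g : K} (hf : f ≠ 0) (hg : g ≠ 0) : div Fq (f * g) = div Fq f + div Fq g := by
  ext v
  rw [Finsupp.add_apply, div_apply, div_apply, div_apply, map_mul,
    log_mul (v.val.ne_zero_iff.2 hf) (v.val.ne_zero_iff.2 hg), neg_add]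

@[simp] lemma div_inv (f : K) : div Fq f⁻¹ = -div Fq f := by
  ext v
  rw [Finsupp.neg_apply, div_apply, div_apply, map_inv₀, log_inv]

lemma div_eq_zero_of_isAlgebraic {f : K} (hf : IsAlgebraic Fq f) : div Fq f = 0 := by
  rcases eq_or_ne f 0 with rfl | h0
  · exact div_zero Fq
  · ext v
    rw [div_apply, v.val_eq_one_of_isAlgebraic h0 hf, log_one, neg_zero, Finsupp.zero_apply]

lemma val_le_exp_negPart_div {f : K} (hf : f ≠ 0) (v : Place K) :
    v.val f ≤ exp ((div Fq f)⁻ v) := by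
  rw [val_eq_exp Fq hf, exp_le_exp]
  exact neg_le_negPart (div Fq f) v

variable {Fq} in
lemma mem_space_iff {D : Divisor K} {f : K} (h0 : f ≠ 0) :
    f ∈ space Fq D ↔ 0 ≤ D + div Fq f := by
  refine mem_space.trans (forall_congr' fun v => ?_)
  rw [val_eq_exp Fq h0, exp_le_exp, Finsupp.add_apply, Finsupp.zero_apply, neg_le_iff_add_nonneg]

lemma finrank_space_le_sub_div (D : Divisor K) {h : K} (hh : h ≠ 0) :
    Module.finrank Fq (space Fq D) ≤ Module.finrank Fq (space Fq (D - div Fq h)) := by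
  let φ : space Fq D →ₗ[Fq] space Fq (D - div Fq h) :=
    (LinearMap.mulLeft Fq h ∘ₗ (space Fq D).subtype).codRestrict _ fun f => by
      refine mem_space.2 fun v => ?_
      rw [Finsupp.sub_apply, sub_eq_neg_add, exp_add, ← val_eq_exp Fq hh]
      exact (map_mul v.val _ _).trans_le (mul_le_mul_right (mem_space.1 f.2 v) _)
  refine LinearMap.finrank_le_finrank_of_injective (f := φ) fun f g hfg => ?_
  exact Subtype.ext (mul_left_cancel₀ hh (congrArg Subtype.val hfg))

lemma degree_posPart_div_le {f : K} (hf : Transcendental Fq f) :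
    degree Fq (div Fq f)⁺ ≤ Module.finrank Fq⟮f⟯ K := by
  have hf0 : f ≠ 0 := fun h => hf (h ▸ isAlgebraic_zero)
  have hpos (v : Place K) : (div Fq f)⁺ v = (div Fq f v).toNat := (Int.toNat_eq_max _).symm
  have hle := sum_mul_deg_le Fq (p := fun i : (div Fq f)⁺.support => i.1) Subtype.val_injective hf
    (fun i => (div Fq f i).toNat) fun i => by
      have hi : (div Fq f)⁺ i ≠ 0 := Finsupp.mem_support_iff.1 i.2
      rw [hpos] at hi
      rw [val_eq_exp Fq hf0, exp_le_exp]
      lia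
  rw [degree, Finsupp.linearCombination_apply, Finsupp.sum, ← Finset.sum_coe_sort]
  simp only [hpos, smul_eq_mul]
  exact_mod_cast hle

/-- The exponent `c` bounds the poles of all the `y j`; it exists because `y j` is integral over
`F[f]`, so that it has poles only at the poles of `f`. -/
lemma exists_forall_val_le_exp_mul {ι : Type*} [Finite ι] {f : K} (hf : f ≠ 0) {y : ι → K}
    (hy0 : ∀ j, y j ≠ 0) (hy : ∀ j, IsIntegral (Algebra.adjoin Fq {f}) (y j)) :
    ∃ c : ℕ, ∀ j (v : Place K), v.val (y j) ≤ exp (c * (div Fq f)⁻ v) := by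
  have := Fintype.ofFinite ι
  choose c hc using fun j => exists_forall_apply_le_natCast (-div Fq (y j))
  refine ⟨∑ j, c j, fun j v => ?_⟩
  have hP : 0 ≤ (div Fq f)⁻ v := negPart_nonneg (div Fq f) v
  rcases hP.eq_or_lt with h | h
  · have hfv := val_le_exp_negPart_div Fq hf v
    rw [← h, exp_zero] at hfv
    rw [← h, mul_zero, exp_zero]
    exact v.val_le_one_of_isIntegral_adjoin hfv (hy j)
  · rw [val_eq_exp Fq (hy0 j), exp_le_exp]
    have hcj : c j ≤ ∑ j, c j := Finset.single_le_sum (fun _ _ => Nat.zero_le _) (Finset.mem_univ j)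
    calc -div Fq (y j) v ≤ c j := hc j v
      _ ≤ (∑ j, c j : ℕ) := by exact_mod_cast hcj
      _ ≤ (∑ j, c j : ℕ) * (div Fq f)⁻ v := le_mul_of_one_le_right (Nat.cast_nonneg _) h

omit [Fintype Fq] [IsFunctionFieldOfCurve Fq K] in
lemma linearIndependent_pow_mul {ι : Type*} {f : K} (hf : Transcendental Fq f) {y : ι → K}
    (hy : LinearIndependent Fq⟮f⟯ y) (n : ℕ) :
    LinearIndependent Fq fun x : Fin n × ι => f ^ (x.1 : ℕ) * y x.2 := by
  have hpow : LinearIndependent Fq fun i : ℕ => f ^ i := by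
    simpa [Function.comp_def] using (Polynomial.basisMonomials Fq).linearIndependent.map'
      (aeval f).toLinearMap (LinearMap.ker_eq_bot.2 (transcendental_iff_injective.1 hf))
  have hgen : LinearIndependent Fq fun i : Fin n => AdjoinSimple.gen Fq f ^ (i : ℕ) :=
    LinearIndependent.of_comp Fq⟮f⟯.val.toLinearMap (hpow.comp _ Fin.val_injective)
  exact linearIndependent_smul hgen hy

lemma exists_mul_le_finrank_space {f : K} (hf : Transcendental Fq f) : ∃ c : ℕ, ∀ n : ℕ,
    Module.finrank Fq⟮f⟯ K * (n + 1) ≤ Module.finrank Fq (space Fq ((n + c) • (div Fq f)⁻)) := by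
  have hf0 : f ≠ 0 := fun h => hf (h ▸ isAlgebraic_zero)
  obtain ⟨y, hy, hint⟩ := IsFunctionFieldOfCurve.exists_isIntegral_basis hf
  obtain ⟨c, hc⟩ := exists_forall_val_le_exp_mul Fq hf0 hy.ne_zero hint
  refine ⟨c, fun n => ?_⟩
  have hmem (x : Fin (n + 1) × Fin (Module.finrank Fq⟮f⟯ K)) :
      f ^ (x.1 : ℕ) * y x.2 ∈ space Fq ((n + c) • (div Fq f)⁻) := mem_space.2 fun v => by
    have hP : 0 ≤ (div Fq f)⁻ v := negPart_nonneg (div Fq f) v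
    have hx : ((x.1 : ℕ) : ℤ) ≤ n := by exact_mod_cast x.1.is_le
    rw [map_mul, map_pow, Finsupp.smul_apply, add_smul, exp_add, nsmul_eq_mul, nsmul_eq_mul]
    refine mul_le_mul' ?_ (hc x.2 v)
    calc v.val f ^ (x.1 : ℕ) ≤ exp ((div Fq f)⁻ v) ^ (x.1 : ℕ) :=
          pow_le_pow_left₀ zero_le (val_le_exp_negPart_div Fq hf0 v) _
      _ = exp ((x.1 : ℕ) * (div Fq f)⁻ v) := by rw [← exp_nsmul, nsmul_eq_mul]
      _ ≤ exp (n * (div Fq f)⁻ v) := exp_le_exp.2 (mul_le_mul_of_nonneg_right hx hP)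
  have hind : LinearIndependent Fq fun x =>
      (⟨_, hmem x⟩ : space Fq ((n + c) • (div Fq f)⁻)) :=
    LinearIndependent.of_comp (Submodule.subtype _) (linearIndependent_pow_mul Fq hf hy (n + 1))
  simpa [mul_comm] using hind.fintype_card_le_finrank

omit [Fintype Fq] [IsFunctionFieldOfCurve Fq K] in
lemma adjoin_simple_inv (f : K) : Fq⟮f⁻¹⟯ = Fq⟮f⟯ := by
  have hle (g : K) : Fq⟮g⁻¹⟯ ≤ Fq⟮g⟯ :=
    adjoin_simple_le_iff.2 (inv_mem (mem_adjoin_simple_self Fq g))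
  exact (hle f).antisymm (by simpa only [inv_inv] using hle f⁻¹)

theorem degree_negPart_div {f : K} (hf : Transcendental Fq f) :
    degree Fq (div Fq f)⁻ = Module.finrank Fq⟮f⟯ K := by
  have hle := degree_posPart_div_le Fq (mt IsAlgebraic.inv_iff.1 hf)
  rw [div_inv, posPart_neg, adjoin_simple_inv] at hle
  refine hle.antisymm ?_
  obtain ⟨c, hc⟩ := exists_mul_le_finrank_space Fq hf
  set m := Module.finrank Fq⟮f⟯ K
  set P := (div Fq f)⁻
  set l := Module.finrank Fq (space Fq (0 : Divisor K))
  have hgrowth (n : ℕ) : (m : ℤ) * (n + 1) ≤ l + (n + c) * degree Fq P := by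
    have hupper := finrank_space_le_add Fq (nsmul_nonneg (negPart_nonneg (div Fq f)) (n + c))
    rw [sub_zero, map_nsmul, nsmul_eq_mul, Nat.cast_add] at hupper
    exact le_trans (by exact_mod_cast hc n) hupper
  by_contra! hlt
  have hP : degree Fq P ≤ m - 1 := Int.le_sub_one_of_lt hlt
  have := IsFunctionFieldOfCurve.finiteDimensional_adjoin hf
  have hm : (0 : ℤ) < m := Int.natCast_pos.2 Module.finrank_pos
  have hlarge := hgrowth (l + c * m)
  push_cast at hlarge
  nlinarith [mul_le_mul_of_nonneg_left hP (by positivity : (0 : ℤ) ≤ l + c * m + c)]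

/-- The product formula. -/
theorem degree_div (f : K) : degree Fq (div Fq f) = 0 := by
  by_cases hf : IsAlgebraic Fq f
  · rw [div_eq_zero_of_isAlgebraic Fq hf, map_zero]
  · have hzeros := degree_negPart_div Fq (mt IsAlgebraic.inv_iff.1 hf)
    rw [div_inv, negPart_neg, adjoin_simple_inv] at hzeros
    rw [← posPart_sub_negPart (div Fq f), map_sub, hzeros, degree_negPart_div Fq hf, sub_self]

end Div
end Divisor

lemma Place.val_aeval_lt_one_iff {F K : Type*} [Field F] [Fintype F] [Field K] [Algebra F K]
    (v : Place K) {t : K} (ht : v.val t ≤ 1) (p : F[X]) :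
    v.val (aeval t p) < 1 ↔
      aeval (IsLocalRing.residue v.val.valuationSubring ⟨t, ht⟩) p = 0 := by
  have hval : aeval t p = (p.eval₂ (v.constants F) ⟨t, ht⟩ : v.val.valuationSubring) :=
    (hom_eval₂ p (v.constants F) v.val.valuationSubring.subtype ⟨t, ht⟩).symm
  have hres : aeval (IsLocalRing.residue v.val.valuationSubring ⟨t, ht⟩) p =
      IsLocalRing.residue _ (p.eval₂ (v.constants F) ⟨t, ht⟩) :=
    (hom_eval₂ p (v.constants F) (IsLocalRing.residue _) ⟨t, ht⟩).symm
  rw [hval, hres, residue_eq_zero_iff]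

lemma Place.exists_val_aeval_lt_one (F : Type*) {K : Type*} [Field F] [Finite F] [Field K]
    [Algebra F K] [IsFunctionFieldOfCurve F K] (v : Place K) {t : K} (ht : v.val t ≤ 1) :
    ∃ p : F[X], p ≠ 0 ∧ v.val (aeval t p) < 1 := by
  have := Fintype.ofFinite F
  obtain ⟨p, hp0, hp⟩ := Algebra.IsAlgebraic.isAlgebraic (R := F)
    (IsLocalRing.residue v.val.valuationSubring ⟨t, ht⟩)
  exact ⟨p, hp0, (v.val_aeval_lt_one_iff ht p).2 hp⟩

namespace Divisor
open Place

section Riemann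

variable {K : Type*} [Field K] (Fq : Type*) [Field Fq] [Fintype Fq] [Algebra Fq K]
  [IsFunctionFieldOfCurve Fq K]

omit [Fintype Fq] in
lemma exists_aeval_ne_zero_forall_val_lt_one [Finite Fq] {t : K} (ht : Transcendental Fq t)
    (S : Finset (Place K)) :
    ∃ p : Fq[X], aeval t p ≠ 0 ∧ ∀ v ∈ S, v.val t ≤ 1 → v.val (aeval t p) < 1 := by
  have := Fintype.ofFinite Fq
  choose! p hp0 hp using fun (v : Place K) (hv : v.val t ≤ 1) => v.exists_val_aeval_lt_one Fq hv
  classical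
  let T := S.filter fun v => v.val t ≤ 1
  have hne (v : Place K) (hv : v ∈ T) : p v ≠ 0 := hp0 v (Finset.mem_filter.1 hv).2
  refine ⟨∏ v ∈ T, p v, fun h => Finset.prod_ne_zero_iff.2 hne (transcendental_iff.1 ht _ h),
    fun v hv hvt => ?_⟩
  rw [v.val_aeval_lt_one_iff hvt, map_prod]
  exact Finset.prod_eq_zero (Finset.mem_filter.2 ⟨hv, hvt⟩)
    ((v.val_aeval_lt_one_iff hvt _).1 (hp v hvt))

lemma exists_le_div {t : K} (ht : Transcendental Fq t) (D : Divisor K) :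
    ∃ h : K, h ≠ 0 ∧ ∀ v : Place K, v.val t ≤ 1 → D v ≤ div Fq h v := by
  obtain ⟨p, hp0, hp⟩ := exists_aeval_ne_zero_forall_val_lt_one Fq ht D.support
  obtain ⟨n, hn⟩ := exists_forall_apply_le_natCast D
  refine ⟨aeval t p ^ n, pow_ne_zero n hp0, fun v hv => ?_⟩
  have hdiv : div Fq (aeval t p ^ n) v = n * div Fq (aeval t p) v := by
    rw [div_apply, div_apply, map_pow, log_pow, nsmul_eq_mul, mul_neg]
  rw [hdiv]
  by_cases hvD : v ∈ D.support
  · have hpos := hp v hvD hv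
    rw [val_eq_exp Fq hp0, exp_lt_one_iff, neg_lt_zero] at hpos
    exact (hn v).trans (le_mul_of_one_le_right (Nat.cast_nonneg n) hpos)
  · have hint := v.val_le_one_of_isIntegral_adjoin hv (isIntegral_algebraMap
      (x := (⟨_, p.aeval_mem_adjoin_singleton Fq t⟩ : Algebra.adjoin Fq {t})))
    change v.val (aeval t p) ≤ 1 at hint
    rw [val_eq_exp Fq hp0, exp_le_one_iff, neg_nonpos] at hint
    rw [Finsupp.notMem_support_iff.1 hvD]
    exact mul_nonneg (Nat.cast_nonneg n) hint

lemma one_le_negPart_div {f : K} (hf : f ≠ 0) {v : Place K} (hv : ¬v.val f ≤ 1) :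
    1 ≤ (div Fq f)⁻ v := by
  rw [val_eq_exp Fq hf, exp_le_one_iff, not_le] at hv
  exact (Int.add_one_le_of_lt hv).trans (neg_le_negPart (div Fq f) v)

/-- Riemann's inequality. -/
theorem exists_degree_sub_le_finrank_space :
    ∃ g : ℤ, ∀ D : Divisor K, degree Fq D - g ≤ Module.finrank Fq (space Fq D) := by
  obtain ⟨t, ht⟩ := IsFunctionFieldOfCurve.exists_transcendental (F := Fq) (K := K)
  have ht0 : t ≠ 0 := fun h => ht (h ▸ isAlgebraic_zero)
  obtain ⟨c, hc⟩ := exists_mul_le_finrank_space Fq ht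
  set m := Module.finrank Fq⟮t⟯ K
  set P := (div Fq t)⁻
  have hP : degree Fq P = m := degree_negPart_div Fq ht
  refine ⟨(c - 1) * m, fun D => ?_⟩
  obtain ⟨h, h0, hh⟩ := exists_le_div Fq ht D
  obtain ⟨n, hn⟩ := exists_forall_apply_le_natCast (D - div Fq h)
  have hle : D - div Fq h ≤ (n + c) • P := fun v => by
    rw [Finsupp.smul_apply, nsmul_eq_mul]
    by_cases hv : v.val t ≤ 1
    · exact (sub_nonpos.2 (hh v hv)).trans
        (mul_nonneg (Nat.cast_nonneg _) (negPart_nonneg (div Fq t) v))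
    · calc (D - div Fq h) v ≤ n := hn v
        _ ≤ (n + c : ℕ) := by simp
        _ ≤ (n + c : ℕ) * P v :=
          le_mul_of_one_le_right (Nat.cast_nonneg _) (one_le_negPart_div Fq ht0 hv)
  have hspace : (m : ℤ) * (n + 1) ≤ Module.finrank Fq (space Fq ((n + c) • P)) :=
    mod_cast hc n
  have hadd := finrank_space_le_add Fq hle
  have hdiv := finrank_space_le_sub_div Fq (D - div Fq h) (inv_ne_zero h0)
  rw [div_inv, sub_neg_eq_add, sub_add_cancel] at hdiv
  rw [map_sub, map_sub, degree_div, map_nsmul, hP, nsmul_eq_mul] at hadd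
  push_cast at hadd
  linarith

end Riemann
end Divisor

/-! ### Counting effective divisors -/

namespace Divisor
open Place

section Effective

variable {K : Type*} [Field K] (Fq : Type*) [Field Fq] [Fintype Fq] [Algebra Fq K]

variable (K) in
/-- The effective divisors of degree `n`. -/
def effective (n : ℕ) : Set (Divisor K) := {E | 0 ≤ E ∧ degree Fq E = n}

lemma apply_mul_deg_le_degree {E : Divisor K} (hE : 0 ≤ E) (v : Place K) :
    E v * v.deg Fq ≤ degree Fq E := by
  have hterm (v : Place K) : 0 ≤ E v * v.deg Fq := mul_nonneg (hE v) (Nat.cast_nonneg _)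
  rw [degree, Finsupp.linearCombination_apply, Finsupp.sum]
  by_cases hv : v ∈ E.support
  · exact Finset.single_le_sum (f := fun v => E v * v.deg Fq) (fun v _ => hterm v) hv
  · rw [Finsupp.notMem_support_iff.1 hv, zero_mul]
    exact Finset.sum_nonneg fun v _ => hterm v

lemma exists_ne_zero_mem_space {D : Divisor K} (h : 0 < Module.finrank Fq (space Fq D)) :
    ∃ f ∈ space Fq D, f ≠ 0 := by
  have := Module.nontrivial_of_finrank_pos h
  obtain ⟨f, hf⟩ := exists_ne (0 : space Fq D)
  exact ⟨f, f.2, fun h => hf (Subtype.ext h)⟩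

variable [IsFunctionFieldOfCurve Fq K]

lemma finite_deg_le (N : ℕ) : {v : Place K | v.deg Fq ≤ N}.Finite := by
  obtain ⟨t, ht⟩ := IsFunctionFieldOfCurve.exists_transcendental (F := Fq) (K := K)
  have ht0 : t ≠ 0 := fun h => ht (h ▸ isAlgebraic_zero)
  -- `p` vanishes on every extension of `Fq` of degree at most `N`.
  let p : Fq[X] := X ^ (Fintype.card Fq ^ N.factorial) - X
  have hp : p ≠ 0 :=
    FiniteField.X_pow_card_pow_sub_X_ne_zero Fq N.factorial_ne_zero Fintype.one_lt_card
  have hpt : aeval t p ≠ 0 := fun h => hp (transcendental_iff.1 ht p h)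
  refine ((finite_val_ne_one Fq ht0).union (finite_val_ne_one Fq hpt)).subset fun v hv => ?_
  rcases ne_or_eq (v.val t) 1 with h | h
  · exact Or.inl h
  · refine Or.inr (ne_of_lt ((v.val_aeval_lt_one_iff h.le p).2 ?_))
    have := Module.finite_of_finite Fq (M := v.Residue)
    have := Fintype.ofFinite v.Residue
    obtain ⟨k, hk⟩ := Nat.dvd_factorial (v.deg_pos Fq) hv
    have hcard : Fintype.card v.Residue = Fintype.card Fq ^ v.deg Fq :=
      Module.card_eq_pow_finrank
    simp only [p, map_sub, map_pow, aeval_X]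
    rw [hk, pow_mul, ← hcard, FiniteField.pow_card_pow, sub_self]

lemma finite_effective (n : ℕ) : (effective K Fq n).Finite := by
  classical
  let T := (finite_deg_le (K := K) Fq n).toFinset
  refine (Set.finite_Icc 0 (Finsupp.indicator T fun _ _ => (n : ℤ))).subset
    fun E ⟨hE, hn⟩ => ⟨hE, fun v => ?_⟩
  have hle := apply_mul_deg_le_degree Fq hE v
  have hdeg : (0 : ℤ) < v.deg Fq := Int.natCast_pos.2 (v.deg_pos Fq)
  rw [hn] at hle
  rw [Finsupp.indicator_apply]
  split_ifs with hv
  · exact (le_mul_of_one_le_right (hE v) hdeg).trans hle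
  · by_contra! hEv
    refine hv ((Set.Finite.mem_toFinset _).2 ?_)
    exact_mod_cast (le_mul_of_one_le_left hdeg.le hEv).trans hle

variable {Fq} in
lemma add_div_mem_effective {D : Divisor K} {n : ℕ} (hD : degree Fq D = n) {f : K}
    (hf : f ∈ space Fq D) (h0 : f ≠ 0) : D + div Fq f ∈ effective K Fq n :=
  ⟨(mem_space_iff h0).1 hf, by rw [map_add, degree_div, add_zero, hD]⟩

lemma finrank_space_le {D : Divisor K} {n : ℕ} (hD : degree Fq D = n) :
    Module.finrank Fq (space Fq D) ≤ n + Module.finrank Fq (space Fq (0 : Divisor K)) := by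
  rcases Nat.eq_zero_or_pos (Module.finrank Fq (space Fq D)) with h | h
  · exact h.trans_le (Nat.zero_le _)
  obtain ⟨f, hf, h0⟩ := exists_ne_zero_mem_space Fq h
  obtain ⟨hE, hn⟩ := add_div_mem_effective hD hf h0
  have hle := finrank_space_le_sub_div Fq D (inv_ne_zero h0)
  rw [div_inv, sub_neg_eq_add] at hle
  have hadd := finrank_space_le_add Fq hE
  rw [sub_zero, hn] at hadd
  lia

/-- Every effective divisor of degree `n` is linearly equivalent to `F + B - E₀`, for one of the
finitely many effective divisors `F` of the degree `r` of `E₀`, if `B` has degree `n` and `r` is so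
large that all divisors of degree `r` are linearly equivalent to an effective one. -/
lemma ncard_effective_le {n r : ℕ} {B E₀ : Divisor K} (hB : degree Fq B = n)
    (hE₀ : degree Fq E₀ = r)
    (hr : ∀ D : Divisor K, degree Fq D = r → 0 < Module.finrank Fq (space Fq D)) :
    (effective K Fq n).ncard ≤ (effective K Fq r).ncard *
      Fintype.card Fq ^ (n + Module.finrank Fq (space Fq (0 : Divisor K))) := by
  set l := Module.finrank Fq (space Fq (0 : Divisor K))
  let system (F : Divisor K) : Set (Divisor K) :=
    (fun f => F + B - E₀ + div Fq f) '' space Fq (F + B - E₀)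
  have hfin (F : Divisor K) : (system F).Finite := (finite_coe_space Fq _).image _
  let R := (finite_effective (K := K) Fq r).toFinset
  have hsub : effective K Fq n ⊆ ⋃ F ∈ R, system F := fun E ⟨hE0, hEn⟩ => by
    have hdeg : degree Fq (E - B + E₀) = r := by rw [map_add, map_sub, hEn, hB, hE₀]; ring
    obtain ⟨f, hf, h0⟩ := exists_ne_zero_mem_space Fq (hr _ hdeg)
    have hEF : E - B + E₀ + div Fq f + B - E₀ + div Fq f⁻¹ = E := by rw [div_inv]; abel
    refine Set.mem_iUnion₂.2 ⟨_, (Set.Finite.mem_toFinset _).2 (add_div_mem_effective hdeg hf h0),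
      f⁻¹, ?_, hEF⟩
    rw [SetLike.mem_coe, mem_space_iff (inv_ne_zero h0), hEF]
    exact hE0
  have hcard (F : Divisor K) (hF : F ∈ R) : (system F).ncard ≤ Fintype.card Fq ^ (n + l) := by
    obtain ⟨-, hFr⟩ := (Set.Finite.mem_toFinset _).1 hF
    refine (Set.ncard_image_le (finite_coe_space Fq _)).trans ((ncard_space Fq _).trans_le ?_)
    refine Nat.pow_le_pow_right Fintype.card_pos (finrank_space_le Fq ?_)
    rw [map_sub, map_add, hFr, hB, hE₀]
    ring
  calc (effective K Fq n).ncard ≤ (⋃ F ∈ R, system F).ncard :=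
        Set.ncard_le_ncard hsub (R.finite_toSet.biUnion fun F _ => hfin F)
    _ ≤ ∑ F ∈ R, (system F).ncard := R.set_ncard_biUnion_le system
    _ ≤ R.card • Fintype.card Fq ^ (n + l) := Finset.sum_le_card_nsmul _ _ _ hcard
    _ = _ := by rw [smul_eq_mul, Set.ncard_eq_toFinset_card _ (finite_effective Fq r)]

theorem exists_ncard_effective_le :
    ∃ C : ℕ, ∀ n : ℕ, (effective K Fq n).ncard ≤ C * Fintype.card Fq ^ n := by
  obtain ⟨g, hg⟩ := exists_degree_sub_le_finrank_space (K := K) Fq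
  obtain ⟨w⟩ := nonempty_place Fq K
  let r := g.toNat.succ * w.deg Fq
  have hgr : g < r := by
    have hle : g.toNat.succ ≤ r := Nat.le_mul_of_pos_right _ (w.deg_pos Fq)
    lia
  have hr (D : Divisor K) (hD : degree Fq D = r) : 0 < Module.finrank Fq (space Fq D) := by
    have := hg D
    lia
  have hE₀ : degree Fq (Finsupp.single w (g.toNat.succ : ℤ)) = r := by
    rw [degree_single, Nat.cast_mul]
  refine ⟨(effective K Fq r).ncard *
    Fintype.card Fq ^ Module.finrank Fq (space Fq (0 : Divisor K)), fun n => ?_⟩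
  rcases (effective K Fq n).eq_empty_or_nonempty with h | ⟨B, -, hB⟩
  · rw [h, Set.ncard_empty]
    exact Nat.zero_le _
  · refine (ncard_effective_le Fq hB hE₀ hr).trans_eq ?_
    rw [pow_add]
    ring

lemma exists_setOf_div_eq_subset (E : Divisor K) :
    ∃ f₀ : K, {f | div Fq f = E} ⊆ (f₀ * ·) '' (space Fq (0 : Divisor K) : Set K) := by
  by_cases h : ∃ f₀ ≠ 0, div Fq f₀ = E
  · obtain ⟨f₀, h0, hf₀⟩ := h
    refine ⟨f₀, fun f hf => ⟨f₀⁻¹ * f, ?_, mul_inv_cancel_left₀ h0 f⟩⟩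
    rcases eq_or_ne f 0 with rfl | hf0
    · rw [mul_zero]
      exact zero_mem _
    · rw [SetLike.mem_coe, mem_space_iff (mul_ne_zero (inv_ne_zero h0) hf0),
        div_mul Fq (inv_ne_zero h0) hf0, div_inv, hf₀, Set.mem_ofPred.1 hf, neg_add_cancel,
        add_zero]
  · refine ⟨0, fun f hf => ⟨0, zero_mem _, ?_⟩⟩
    by_contra hf0
    exact h ⟨f, fun h0 => hf0 ((mul_zero 0).trans h0.symm), hf⟩

/-- The map `f ↦ D + div f` from `L(D)` has values in the effective divisors even at `f = 0`, as
`div 0 = 0` and `D` is effective. -/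
lemma ncard_space_le_mul_ncard_effective {D : Divisor K} {n : ℕ} (hD : D ∈ effective K Fq n) :
    (space Fq D : Set K).ncard ≤
      (space Fq (0 : Divisor K) : Set K).ncard * (effective K Fq n).ncard := by
  classical
  rw [Set.ncard_eq_toFinset_card _ (finite_coe_space Fq D),
    Set.ncard_eq_toFinset_card _ (finite_effective Fq n)]
  refine Finset.card_le_mul_card_image_of_maps_to (f := fun f => D + div Fq f) (fun f hf => ?_) _
    fun E _ => ?_
  · refine (Set.Finite.mem_toFinset _).2 ?_
    replace hf := (Set.Finite.mem_toFinset _).1 hf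
    rcases eq_or_ne f 0 with rfl | h0
    · rwa [div_zero, add_zero]
    · exact add_div_mem_effective hD.2 hf h0
  · obtain ⟨f₀, hf₀⟩ := exists_setOf_div_eq_subset Fq (E - D)
    have hfin := finite_coe_space Fq (0 : Divisor K)
    rw [← Set.ncard_coe_finset]
    refine (Set.ncard_le_ncard (fun f hf => hf₀ ?_) (hfin.image _)).trans
      (Set.ncard_image_le hfin)
    exact eq_sub_of_add_eq' (Finset.mem_filter.1 hf).2

theorem exists_le_ncard_effective (w : Place K) :
    ∃ c : ℕ, ∀ k : ℕ, Fintype.card Fq ^ (k * w.deg Fq) ≤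
      c * (effective K Fq (k * w.deg Fq)).ncard := by
  obtain ⟨g, hg⟩ := exists_degree_sub_le_finrank_space (K := K) Fq
  refine ⟨Fintype.card Fq ^ g.toNat * (space Fq (0 : Divisor K) : Set K).ncard, fun k => ?_⟩
  let D : Divisor K := Finsupp.single w (k : ℤ)
  have hdeg : degree Fq D = (k * w.deg Fq : ℕ) := by rw [degree_single, Nat.cast_mul]
  have hD : D ∈ effective K Fq (k * w.deg Fq) :=
    ⟨Finsupp.single_nonneg.2 (Nat.cast_nonneg k), hdeg⟩
  have hrank : k * w.deg Fq ≤ g.toNat + Module.finrank Fq (space Fq D) := by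
    have := hg D
    lia
  calc Fintype.card Fq ^ (k * w.deg Fq)
      ≤ Fintype.card Fq ^ (g.toNat + Module.finrank Fq (space Fq D)) :=
        Nat.pow_le_pow_right Fintype.card_pos hrank
    _ = Fintype.card Fq ^ g.toNat * (space Fq D : Set K).ncard := by rw [pow_add, ncard_space]
    _ ≤ _ := by
      rw [mul_assoc]
      exact Nat.mul_le_mul_left _ (ncard_space_le_mul_ncard_effective Fq hD)

end Effective

section Split

variable {K K' : Type*} [Field K] [Field K'] (Fq : Type*) [Field Fq] [Fintype Fq] [Algebra Fq K]
  [Algebra Fq K']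

lemma degree_mapDomain {w : Place K → Place K'} (hw : ∀ v, (w v).deg Fq = v.deg Fq)
    (E : Divisor K) : degree Fq (E.mapDomain w) = degree Fq E := by
  rw [degree, Finsupp.linearCombination_mapDomain, degree]
  congr 2
  funext v
  exact congrArg Nat.cast (hw v)

lemma mapDomain_mem_effective {w : Place K → Place K'} (hw : ∀ v, (w v).deg Fq = v.deg Fq)
    {n : ℕ} {E : Divisor K} (hE : E ∈ effective K Fq n) :
    E.mapDomain w ∈ effective K' Fq n :=
  ⟨Finset.sum_nonneg fun v _ => Finsupp.single_nonneg.2 (hE.1 v),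
    (degree_mapDomain Fq hw E).trans hE.2⟩

lemma injective_mapDomain_add_mapDomain {α β : Type*} {w₁ w₂ : α → β}
    (hinj : Function.Injective (Sum.elim w₁ w₂)) :
    Function.Injective fun x : (α →₀ ℤ) × (α →₀ ℤ) => x.1.mapDomain w₁ + x.2.mapDomain w₂ := by
  have heq (x : (α →₀ ℤ) × (α →₀ ℤ)) : x.1.mapDomain w₁ + x.2.mapDomain w₂ =
      (Finsupp.sumElim x.1 x.2).mapDomain (Sum.elim w₁ w₂) := by
    rw [Finsupp.sumElim_eq_add, Finsupp.mapDomain_add, ← Finsupp.mapDomain_comp,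
      ← Finsupp.mapDomain_comp, Sum.elim_comp_inl, Sum.elim_comp_inr]
  simp only [heq]
  intro x y h
  have h' := Finsupp.mapDomain_injective hinj h
  exact Prod.ext (Finsupp.ext fun v => DFunLike.congr_fun h' (Sum.inl v))
    (Finsupp.ext fun v => DFunLike.congr_fun h' (Sum.inr v))

variable [IsFunctionFieldOfCurve Fq K] [IsFunctionFieldOfCurve Fq K']

lemma sum_ncard_mul_ncard_effective_le {w₁ w₂ : Place K → Place K'}
    (h₁ : ∀ v, (w₁ v).deg Fq = v.deg Fq) (h₂ : ∀ v, (w₂ v).deg Fq = v.deg Fq)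
    (hinj : Function.Injective (Sum.elim w₁ w₂)) {e : ℕ} (he : 0 < e) (k : ℕ) :
    ∑ p ∈ Finset.HasAntidiagonal.antidiagonal k,
      (effective K Fq (p.1 * e)).ncard * (effective K Fq (p.2 * e)).ncard ≤
        (effective K' Fq (k * e)).ncard := by
  classical
  let A := Finset.HasAntidiagonal.antidiagonal k
  let pairs (p : ℕ × ℕ) := effective K Fq (p.1 * e) ×ˢ effective K Fq (p.2 * e)
  have hfin (p : ℕ × ℕ) : (pairs p).Finite := (finite_effective Fq _).prod (finite_effective Fq _)
  have hdisj : (A : Set (ℕ × ℕ)).PairwiseDisjoint fun p => (hfin p).toFinset := by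
    refine fun p _ p' _ hp => Finset.disjoint_left.2 fun x hx hx' => hp ?_
    obtain ⟨h₁, h₂⟩ := (Set.Finite.mem_toFinset _).1 hx
    obtain ⟨h₁', h₂'⟩ := (Set.Finite.mem_toFinset _).1 hx'
    exact Prod.ext (Nat.eq_of_mul_eq_mul_right he (Nat.cast_injective (h₁.2.symm.trans h₁'.2)))
      (Nat.eq_of_mul_eq_mul_right he (Nat.cast_injective (h₂.2.symm.trans h₂'.2)))
  calc ∑ p ∈ A, (effective K Fq (p.1 * e)).ncard * (effective K Fq (p.2 * e)).ncard
      = ∑ p ∈ A, (hfin p).toFinset.card := Finset.sum_congr rfl fun p _ => by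
        rw [← Set.ncard_prod, Set.ncard_eq_toFinset_card _ (hfin p)]
    _ = (A.biUnion fun p => (hfin p).toFinset).card := (Finset.card_biUnion hdisj).symm
    _ ≤ (finite_effective (K := K') Fq (k * e)).toFinset.card :=
      Finset.card_le_card_of_injOn _ (fun x hx => ?_)
        (injective_mapDomain_add_mapDomain hinj).injOn
    _ = (effective K' Fq (k * e)).ncard := (Set.ncard_eq_toFinset_card _ _).symm
  obtain ⟨p, hp, hx⟩ := Finset.mem_biUnion.1 hx
  obtain ⟨hD, hE⟩ := (Set.Finite.mem_toFinset _).1 hx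
  refine (Set.Finite.mem_toFinset _).2 ?_
  obtain ⟨hD0, hDn⟩ := mapDomain_mem_effective Fq h₁ hD
  obtain ⟨hE0, hEn⟩ := mapDomain_mem_effective Fq h₂ hE
  refine ⟨add_nonneg hD0 hE0, ?_⟩
  rw [map_add, hDn, hEn, ← Nat.cast_add, ← add_mul, Finset.HasAntidiagonal.mem_antidiagonal.1 hp]

/-- A field with places over `K` as in the statement would have about `k q ^ (k * e)` effective
divisors of degree `k * e`, which is too many. -/
theorem not_injective_sumElim {w₁ w₂ : Place K → Place K'} (h₁ : ∀ v, (w₁ v).deg Fq = v.deg Fq)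
    (h₂ : ∀ v, (w₂ v).deg Fq = v.deg Fq) : ¬Function.Injective (Sum.elim w₁ w₂) := by
  intro hinj
  obtain ⟨w⟩ := nonempty_place Fq K
  obtain ⟨c, hc⟩ := exists_le_ncard_effective Fq w
  obtain ⟨C, hC⟩ := exists_ncard_effective_le (K := K') Fq
  set e := w.deg Fq
  set q := Fintype.card Fq
  have hgrowth (k : ℕ) : (k + 1) * q ^ (k * e) ≤ c ^ 2 * C * q ^ (k * e) := by
    calc (k + 1) * q ^ (k * e)
        = ∑ p ∈ Finset.HasAntidiagonal.antidiagonal k, q ^ ((p.1 + p.2) * e) := by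
          rw [Finset.sum_congr rfl fun p hp => by
            rw [Finset.HasAntidiagonal.mem_antidiagonal.1 hp], Finset.sum_const,
            Finset.Nat.card_antidiagonal, smul_eq_mul]
      _ ≤ ∑ p ∈ Finset.HasAntidiagonal.antidiagonal k, c ^ 2 *
          ((effective K Fq (p.1 * e)).ncard * (effective K Fq (p.2 * e)).ncard) :=
          Finset.sum_le_sum fun p _ => by
            rw [add_mul, pow_add]
            exact (Nat.mul_le_mul (hc p.1) (hc p.2)).trans_eq (by ring)
      _ ≤ c ^ 2 * C * q ^ (k * e) := by
          rw [← Finset.mul_sum, mul_assoc]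
          exact Nat.mul_le_mul_left _
            ((sum_ncard_mul_ncard_effective_le Fq h₁ h₂ hinj (w.deg_pos Fq) k).trans (hC _))
  have hle := Nat.le_of_mul_le_mul_right (hgrowth (c ^ 2 * C)) (pow_pos Fintype.card_pos _)
  exact hle.not_gt (Nat.lt_succ_self _)

end Split
end Divisor

/-! ### F. K. Schmidt's theorem -/

section FrobeniusPowers

variable {Fq R : Type*} [Field Fq] [Fintype Fq] [CommRing R] [Algebra Fq R]

lemma frobeniusAlgHom_pow_apply (i : ℕ) (x : R) :
    (FiniteField.frobeniusAlgHom Fq R ^ i) x = x ^ Fintype.card Fq ^ i := by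
  rw [AlgHom.coe_pow, FiniteField.coe_frobeniusAlgHom, pow_iterate]

variable (Fq) in
lemma sub_pow_card_pow (i : ℕ) (x y : R) :
    (x - y) ^ Fintype.card Fq ^ i = x ^ Fintype.card Fq ^ i - y ^ Fintype.card Fq ^ i := by
  simp only [← frobeniusAlgHom_pow_apply (Fq := Fq), map_sub]

lemma aeval_pow_card_pow (i : ℕ) (x : R) (p : Fq[X]) :
    aeval (x ^ Fintype.card Fq ^ i) p = aeval x p ^ Fintype.card Fq ^ i := by
  simp only [← frobeniusAlgHom_pow_apply (Fq := Fq), aeval_algHom_apply]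

end FrobeniusPowers

namespace Place

open Filter Topology

variable {K : Type*} [Field K] (v : Place K)

/-- The embedding of `K` into the local field `K_v`. -/
def embed : K →+* v.Completion :=
  UniformSpace.Completion.coeRingHom.comp ((WithVal.equiv v.val).symm : K →+* WithVal v.val)

lemma valued_embed (k : K) : Valued.v (v.embed k) = v.val k :=
  Valued.valuedCompletion_apply _

lemma valued_surjective :
    Function.Surjective (Valued.v : Valuation v.Completion ℤᵐ⁰) := fun γ =>
  let ⟨k, hk⟩ := v.surjective γ
  ⟨v.embed k, (v.valued_embed k).trans hk⟩

lemma setOf_valued_sub_lt_mem_nhds (x : v.Completion) (n : ℤ) :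
    {y | Valued.v (y - x) < (exp n : ℤᵐ⁰)} ∈ 𝓝 x := by
  obtain ⟨c, hc⟩ := v.valued_surjective (exp n)
  rw [Valued.mem_nhds]
  refine ⟨Units.mk0 ((Valued.v : Valuation v.Completion ℤᵐ⁰).restrict c) ?_, fun y hy => ?_⟩
  · rw [Ne, Valuation.restrict_eq_zero_iff, hc]
    exact exp_ne_zero
  · have hlt := (Valuation.restrict_lt_iff _).1 hy
    rwa [hc] at hlt

lemma exists_valued_sub_embed_lt (x : v.Completion) (n : ℤ) :
    ∃ k : K, Valued.v (v.embed k - x) < (exp n : ℤᵐ⁰) := by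
  obtain ⟨_, ⟨k, rfl⟩, hk⟩ := UniformSpace.Completion.denseRange_coe.inter_nhds_nonempty
    (v.setOf_valued_sub_lt_mem_nhds x n)
  exact ⟨WithVal.equiv v.val k, hk⟩

lemma tendsto_zero_of_forall_eventually_lt {f : ℕ → v.Completion}
    (h : ∀ n : ℤ, ∀ᶠ i in atTop, Valued.v (f i) < (exp n : ℤᵐ⁰)) : Tendsto f atTop (𝓝 0) := by
  rw [(Valued.hasBasis_nhds_zero v.Completion ℤᵐ⁰).tendsto_right_iff]
  rintro γ -
  obtain ⟨n, hn⟩ : ∃ n : ℤ, MonoidWithZeroHom.ValueGroup₀.embedding γ.1 = (exp n : ℤᵐ⁰) :=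
    ⟨log _, (exp_log (by simp)).symm⟩
  filter_upwards [h n] with i hi
  rw [Valuation.restrict_lt_iff_lt_embedding, hn]
  exact hi

lemma nonarchimedeanAddGroup_completion : NonarchimedeanAddGroup v.Completion where
  is_nonarchimedean U hU := by
    obtain ⟨γ, hγ⟩ := Valued.mem_nhds_zero.1 hU
    exact ⟨⟨(Valued.v : Valuation v.Completion ℤᵐ⁰).restrict.ltAddSubgroup γ,
      Valued.isOpen_ball _ γ.1⟩, hγ⟩

lemma tendsto_pow_pow {d : v.Completion} (hd : Valued.v d < (1 : ℤᵐ⁰)) {Q : ℕ} (hQ : 1 < Q) :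
    Tendsto (fun i : ℕ => d ^ Q ^ i) atTop (𝓝 0) := by
  refine v.tendsto_zero_of_forall_eventually_lt fun n => ?_
  filter_upwards [eventually_ge_atTop (1 - n).toNat] with i hi
  have hi' : i < Q ^ i := Nat.lt_pow_self hQ
  calc Valued.v (d ^ Q ^ i) = Valued.v d ^ Q ^ i := map_pow ..
    _ ≤ (exp (-1) : ℤᵐ⁰) ^ Q ^ i := pow_le_pow_left₀ zero_le (lt_one_iff_le_exp.1 hd) _
    _ = exp ((Q ^ i : ℕ) • (-1)) := (exp_nsmul ..).symm
    _ < exp n := by rw [exp_lt_exp, nsmul_eq_mul]; omega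

section Teichmuller

variable {Fq : Type*} [Field Fq] [Fintype Fq] [Algebra Fq K] [Finite v.Residue]

lemma val_pow_card_sub_lt_one {a : K} (ha : v.val a ≤ 1) :
    v.val (a ^ Fintype.card Fq ^ v.deg Fq - a) < 1 := by
  have := Fintype.ofFinite v.Residue
  have hcard : Fintype.card v.Residue = Fintype.card Fq ^ v.deg Fq := Module.card_eq_pow_finrank
  have hmem : a ^ Fintype.card Fq ^ v.deg Fq - a ∈ v.val.valuationSubring :=
    sub_mem (pow_mem (show a ∈ v.val.valuationSubring from ha) _) ha
  rw [← residue_eq_zero_iff v ⟨_, hmem⟩]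
  change IsLocalRing.residue v.val.valuationSubring
    (⟨a, ha⟩ ^ Fintype.card Fq ^ v.deg Fq - ⟨a, ha⟩) = 0
  rw [map_sub, map_pow, ← hcard, FiniteField.pow_card, sub_self]

variable (Fq) in
omit [Finite v.Residue] in
lemma pow_card_pow_succ_sub (a : K) (i : ℕ) :
    a ^ (Fintype.card Fq ^ v.deg Fq) ^ (i + 1) - a ^ (Fintype.card Fq ^ v.deg Fq) ^ i =
      (a ^ Fintype.card Fq ^ v.deg Fq - a) ^ (Fintype.card Fq ^ v.deg Fq) ^ i := by
  rw [← pow_mul _ _ i, sub_pow_card_pow, ← pow_mul a, pow_mul _ _ i, ← pow_succ']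

lemma val_pow_card_pow_sub_lt_one {a : K} (ha : v.val a ≤ 1) (i : ℕ) :
    v.val (a ^ (Fintype.card Fq ^ v.deg Fq) ^ i - a) < 1 := by
  induction i with
  | zero => simp
  | succ i ih =>
    rw [← sub_add_sub_cancel _ (a ^ (Fintype.card Fq ^ v.deg Fq) ^ i), pow_card_pow_succ_sub]
    refine v.val.map_add_lt ?_ ih
    rw [map_pow]
    exact pow_lt_one₀ zero_le (v.val_pow_card_sub_lt_one ha)
      (pow_ne_zero _ (pow_ne_zero _ Fintype.card_ne_zero))

variable (Fq) in
lemma one_lt_card_pow_deg : 1 < Fintype.card Fq ^ v.deg Fq :=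
  have : Module.Finite Fq v.Residue := .of_finite
  Nat.one_lt_pow Module.finrank_pos.ne' Fintype.one_lt_card

lemma cauchySeq_embed_pow {a : K} (ha : v.val a ≤ 1) :
    CauchySeq fun i : ℕ => v.embed (a ^ (Fintype.card Fq ^ v.deg Fq) ^ i) := by
  have := v.nonarchimedeanAddGroup_completion
  apply NonarchimedeanAddGroup.cauchySeq_of_tendsto_sub_nhds_zero
  simp only [← map_sub, v.pow_card_pow_succ_sub Fq, map_pow v.embed (a ^ _ - a)]
  refine v.tendsto_pow_pow ?_ (v.one_lt_card_pow_deg Fq)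
  rw [valued_embed]
  exact v.val_pow_card_sub_lt_one ha

/-- The lift is the Teichmüller representative `lim a ^ Q ^ i`, where `Q = #κ(v)`. -/
lemma exists_root_lift (p : Fq[X]) {a : K} (ha : v.val a ≤ 1)
    (hp : aeval (IsLocalRing.residue v.val.valuationSubring ⟨a, ha⟩) p = 0) :
    ∃ τ : v.Completion, p.eval₂ (v.embed.comp (algebraMap Fq K)) τ = 0 ∧
      Valued.v (τ - v.embed a) < (1 : ℤᵐ⁰) := by
  obtain ⟨τ, hτ⟩ := cauchySeq_tendsto_of_complete (v.cauchySeq_embed_pow (Fq := Fq) ha)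
  refine ⟨τ, ?_, ?_⟩
  · have hlim := ((p.continuous_eval₂ (v.embed.comp (algebraMap Fq K))).tendsto τ).comp hτ
    have hpow (i : ℕ) : p.eval₂ (v.embed.comp (algebraMap Fq K))
        (v.embed (a ^ (Fintype.card Fq ^ v.deg Fq) ^ i)) =
          v.embed (aeval a p) ^ (Fintype.card Fq ^ v.deg Fq) ^ i := by
      rw [← map_pow, ← pow_mul, ← aeval_pow_card_pow]
      exact (hom_eval₂ p _ _ _).symm
    have hval : Valued.v (v.embed (aeval a p)) < (1 : ℤᵐ⁰) := by
      rw [valued_embed]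
      exact (val_aeval_lt_one_iff v ha p).2 hp
    refine tendsto_nhds_unique hlim ((v.tendsto_pow_pow hval (v.one_lt_card_pow_deg Fq)).congr ?_)
    exact fun i => (hpow i).symm
  · obtain ⟨i, hi⟩ := (hτ.eventually (v.setOf_valued_sub_lt_mem_nhds τ 0)).exists
    rw [← sub_sub_sub_cancel_left _ _ (v.embed (a ^ (Fintype.card Fq ^ v.deg Fq) ^ i)),
      ← map_sub]
    refine Valuation.map_sub_lt _ ?_ hi
    rw [valued_embed]
    exact v.val_pow_card_pow_sub_lt_one ha i

end Teichmuller

end Place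

open Algebra in
theorem IsFunctionFieldOfCurve.of_finite (F : Type*) {K L : Type u} [Field F] [Field K] [Field L]
    [Algebra F K] [Algebra F L] [Algebra K L] [IsScalarTower F K L] [Module.Finite K L]
    [h : IsFunctionFieldOfCurve F K] : IsFunctionFieldOfCurve F L where
  toEssFiniteType := Algebra.EssFiniteType.comp F K L
  trdeg_eq_one := by
    rw [← trdeg_add_eq F K (A := L), trdeg_eq_zero (R := K), add_zero,
      h.trdeg_eq_one]

lemma exists_irreducible_natDegree_eq (F : Type*) [Field F] [Finite F] {n : ℕ} (hn : 0 < n) :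
    ∃ p : F[X], Irreducible p ∧ p.natDegree = n := by
  obtain ⟨r, hr⟩ := CharP.exists F
  have : Fact r.Prime := ⟨CharP.char_is_prime F r⟩
  have : NeZero n := ⟨hn.ne'⟩
  obtain ⟨α, hα⟩ := Field.exists_primitive_element F (FiniteField.Extension F r n)
  have hint : IsIntegral F α := Algebra.IsIntegral.isIntegral α
  refine ⟨minpoly F α, minpoly.irreducible hint, ?_⟩
  rw [← IntermediateField.adjoin.finrank hint, hα, IntermediateField.finrank_top']
  exact FiniteField.finrank_extension F r n

lemma exists_ne_aeval_eq_zero_of_natDegree_dvd {F κ : Type*} [Field F] [Finite F] [Field κ]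
    [Algebra F κ] [Module.Finite F κ] {p : F[X]} (hp : Irreducible p) (h1 : 1 < p.natDegree)
    (hdvd : p.natDegree ∣ Module.finrank F κ) :
    ∃ a b : κ, a ≠ b ∧ aeval a p = 0 ∧ aeval b p = 0 := by
  have := Fact.mk hp
  have hfin : Module.finrank F (AdjoinRoot p) = p.natDegree := finrank_quotient_span_eq_natDegree
  have : Module.Finite F (AdjoinRoot p) := Module.finite_of_finrank_pos (by omega)
  have := Module.finite_of_finite F (M := κ)
  have := Module.finite_of_finite F (M := AdjoinRoot p)
  have hcard : Nat.card (AdjoinRoot p →ₐ[F] κ) = p.natDegree := by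
    rw [FiniteField.natCard_algHom_of_finrank_dvd (hfin ▸ hdvd), hfin]
  have : Finite (AdjoinRoot p →ₐ[F] κ) := Nat.finite_of_card_ne_zero (by omega)
  have : Nontrivial (AdjoinRoot p →ₐ[F] κ) :=
    Finite.one_lt_card_iff_nontrivial.1 (hcard.symm ▸ h1)
  obtain ⟨f, g, hfg⟩ := exists_pair_ne (AdjoinRoot p →ₐ[F] κ)
  exact ⟨f (AdjoinRoot.root p), g (AdjoinRoot.root p), fun h => hfg (AdjoinRoot.algHom_ext h),
    AdjoinRoot.aeval_algHom_eq_zero p f, AdjoinRoot.aeval_algHom_eq_zero p g⟩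

namespace Place

section Extension

variable {K L : Type*} [Field K] [Field L] [Algebra K L] {v : Place K} {w : Place L}

/-- The inclusion of valuation rings for a place `w` extending `v` without ramification. -/
def valuationSubringMap (hw : ∀ k, w.val (algebraMap K L k) = v.val k) :
    v.val.valuationSubring →+* w.val.valuationSubring :=
  ((algebraMap K L).comp v.val.valuationSubring.subtype).codRestrict
    w.val.valuationSubring.toSubring fun x => (hw x).trans_le x.2

lemma isLocalHom_valuationSubringMap (hw : ∀ k, w.val (algebraMap K L k) = v.val k) :
    IsLocalHom (valuationSubringMap hw) where
  map_nonunit x hx := by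
    by_contra hn
    have hlt : v.val x < 1 := (residue_eq_zero_iff v x).1 ((IsLocalRing.residue_eq_zero_iff x).2 hn)
    rw [← hw] at hlt
    exact (IsLocalRing.residue_eq_zero_iff _).1
      ((residue_eq_zero_iff w (valuationSubringMap hw x)).2 hlt) hx

variable (Fq : Type*) [Field Fq] [Fintype Fq] [Algebra Fq K] [Algebra Fq L] [IsScalarTower Fq K L]

/-- The embedding of residue fields `κ(v) → κ(w)` for a place `w` extending `v` without
ramification. -/
def residueMap (hw : ∀ k, w.val (algebraMap K L k) = v.val k) : v.Residue →ₐ[Fq] w.Residue :=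
  have := isLocalHom_valuationSubringMap hw
  { IsLocalRing.ResidueField.map (valuationSubringMap hw) with
    commutes' c := congrArg (IsLocalRing.residue w.val.valuationSubring)
      (Subtype.ext (IsScalarTower.algebraMap_apply Fq K L c).symm) }

lemma deg_eq_of_forall_exists_val_sub_lt_one (hw : ∀ k, w.val (algebraMap K L k) = v.val k)
    (hdense : ∀ x, w.val x ≤ 1 → ∃ k, w.val (algebraMap K L k - x) < 1) :
    w.deg Fq = v.deg Fq := by
  refine (LinearEquiv.finrank_eq (LinearEquiv.ofBijective (residueMap Fq hw).toLinearMap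
    ⟨(residueMap Fq hw).toRingHom.injective, fun y => ?_⟩)).symm
  obtain ⟨x, rfl⟩ := IsLocalRing.residue_surjective y
  obtain ⟨k, hk⟩ := hdense x x.2
  have hk' : v.val k ≤ 1 := by
    rw [← hw, ← sub_add_cancel (algebraMap K L k) x]
    exact w.val.map_add_le hk.le x.2
  refine ⟨IsLocalRing.residue _ ⟨k, hk'⟩, sub_eq_zero.1 ?_⟩
  exact (map_sub _ _ _).symm.trans
    ((residue_eq_zero_iff w (valuationSubringMap hw ⟨k, hk'⟩ - x)).2 hk)

end Extension

section Embedding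

variable {K L : Type*} [Field K] [Field L] [Algebra K L] (v : Place K)
  (φ : L →+* v.Completion) (hφ : φ.comp (algebraMap K L) = v.embed)

/-- The place of an extension of `K` given by an embedding into the completion `K_v`. -/
def ofEmbedding : Place L where
  val := (Valued.v : Valuation v.Completion ℤᵐ⁰).comap φ
  surjective γ := by
    obtain ⟨k, hk⟩ := v.surjective γ
    refine ⟨algebraMap K L k, ?_⟩
    rw [Valuation.comap_apply, ← RingHom.comp_apply, hφ, valued_embed, hk]

lemma ofEmbedding_val (x : L) : (v.ofEmbedding φ hφ).val x = Valued.v (φ x) := rfl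

lemma ofEmbedding_val_algebraMap (k : K) :
    (v.ofEmbedding φ hφ).val (algebraMap K L k) = v.val k := by
  rw [ofEmbedding_val, ← RingHom.comp_apply, hφ, valued_embed]

lemma ofEmbedding_val_algebraMap_sub (k : K) (x : L) :
    (v.ofEmbedding φ hφ).val (algebraMap K L k - x) = Valued.v (v.embed k - φ x) := by
  rw [ofEmbedding_val, map_sub, ← RingHom.comp_apply, hφ]

lemma deg_ofEmbedding (Fq : Type*) [Field Fq] [Fintype Fq] [Algebra Fq K] [Algebra Fq L]
    [IsScalarTower Fq K L] : (v.ofEmbedding φ hφ).deg Fq = v.deg Fq :=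
  deg_eq_of_forall_exists_val_sub_lt_one Fq (v.ofEmbedding_val_algebraMap φ hφ) fun x _ => by
    simpa only [ofEmbedding_val_algebraMap_sub, exp_zero] using
      v.exists_valued_sub_embed_lt (φ x) 0

end Embedding

section AdjoinRoot

variable {K : Type*} [Field K] {Fq : Type*} [Field Fq] [Fintype Fq] [Algebra Fq K] (v : Place K)
  {p : Fq[X]} [Fact (Irreducible (p.map (algebraMap Fq K)))]

lemma exists_place_adjoinRoot [Finite v.Residue] {a : K} (ha : v.val a ≤ 1)
    (hroot : aeval (IsLocalRing.residue v.val.valuationSubring ⟨a, ha⟩) p = 0) :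
    ∃ w : Place (AdjoinRoot (p.map (algebraMap Fq K))),
      (∀ k : K, w.val (algebraMap _ _ k) = v.val k) ∧ w.deg Fq = v.deg Fq ∧
        w.val (algebraMap _ _ a - AdjoinRoot.root _) < 1 := by
  obtain ⟨τ, hτ, hτa⟩ := v.exists_root_lift p ha hroot
  have hlift : (AdjoinRoot.lift v.embed τ (by rwa [eval₂_map])).comp
      (algebraMap K (AdjoinRoot (p.map (algebraMap Fq K)))) = v.embed := by
    rw [AdjoinRoot.algebraMap_eq, AdjoinRoot.lift_comp_of]
  refine ⟨v.ofEmbedding _ hlift, v.ofEmbedding_val_algebraMap _ _, v.deg_ofEmbedding _ _ Fq, ?_⟩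
  rwa [ofEmbedding_val_algebraMap_sub, AdjoinRoot.lift_root, Valuation.map_sub_swap]

lemma exists_two_places_adjoinRoot [IsFunctionFieldOfCurve Fq K] (hp : Irreducible p)
    (h1 : 1 < p.natDegree) (hdvd : p.natDegree ∣ v.deg Fq) :
    ∃ w₁ w₂ : Place (AdjoinRoot (p.map (algebraMap Fq K))),
      (∀ k : K, w₁.val (algebraMap _ _ k) = v.val k) ∧
      (∀ k : K, w₂.val (algebraMap _ _ k) = v.val k) ∧
      w₁.deg Fq = v.deg Fq ∧ w₂.deg Fq = v.deg Fq ∧ w₁ ≠ w₂ := by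
  have : Finite v.Residue := Module.finite_of_finite Fq
  obtain ⟨α, β, hne, hα, hβ⟩ :=
    exists_ne_aeval_eq_zero_of_natDegree_dvd (κ := v.Residue) hp h1 hdvd
  obtain ⟨⟨a, ha⟩, rfl⟩ := IsLocalRing.residue_surjective α
  obtain ⟨⟨b, hb⟩, rfl⟩ := IsLocalRing.residue_surjective β
  obtain ⟨w₁, hw₁, hdeg₁, hroot₁⟩ := v.exists_place_adjoinRoot ha hα
  obtain ⟨w₂, hw₂, hdeg₂, hroot₂⟩ := v.exists_place_adjoinRoot hb hβ
  refine ⟨w₁, w₂, hw₁, hw₂, hdeg₁, hdeg₂, ?_⟩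
  rintro rfl
  refine hne (sub_eq_zero.1 ((residue_eq_zero_iff v (⟨a, ha⟩ - ⟨b, hb⟩)).2 ?_))
  have hsub := Valuation.map_sub_lt _ hroot₁ hroot₂
  rwa [sub_sub_sub_cancel_right, ← map_sub, hw₁] at hsub

end AdjoinRoot

end Place

/-- F. K. Schmidt's theorem.  If `ℓ` divided all degrees, the extension of constants of degree `ℓ`
would have two places of degree `n_v` above every place `v`, that is, too many places. -/
theorem exists_not_dvd_deg {Fq K : Type*} [Field Fq] [Fintype Fq] [Field K] [Algebra Fq K]
    [IsFunctionFieldOfCurve Fq K]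
    (hgeom : ∀ p : Fq[X], Irreducible p → Irreducible (p.map (algebraMap Fq K)))
    {ℓ : ℕ} (hℓ : 1 < ℓ) : ∃ v : Place K, ¬ ℓ ∣ v.deg Fq := by
  by_contra! hdvd
  obtain ⟨p, hp, rfl⟩ := exists_irreducible_natDegree_eq Fq (n := ℓ) (by omega)
  have := Fact.mk (hgeom p hp)
  choose w₁ w₂ hw₁ hw₂ hdeg₁ hdeg₂ hne using fun v : Place K =>
    v.exists_two_places_adjoinRoot hp hℓ (hdvd v)
  have : Module.Finite K (AdjoinRoot (p.map (algebraMap Fq K))) :=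
    (AdjoinRoot.powerBasis (hgeom p hp).ne_zero).finite
  have : IsFunctionFieldOfCurve Fq (AdjoinRoot (p.map (algebraMap Fq K))) :=
    .of_finite Fq (K := K)
  have eq_of_extend_eq {v v' : Place K} {w w' : Place (AdjoinRoot (p.map (algebraMap Fq K)))}
      (h : ∀ k : K, w.val (algebraMap _ _ k) = v.val k)
      (h' : ∀ k : K, w'.val (algebraMap _ _ k) = v'.val k) (hww' : w = w') : v = v' :=
    Place.eq_of_le_one_iff fun f => by rw [← h, ← h', hww']
  refine Divisor.not_injective_sumElim Fq hdeg₁ hdeg₂ ?_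
  rintro (v | v) (v' | v') heq
  · exact congrArg _ (eq_of_extend_eq (hw₁ v) (hw₁ v') heq)
  · obtain rfl := eq_of_extend_eq (hw₁ v) (hw₂ v') heq
    exact (hne v heq).elim
  · obtain rfl := eq_of_extend_eq (hw₂ v) (hw₁ v') heq
    exact (hne v heq.symm).elim
  · exact congrArg _ (eq_of_extend_eq (hw₂ v) (hw₂ v') heq)

/-! ### Norms of ideles and the adele class space -/

lemma zpow_sum {G ι : Type*} [CommGroup G] (g : G) (s : Finset ι) (f : ι → ℤ) :
    g ^ ∑ i ∈ s, f i = ∏ i ∈ s, g ^ f i := by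
  classical
  induction s using Finset.induction_on with
  | empty => simp
  | insert i s hi ih => rw [Finset.sum_insert hi, Finset.prod_insert hi, zpow_add, ih]

theorem nonempty_zpowers_quotient_mulEquiv {G : Type*} [CommGroup G] {g : G}
    (hg : Function.Injective fun m : ℤ => g ^ m) (n : ℕ) :
    Nonempty ((Subgroup.zpowers g ⧸ (Subgroup.zpowers (g ^ n)).subgroupOf (Subgroup.zpowers g)) ≃*
      Multiplicative (ZMod n)) := by
  set H := (Subgroup.zpowers (g ^ n)).subgroupOf (Subgroup.zpowers g)
  let φ : ℤ →+ Additive (Subgroup.zpowers g ⧸ H) :=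
    zmultiplesHom _ (Additive.ofMul (QuotientGroup.mk' H ⟨g, Subgroup.mem_zpowers g⟩))
  have hφ (m : ℤ) : φ m =
      Additive.ofMul (QuotientGroup.mk' H (⟨g, Subgroup.mem_zpowers g⟩ ^ m)) := by
    rw [zmultiplesHom_apply, map_zpow, ofMul_zpow]
  have hsurj : Function.Surjective φ := fun x => by
    obtain ⟨⟨_, m, rfl⟩, hm⟩ := QuotientGroup.mk'_surjective H x.toMul
    exact ⟨m, (hφ m).trans (congrArg Additive.ofMul hm)⟩
  have hker : φ.ker = AddSubgroup.zmultiples (n : ℤ) := by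
    ext m
    rw [AddMonoidHom.mem_ker, hφ, Int.mem_zmultiples_iff, ofMul_eq_zero, QuotientGroup.mk'_apply,
      QuotientGroup.eq_one_iff, Subgroup.mem_subgroupOf, Subgroup.mem_zpowers_iff]
    refine exists_congr fun k => ?_
    rw [eq_comm, ← zpow_natCast, ← zpow_mul]
    exact hg.eq_iff
  exact ⟨AddEquiv.toMultiplicativeRight
    (((QuotientAddGroup.quotientKerEquivOfSurjective φ hsurj).symm.trans
      (QuotientAddGroup.quotientAddEquivOfEq hker)).trans
        (Int.quotientZMultiplesNatEquivZMod n))⟩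

lemma one_mem_of_forall_exists_not_dvd {ι : Type*} {S : AddSubgroup ℤ} {f : ι → ℕ}
    (hS : ∀ i, (f i : ℤ) ∈ S) (hf : ∀ ℓ : ℕ, 1 < ℓ → ∃ i, ¬ ℓ ∣ f i) : (1 : ℤ) ∈ S := by
  obtain ⟨d, rfl⟩ := (AddSubgroup.isAddCyclic_iff_exists_zmultiples_eq_top S).1 inferInstance
  have hdvd (i : ι) : d.natAbs ∣ f i :=
    Int.natAbs_dvd_natAbs.2 (Int.mem_zmultiples_iff.1 (hS i))
  have hd : d.natAbs = 1 := by
    by_contra hne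
    rcases Nat.eq_zero_or_pos d.natAbs with h0 | h0
    · obtain ⟨i, hi⟩ := hf 2 one_lt_two
      have hi0 := hdvd i
      rw [h0, zero_dvd_iff] at hi0
      exact hi (hi0 ▸ dvd_zero 2)
    · obtain ⟨i, hi⟩ := hf d.natAbs (by omega)
      exact hi (hdvd i)
  exact Int.mem_zmultiples_iff.2 (Int.natAbs_dvd.1 (by simp [hd]))

lemma qUnit_zpow_injective (Fq : Type*) [Field Fq] [Fintype Fq] :
    Function.Injective fun n : ℤ => qUnit Fq ^ n := fun m n h => by
  have hval := congrArg Units.val h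
  simp only [Units.val_zpow_eq_zpow_val] at hval
  refine zpow_right_injective₀ (a := (Fintype.card Fq : ℝ≥0)) ?_ ?_ hval
  · exact_mod_cast Fintype.card_pos
  · exact_mod_cast Fintype.one_lt_card.ne'

namespace Place
variable {K : Type*} [Field K] (v : Place K) (Fq : Type*) [Field Fq] [Fintype Fq] [Algebra Fq K]

lemma absVal_eq {x : v.Completion} (hx : x ≠ 0) :
    v.absVal Fq x = ((qUnit Fq ^ (v.deg Fq * log (Valued.v x : ℤᵐ⁰)) : ℝ≥0ˣ) : ℝ≥0) := by
  have hx' : (Valued.v x : ℤᵐ⁰) ≠ 0 := (Valuation.ne_zero_iff _).2 hx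
  have hunzero (γ : ℤᵐ⁰) (hγ : γ ≠ 0) : Multiplicative.toAdd (unzero hγ) = log γ := by
    obtain ⟨n, rfl⟩ : ∃ n, γ = exp n := ⟨_, (exp_log hγ).symm⟩
    rw [log_exp]
    rfl
  rw [zpow_mul, zpow_natCast, Units.val_zpow_eq_zpow_val, Units.val_pow_eq_pow_val]
  refine (WithZeroMulInt.toNNReal_neg_apply
    (pow_ne_zero _ (Nat.cast_ne_zero.2 Fintype.card_ne_zero)) hx').trans ?_
  rw [hunzero]
  rfl

lemma map_absVal (x : v.Completionˣ) : Units.map (v.absVal Fq : v.Completion →* ℝ≥0) x =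
    (qUnit Fq ^ v.deg Fq) ^ log (Valued.v (x : v.Completion) : ℤᵐ⁰) := by
  ext1
  rw [Units.coe_map, ← zpow_natCast, ← zpow_mul]
  exact v.absVal_eq Fq x.ne_zero

lemma normRange_eq : v.normRange Fq = Subgroup.zpowers (qUnit Fq ^ v.deg Fq) := by
  ext y
  rw [normRange, MonoidHom.mem_range, Subgroup.mem_zpowers_iff]
  constructor
  · rintro ⟨x, rfl⟩
    exact ⟨_, (v.map_absVal Fq x).symm⟩
  · rintro ⟨n, rfl⟩
    obtain ⟨x, hx⟩ := v.valued_surjective (exp n)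
    refine ⟨Units.mk0 x ((Valuation.ne_zero_iff _).1 (hx ▸ exp_ne_zero)), ?_⟩
    rw [map_absVal, Units.val_mk0, hx, log_exp]

end Place

section Ideles
variable {K : Type*} [Field K]

lemma Idele.apply_ne_zero (a : Idele K) (v : Place K) : (a : Adele K) v ≠ 0 :=
  left_ne_zero_of_mul_eq_one (Idele.mul_inv_apply K a v)

lemma Idele.ext {a b : Idele K} (h : ∀ v, (a : Adele K) v = (b : Adele K) v) : a = b :=
  Units.ext (DFunLike.ext _ _ h)

open Classical in
/-- The adele with component `x` at `v` and `1` at all other places. -/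
def Adele.concentrated (v : Place K) (x : v.Completion) : Adele K :=
  ⟨Function.update (fun _ => 1) v x, by
    refine (Set.finite_singleton v).subset fun w hw => ?_
    by_contra h
    refine hw ?_
    change Function.update (fun _ => 1) v x w ∈ w.integers
    rw [Function.update_of_ne h]
    exact one_mem w.integers⟩

lemma Adele.concentrated_self (v : Place K) (x : v.Completion) :
    Adele.concentrated v x v = x := by
  classical exact Function.update_self v x (fun _ => 1)

lemma Adele.concentrated_of_ne {v w : Place K} (h : w ≠ v) (x : v.Completion) :
    Adele.concentrated v x w = 1 := by
  classical exact Function.update_of_ne h x (fun _ => 1)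

lemma Adele.concentrated_mul (v : Place K) (x y : v.Completion) :
    Adele.concentrated v x * Adele.concentrated v y = Adele.concentrated v (x * y) := by
  refine DFunLike.ext _ _ fun w => ?_
  rw [Adele.mul_apply]
  rcases eq_or_ne w v with rfl | h
  · simp only [Adele.concentrated_self]
  · simp only [Adele.concentrated_of_ne h, mul_one]

lemma Adele.concentrated_one (v : Place K) : Adele.concentrated v 1 = 1 := by
  refine DFunLike.ext _ _ fun w => ?_
  rcases eq_or_ne w v with rfl | h
  · rw [Adele.concentrated_self, Adele.one_apply]
  · rw [Adele.concentrated_of_ne h, Adele.one_apply]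

/-- The idele with component `x` at `v` and `1` at all other places. -/
def Idele.concentrated (v : Place K) (x : v.Completionˣ) : Idele K where
  val := Adele.concentrated v x
  inv := Adele.concentrated v ↑x⁻¹
  val_inv := by rw [Adele.concentrated_mul, Units.mul_inv, Adele.concentrated_one]
  inv_val := by rw [Adele.concentrated_mul, Units.inv_mul, Adele.concentrated_one]

lemma puncturedOne_self (v : Place K) : puncturedOne v v = 0 := if_pos rfl

lemma puncturedOne_of_ne {v w : Place K} (h : w ≠ v) : puncturedOne v w = 1 := if_neg h

lemma concentrated_smul_puncturedOne (v : Place K) (x : v.Completionˣ) :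
    Idele.concentrated v x • puncturedOne v = puncturedOne v := by
  refine DFunLike.ext _ _ fun w => ?_
  rw [Units.smul_def, smul_eq_mul, Adele.mul_apply]
  rcases eq_or_ne w v with rfl | h
  · rw [puncturedOne_self, mul_zero]
  · rw [puncturedOne_of_ne h, mul_one]
    exact Adele.concentrated_of_ne h _

variable (Fq : Type*) [Field Fq] [Fintype Fq] [Algebra Fq K]

lemma coe_ideleNorm (a : Idele K) :
    (ideleNorm K Fq a : ℝ≥0) = ∏ᶠ v : Place K, v.absVal Fq ((a : Adele K) v) := rfl

lemma ideleNorm_concentrated (v : Place K) (x : v.Completionˣ) :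
    ideleNorm K Fq (Idele.concentrated v x) =
      Units.map (v.absVal Fq : v.Completion →* ℝ≥0) x := by
  ext1
  rw [coe_ideleNorm, finprod_eq_single _ v]
  · exact congrArg _ (Adele.concentrated_self v x.1)
  · intro w hw
    refine (congrArg _ (Adele.concentrated_of_ne hw x.1)).trans (map_one _)

lemma exists_ideleNorm_eq (a : Idele K) : ∃ s : Finset (Place K), ∀ t, s ⊆ t →
    ideleNorm K Fq a =
      qUnit Fq ^ ∑ v ∈ t, (v.deg Fq * log (Valued.v ((a : Adele K) v) : ℤᵐ⁰)) := by
  refine ⟨(finite_mulSupport_absVal K Fq a).toFinset, fun t ht => ?_⟩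
  ext1
  rw [coe_ideleNorm, finprod_eq_prod_of_mulSupport_subset (s := t), zpow_sum,
    Units.coe_prod]
  · exact Finset.prod_congr rfl fun v _ => v.absVal_eq Fq (Idele.apply_ne_zero a v)
  · intro v hv
    exact ht ((Set.Finite.mem_toFinset _).2 hv)

lemma ideleNorm_mem_zpowers (a : Idele K) : ideleNorm K Fq a ∈ Subgroup.zpowers (qUnit Fq) := by
  obtain ⟨s, hs⟩ := exists_ideleNorm_eq Fq a
  exact ⟨_, (hs s subset_rfl).symm⟩

variable [IsFunctionFieldOfCurve Fq K]

omit [Fintype Fq] in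
include Fq in
lemma exists_principal_idele [Finite Fq] (k : Kˣ) :
    ∃ u : Idele K, ∀ v : Place K, (u : Adele K) v = ((k : K) : v.Completion) := by
  have exists_diagonal (k : Kˣ) : ∃ a : Adele K, ∀ v : Place K, a v = v.embed k :=
    ⟨⟨fun v => v.embed k, (Place.finite_val_ne_one Fq k.ne_zero).subset fun v hv h =>
      hv ((v.valued_embed k).trans_le h.le)⟩, fun _ => rfl⟩
  obtain ⟨a, ha⟩ := exists_diagonal k
  obtain ⟨b, hb⟩ := exists_diagonal k⁻¹
  have hab : a * b = 1 := DFunLike.ext _ _ fun v => by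
    rw [Adele.mul_apply, ha, hb, ← map_mul, Units.mul_inv, map_one, Adele.one_apply]
  exact ⟨⟨a, b, hab, (mul_comm _ _).trans hab⟩, ha⟩

lemma ideleNorm_principal {a : Idele K} (ha : a ∈ principal K) : ideleNorm K Fq a = 1 := by
  obtain ⟨k, hk⟩ := ha
  obtain ⟨s, hs⟩ := exists_ideleNorm_eq Fq a
  have hval (v : Place K) : (Valued.v ((a : Adele K) v) : ℤᵐ⁰) = v.val k := by
    rw [hk]
    exact v.valued_embed k
  classical
  rw [hs (s ∪ (Divisor.div Fq (k : K)).support) Finset.subset_union_left, ← zpow_zero (qUnit Fq)]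
  congr 1
  have hdeg := Divisor.degree_div Fq (k : K)
  rw [Divisor.degree, Finsupp.linearCombination_apply,
    Finsupp.sum_of_support_subset _ (Finset.subset_union_right (s₁ := s)) _ (by simp)] at hdeg
  rw [← neg_eq_zero, ← hdeg, ← Finset.sum_neg_distrib]
  refine Finset.sum_congr rfl fun v _ => ?_
  rw [hval, Divisor.div_apply, smul_eq_mul]
  ring

end Ideles

section Classes
variable {K : Type*} [Field K] (Fq : Type*) [Field Fq] [Fintype Fq] [Algebra Fq K]
  [IsFunctionFieldOfCurve Fq K]

/-- The norm of idele classes. -/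
def IdeleClass.norm : IdeleClass K →* ℝ≥0ˣ :=
  QuotientGroup.lift (principal K) (ideleNorm K Fq) fun _ ha => ideleNorm_principal Fq ha

lemma IdeleClass.norm_mk (a : Idele K) :
    IdeleClass.norm Fq (a : IdeleClass K) = ideleNorm K Fq a := rfl

lemma IdeleClass.ker_norm : (IdeleClass.norm Fq).ker = normOne K Fq := by
  ext c
  obtain ⟨a, rfl⟩ := QuotientGroup.mk_surjective c
  constructor
  · exact fun h => ⟨a, h, rfl⟩
  · rintro ⟨b, hb, hab⟩
    rw [MonoidHom.mem_ker, ← hab]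
    exact hb

lemma Place.exists_norm_eq (v : Place K) {y : ℝ≥0ˣ} (hy : y ∈ v.normRange Fq) :
    ∃ x : v.Completionˣ, IdeleClass.norm Fq (Idele.concentrated v x : IdeleClass K) = y := by
  obtain ⟨x, hx⟩ := hy
  exact ⟨x, (ideleNorm_concentrated Fq v x).trans hx⟩

lemma IdeleClass.range_norm (hdeg : ∀ ℓ : ℕ, 1 < ℓ → ∃ v : Place K, ¬ ℓ ∣ v.deg Fq) :
    (IdeleClass.norm Fq (K := K)).range = Subgroup.zpowers (qUnit Fq) := by
  refine le_antisymm ?_ ?_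
  · rintro _ ⟨c, rfl⟩
    obtain ⟨a, rfl⟩ := QuotientGroup.mk_surjective c
    exact ideleNorm_mem_zpowers Fq a
  · let S : AddSubgroup ℤ := (((IdeleClass.norm Fq (K := K)).range.comap
      (zpowersHom ℝ≥0ˣ (qUnit Fq)))).toAddSubgroup'
    have mem_S (n : ℤ) : n ∈ S ↔ qUnit Fq ^ n ∈ (IdeleClass.norm Fq (K := K)).range := Iff.rfl
    have hmem (v : Place K) : (v.deg Fq : ℤ) ∈ S := by
      rw [mem_S, zpow_natCast]
      obtain ⟨x, hx⟩ := v.exists_norm_eq Fq (v.normRange_eq Fq ▸ Subgroup.mem_zpowers _)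
      exact ⟨_, hx⟩
    rw [Subgroup.zpowers_le]
    simpa only [mem_S, zpow_one] using one_mem_of_forall_exists_not_dvd hmem hdeg

lemma concentrated_smul_puncturedClass (v : Place K) (x : v.Completionˣ) :
    (Idele.concentrated v x : IdeleClass K) • puncturedClass v = puncturedClass v :=
  congrArg (Quotient.mk _) (concentrated_smul_puncturedOne v x)

lemma eq_of_mul_puncturedOne_eq {a b : Idele K} {v w : Place K}
    (h : (b : Adele K) * puncturedOne w = a * puncturedOne v) :
    v = w ∧ ∃ x : v.Completionˣ, b⁻¹ * a = Idele.concentrated v x := by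
  have hcomp (z : Place K) :
      (b : Adele K) z * puncturedOne w z = (a : Adele K) z * puncturedOne v z := by
    rw [← Adele.mul_apply, h, Adele.mul_apply]
  obtain rfl : v = w := by
    by_contra hne
    have hv := hcomp v
    rw [puncturedOne_self, mul_zero, puncturedOne_of_ne hne, mul_one] at hv
    exact Idele.apply_ne_zero b v hv
  refine ⟨rfl, Units.mk0 (((b⁻¹ * a : Idele K) : Adele K) v) (Idele.apply_ne_zero _ v),
    Idele.ext fun z => ?_⟩
  rcases eq_or_ne z v with rfl | hz
  · exact (Adele.concentrated_self z _).symm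
  · refine Eq.trans ?_ (Adele.concentrated_of_ne hz _).symm
    have hab := hcomp z
    rw [puncturedOne_of_ne hz, mul_one, mul_one] at hab
    rw [Units.val_mul, Adele.mul_apply, ← hab, ← Adele.mul_apply, Units.inv_mul, Adele.one_apply]

lemma eq_of_smul_puncturedClass_eq {c : IdeleClass K} {v w : Place K}
    (h : c • puncturedClass v = puncturedClass w) :
    v = w ∧ ∃ x : v.Completionˣ, c = (Idele.concentrated v x : IdeleClass K) := by
  obtain ⟨a, rfl⟩ := QuotientGroup.mk_surjective c
  obtain ⟨⟨k, hk⟩, hka⟩ := Quotient.exact h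
  obtain ⟨rfl, x, hx⟩ := eq_of_mul_puncturedOne_eq hka
  refine ⟨rfl, x, ?_⟩
  rw [← hx, QuotientGroup.eq, mul_comm, mul_inv_cancel_right]
  exact inv_mem hk

namespace XiQuotient

omit [IsFunctionFieldOfCurve Fq K] in
lemma smul_base (c : IdeleClass K) (v : Place K) :
    c • base Fq v = (Quotient.mk _ (c • Xi.base v) : XiQuotient K Fq) := rfl

omit [IsFunctionFieldOfCurve Fq K] in
lemma exists_eq_smul_base (x : XiQuotient K Fq) : ∃ (v : Place K) (c : IdeleClass K),
    x = c • base Fq v := by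
  induction x using Quotient.inductionOn with
  | _ x =>
    obtain ⟨v, c, hc⟩ := Set.mem_iUnion.1 x.2
    exact ⟨v, c, congrArg (Quotient.mk _) (Subtype.ext hc.symm)⟩

lemma eq_of_smul_base_eq {c : IdeleClass K} {v w : Place K}
    (h : c • base Fq v = base Fq w) : v = w ∧ IdeleClass.norm Fq c ∈ v.normRange Fq := by
  rw [smul_base] at h
  obtain ⟨⟨d, hd⟩, hdc⟩ := Quotient.exact h
  have hsmul : d • puncturedClass w = c • puncturedClass v := congrArg Subtype.val hdc
  rw [← inv_smul_eq_iff, smul_smul] at hsmul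
  obtain ⟨rfl, x, hx⟩ := eq_of_smul_puncturedClass_eq hsmul
  refine ⟨rfl, x⁻¹, ?_⟩
  rw [map_inv, ← ideleNorm_concentrated, ← IdeleClass.norm_mk, ← hx, map_mul, map_inv]
  rw [← IdeleClass.ker_norm] at hd
  rw [MonoidHom.mem_ker.1 hd, mul_one, inv_inv]

lemma smul_base_eq {c : IdeleClass K} {v : Place K} (h : IdeleClass.norm Fq c ∈ v.normRange Fq) :
    c • base Fq v = base Fq v := by
  obtain ⟨x, hx⟩ := v.exists_norm_eq Fq h
  rw [smul_base]
  refine Quotient.sound ⟨⟨c * (Idele.concentrated v x : IdeleClass K)⁻¹, ?_⟩, ?_⟩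
  · rw [← IdeleClass.ker_norm, MonoidHom.mem_ker, map_mul, map_inv, hx, mul_inv_cancel]
  · refine Subtype.ext ?_
    change (c * (Idele.concentrated v x : IdeleClass K)⁻¹) • puncturedClass v = c • puncturedClass v
    rw [mul_smul, inv_smul_eq_iff.2 (concentrated_smul_puncturedClass v x).symm]

lemma stabilizer_base (v : Place K) : MulAction.stabilizer (IdeleClass K) (base Fq v) =
    (v.normRange Fq).comap (IdeleClass.norm Fq) :=
  SetLike.ext fun _ => ⟨fun h => (eq_of_smul_base_eq Fq h).2, fun h => smul_base_eq Fq h⟩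

end XiQuotient

end Classes

theorem existsUnique_equivariant_equiv {G H M Y X I : Type*} [Group G] [Group H] [Group M]
    [MulAction G Y] [MulAction H X] {φ : G →* M} {ψ : H →* M} (hrange : φ.range = ψ.range)
    {b : I → Y} {s : I → X} (hb : ∀ y, ∃ i, ∃ g : G, y = g • b i)
    (hs : ∀ x, ∃ i, ∃ h : H, x = h • s i)
    (hbs : ∀ g h i j, φ g = ψ h → (g • b i = b j ↔ h • s i = s j)) :
    ∃! Φ : Y ≃ X, (∀ g h, φ g = ψ h → ∀ y, Φ (g • y) = h • Φ y) ∧ ∀ i, Φ (b i) = s i := by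
  have smul_eq_iff : ∀ {g g' h h'} (i j), φ g = ψ h → φ g' = ψ h' →
      (g • b i = g' • b j ↔ h • s i = h' • s j) := by
    intro g g' h h' i j hg hg'
    rw [← inv_smul_eq_iff, smul_smul, ← inv_smul_eq_iff, smul_smul]
    exact hbs _ _ i j (by rw [map_mul, map_mul, map_inv, map_inv, hg, hg'])
  choose i g hig using hb
  choose j k hjk using hs
  choose e he using fun a => hrange.le ⟨a, rfl⟩
  choose f hf using fun a => hrange.ge ⟨a, rfl⟩
  have he' : ∀ a, φ a = ψ (e a) := fun a => (he a).symm
  refine ⟨⟨fun y => e (g y) • s (i y), fun x => f (k x) • b (j x), fun y => ?_, fun x => ?_⟩,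
    ⟨fun a h ha y => ?_, fun l => ?_⟩, fun Ψ hΨ => ?_⟩
  · exact ((smul_eq_iff _ _ (hf _) (he' _)).2 (hjk _).symm).trans (hig y).symm
  · exact ((smul_eq_iff _ _ (he' _) (hf _)).1 (hig _).symm ▸ (hjk x).symm :)
  · change e (g (a • y)) • s (i (a • y)) = h • e (g y) • s (i y)
    have hmul : φ (a * g y) = ψ (h * e (g y)) := by rw [map_mul, map_mul, ha, he']
    rw [smul_smul, ← smul_eq_iff _ _ (he' _) hmul, ← hig, mul_smul, ← hig]
  · change e (g (b l)) • s (i (b l)) = s l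
    rw [← one_smul H (s l), ← smul_eq_iff _ _ (he' _) (by rw [map_one, map_one]), ← hig, one_smul]
  · ext y
    change Ψ y = e (g y) • s (i y)
    conv_lhs => rw [hig y]
    rw [hΨ.1 _ _ (he' _), hΨ.2]

section Equivariant
variable {K : Type*} [Field K] (Fq : Type*) [Field Fq] [Fintype Fq] [Algebra Fq K]

lemma Place.qUnit_zpow_mem_normRange_iff (v : Place K) (n : ℤ) :
    qUnit Fq ^ n ∈ v.normRange Fq ↔ (v.deg Fq : ℤ) ∣ n := by
  rw [v.normRange_eq, Subgroup.mem_zpowers_iff]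
  refine exists_congr fun k => ?_
  rw [eq_comm, ← zpow_natCast, ← zpow_mul]
  exact (qUnit_zpow_injective Fq).eq_iff

theorem XiQuotient.existsUnique_equiv [IsFunctionFieldOfCurve Fq K]
    (hdeg : ∀ ℓ : ℕ, 1 < ℓ → ∃ v : Place K, ¬ ℓ ∣ v.deg Fq)
    {X : Type*} {F : Equiv.Perm X} {s : Place K → X}
    (hs : ∀ x, ∃ v, ∃ n : ℤ, x = (F ^ n) (s v))
    (hs' : ∀ (v w : Place K) (n : ℤ), (F ^ n) (s v) = s w ↔ v = w ∧ (v.deg Fq : ℤ) ∣ n) :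
    ∃! Φ : XiQuotient K Fq ≃ X,
      (∀ (c : IdeleClass K) (n : ℤ), IdeleClass.norm Fq c = qUnit Fq ^ n →
        ∀ x : XiQuotient K Fq, Φ (c • x) = (F ^ n) (Φ x)) ∧
      ∀ v : Place K, Φ (XiQuotient.base Fq v) = s v := by
  let : MulAction (Multiplicative ℤ) X := MulAction.compHom X (zpowersHom (Equiv.Perm X) F)
  refine existsUnique_equivariant_equiv (H := Multiplicative ℤ) (φ := IdeleClass.norm Fq)
    (ψ := zpowersHom ℝ≥0ˣ (qUnit Fq)) (IdeleClass.range_norm Fq hdeg)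
    (XiQuotient.exists_eq_smul_base Fq) hs fun c n v w hcn => ?_
  replace hcn : IdeleClass.norm Fq c = qUnit Fq ^ n.toAdd := hcn
  refine Iff.trans ?_ (hs' v w n.toAdd).symm
  rw [← v.qUnit_zpow_mem_normRange_iff Fq, ← hcn]
  constructor
  · exact XiQuotient.eq_of_smul_base_eq Fq
  · rintro ⟨rfl, h⟩
    exact XiQuotient.smul_base_eq Fq h

end Equivariant

/-! ### Smooth curves -/

section SmoothCurves
open Algebra

lemma exists_etale_polynomial (F A : Type u) [Field F] [CommRing A] [Algebra F A]
    [IsStandardSmoothOfRelativeDimension 1 F A] :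
    ∃ g : F[X] →ₐ[F] A, g.toRingHom.Etale := by
  obtain ⟨g, hg⟩ := IsStandardSmoothOfRelativeDimension.exists_etale_mvPolynomial (n := 1) F A
  let e : F[X] ≃ₐ[F] MvPolynomial (Fin 1) F := (MvPolynomial.uniqueAlgEquiv F (Fin 1)).symm
  exact ⟨g.comp e.toAlgHom, RingHom.Etale.respectsIso.2 g.toRingHom e.toRingEquiv hg⟩

lemma isAlgebraic_fractionRing_of_etale (R A : Type*) {K : Type*} [CommRing R] [IsDomain R]
    [CommRing A] [IsDomain A] [Field K] [Algebra R A] [Algebra A K] [Algebra R K]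
    [IsScalarTower R A K] [IsFractionRing A K] [Algebra.Etale R A] : Algebra.IsAlgebraic R K := by
  have : EssFiniteType A K := .of_isLocalization K (nonZeroDivisors A)
  have : FormallyUnramified A K := .of_isLocalization (nonZeroDivisors A)
  have : EssFiniteType R K := .comp _ A _
  have : FormallyUnramified R K := .comp _ A _
  have hinj : Function.Injective (algebraMap R K) := by
    rw [IsScalarTower.algebraMap_eq R A K]
    exact (IsFractionRing.injective A K).comp (FaithfulSMul.algebraMap_injective R A)
  have : FaithfulSMul R K := (faithfulSMul_iff_algebraMap_injective _ _).2 hinj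
  let : Algebra (FractionRing R) K := FractionRing.liftAlgebra R K
  have : EssFiniteType (FractionRing R) K := .of_comp R _ _
  have : FormallyUnramified (FractionRing R) K := .of_restrictScalars R _ _
  have : Algebra.IsSeparable (FractionRing R) K := FormallyUnramified.isSeparable _ _
  exact (IsFractionRing.comap_isAlgebraic_iff (K := FractionRing R)).2 inferInstance

lemma IsFunctionFieldOfCurve.of_smooth (F A : Type u) {K : Type u} [Field F] [CommRing A]
    [IsDomain A] [Field K] [Algebra F A] [Algebra F K] [Algebra A K] [IsScalarTower F A K]
    [IsFractionRing A K] [IsStandardSmoothOfRelativeDimension 1 F A] :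
    IsFunctionFieldOfCurve F K := by
  obtain ⟨g, hg⟩ := exists_etale_polynomial F A
  let := g.toRingHom.toAlgebra
  have : IsScalarTower F F[X] A := .of_algebraMap_eq' g.comp_algebraMap.symm
  have : Algebra.Etale F[X] A := hg
  let : Algebra F[X] K := ((algebraMap A K).comp g.toRingHom).toAlgebra
  have : IsScalarTower F[X] A K := .of_algebraMap_eq' rfl
  have : IsScalarTower F F[X] K := .to₁₂₄ _ _ A _
  have : Algebra.IsAlgebraic F[X] K := isAlgebraic_fractionRing_of_etale F[X] A
  have : EssFiniteType A K := .of_isLocalization K (nonZeroDivisors A)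
  have : EssFiniteType F A := .comp F F[X] A
  have : FaithfulSMul F[X] K := by
    rw [faithfulSMul_iff_algebraMap_injective, IsScalarTower.algebraMap_eq F[X] A K]
    exact (IsFractionRing.injective A K).comp (FaithfulSMul.algebraMap_injective F[X] A)
  refine { toEssFiniteType := .comp F A K, trdeg_eq_one := ?_ }
  rw [← trdeg_add_eq F F[X] (A := K), trdeg_eq_zero (R := F[X]), add_zero]
  exact Polynomial.trdeg_of_isDomain

/- The maximal ideal of `O` is generated by that of the local ring of the affine line, since the
curve is étale, hence unramified, over the line. -/
lemma isDiscreteValuationRing_of_smooth (F : Type u) {A : Type u} [Field F] [CommRing A]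
    [IsDomain A] [Algebra F A] [IsStandardSmoothOfRelativeDimension 1 F A] {q : Ideal A}
    [q.IsPrime] (hq : q ≠ ⊥) (O : Type u) [CommRing O] [IsDomain O] [IsLocalRing O] [Algebra A O]
    [IsLocalization.AtPrime O q] : IsDiscreteValuationRing O := by
  obtain ⟨g, hg⟩ := exists_etale_polynomial F A
  let := g.toRingHom.toAlgebra
  have : Algebra.Etale F[X] A := hg
  have : IsNoetherianRing A := FiniteType.isNoetherianRing F[X] A
  have : IsNoetherianRing O := IsLocalization.isNoetherianRing q.primeCompl O inferInstance
  let := Localization.AtPrime.algebraOfLiesOver (q.under F[X]) q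
  have map_maximalIdeal :=
    ((isUnramifiedAt_iff_map_eq F[X] (q.under F[X]) q).1 inferInstance).2
  have isPrincipal : (IsLocalRing.maximalIdeal O).IsPrincipal := by
    let e := (IsLocalization.algEquiv q.primeCompl (Localization.AtPrime q) O).toRingEquiv
    rw [← IsLocalRing.map_ringEquiv_maximalIdeal e, ← map_maximalIdeal]
    exact ((IsPrincipalIdealRing.principal _).map_ringHom _).map_ringHom _
  exact ((IsDiscreteValuationRing.TFAE O
    (IsLocalization.AtPrime.not_isField A hq O)).out 4 0).mp isPrincipal

end SmoothCurves

section GeomIrreducible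
open TensorProduct

lemma isUnit_of_separable_of_dvd_pow {K : Type*} [Field K] {p g h : K[X]} (hsep : p.Separable)
    (hp : p = g * h) {n : ℕ} (hn : h ∣ g ^ n) : IsUnit h := by
  rw [hp] at hsep
  exact (hsep.isCoprime.pow_left (m := n)).isUnit_of_dvd' hn dvd_rfl

lemma aeval_one_tmul_root {F : Type*} (A : Type*) [Field F] [CommRing A] [Algebra F A] (p : F[X]) :
    aeval (1 ⊗ₜ[F] AdjoinRoot.root p : A ⊗[F] AdjoinRoot p) p = 0 := by
  have := aeval_algHom_apply (Algebra.TensorProduct.includeRight : _ →ₐ[F] A ⊗[F] AdjoinRoot p)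
    (AdjoinRoot.root p) p
  rwa [AdjoinRoot.aeval_eq, AdjoinRoot.mk_self, map_zero] at this

variable {F A K : Type*} [Field F] [CommRing A] [Field K] [Algebra F A] [Algebra F K] [Algebra A K]
  [IsScalarTower F A K]

lemma exists_dvd_pow_of_isNilpotent {p : F[X]} {g h : K[X]} (hp : h ∣ p.map (algebraMap F K))
    {G : A[X]} {b : A} (hb : algebraMap A K b ≠ 0) (hG : G.map (algebraMap A K) = b • g)
    (hnil : IsNilpotent (aeval (1 ⊗ₜ[F] AdjoinRoot.root p : A ⊗[F] AdjoinRoot p) G)) :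
    ∃ n, h ∣ g ^ n := by
  have hroot : aeval (AdjoinRoot.root h) p = 0 := by
    obtain ⟨k, hk⟩ := hp
    rw [← aeval_map_algebraMap K, hk, map_mul, AdjoinRoot.aeval_eq, AdjoinRoot.mk_self, zero_mul]
  let ψ : A ⊗[F] AdjoinRoot p →ₐ[A] AdjoinRoot h :=
    Algebra.TensorProduct.lift (Algebra.ofId A (AdjoinRoot h))
      (AdjoinRoot.liftAlgHom p (Algebra.ofId F (AdjoinRoot h)) (AdjoinRoot.root h) hroot)
      fun _ _ => .all ..
  have hψ : ψ (1 ⊗ₜ[F] AdjoinRoot.root p) = AdjoinRoot.root h := by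
    rw [Algebra.TensorProduct.lift_tmul, map_one, one_mul]
    exact AdjoinRoot.liftAlgHom_root ..
  obtain ⟨n, hn⟩ := hnil
  have hmk := congrArg ψ hn
  rw [map_pow, map_zero, ← aeval_algHom_apply, hψ, ← aeval_map_algebraMap K, hG,
    AdjoinRoot.aeval_eq, ← map_pow, AdjoinRoot.mk_eq_zero, ← algebraMap_smul K b g, _root_.smul_pow,
    smul_eq_C_mul, IsUnit.dvd_mul_left (isUnit_C.2 (pow_ne_zero _ hb).isUnit)] at hmk
  exact ⟨n, hmk⟩

lemma irreducible_map_of_isNilpotent [IsDomain A] [IsFractionRing A K] {p : F[X]}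
    (hp : Irreducible p) (hsep : p.Separable)
    (hnil : ∀ a b : A ⊗[F] AdjoinRoot p, a * b = 0 → IsNilpotent a ∨ IsNilpotent b) :
    Irreducible (p.map (algebraMap F K)) := by
  refine ⟨fun hu => hp.natDegree_pos.ne' ?_, fun g h hgh => ?_⟩
  · rw [← natDegree_map (algebraMap F K), natDegree_eq_zero_of_isUnit hu]
  obtain ⟨b, hbA, hb⟩ := IsLocalization.integerNormalization_spec (nonZeroDivisors A) g
  obtain ⟨c, hcA, hc⟩ := IsLocalization.integerNormalization_spec (nonZeroDivisors A) h
  set G := IsLocalization.integerNormalization (nonZeroDivisors A) g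
  set H := IsLocalization.integerNormalization (nonZeroDivisors A) h
  have hGH : G * H = C (b * c) * p.map (algebraMap F A) := by
    apply map_injective _ (IsFractionRing.injective A K)
    rw [Polynomial.map_mul, hb, hc, Polynomial.map_mul, Polynomial.map_map,
      ← IsScalarTower.algebraMap_eq, hgh, map_C, ← algebraMap_smul K b g, ← algebraMap_smul K c h,
      smul_eq_C_mul, smul_eq_C_mul, map_mul, C_mul]
    ring
  have hb0 : algebraMap A K b ≠ 0 := IsFractionRing.to_map_ne_zero_of_mem_nonZeroDivisors hbA
  have hc0 : algebraMap A K c ≠ 0 := IsFractionRing.to_map_ne_zero_of_mem_nonZeroDivisors hcA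
  have aeval_mul_aeval : aeval (1 ⊗ₜ[F] AdjoinRoot.root p : A ⊗[F] AdjoinRoot p) G *
      aeval (1 ⊗ₜ[F] AdjoinRoot.root p : A ⊗[F] AdjoinRoot p) H = 0 := by
    rw [← map_mul, hGH, map_mul, aeval_map_algebraMap, aeval_one_tmul_root, mul_zero]
  rcases hnil _ _ aeval_mul_aeval with hn | hn
  · obtain ⟨n, hn⟩ := exists_dvd_pow_of_isNilpotent (hgh ▸ dvd_mul_left h g) hb0 hb hn
    exact .inr (isUnit_of_separable_of_dvd_pow hsep.map hgh hn)
  · obtain ⟨n, hn⟩ := exists_dvd_pow_of_isNilpotent (hgh ▸ dvd_mul_right g h) hc0 hc hn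
    exact .inl (isUnit_of_separable_of_dvd_pow hsep.map (hgh.trans (mul_comm g h)) hn)

end GeomIrreducible

section Constants
variable (Fq : Type u) [Field Fq] (C : Scheme.{u}) [C.Over (Spec (.of Fq))]

/-- The constants, as functions on an open set. -/
def openConstants (U : C.Opens) : CommRingCat.of Fq ⟶ Γ(C, U) :=
  (Scheme.ΓSpecIso (.of Fq)).inv ≫ (C ↘ Spec (.of Fq)).appLE ⊤ U le_top

/-- The constants, as elements of the local ring of a point. -/
def stalkConstants (x : C) : CommRingCat.of Fq ⟶ C.presheaf.stalk x :=
  (Scheme.ΓSpecIso (.of Fq)).inv ≫ (C ↘ Spec (.of Fq)).appTop ≫ C.presheaf.germ ⊤ x trivial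

variable {C}

lemma openConstants_germ {U : C.Opens} {x : C} (hx : x ∈ U) :
    openConstants Fq C U ≫ C.presheaf.germ U x hx = stalkConstants Fq C x := by
  have appLE_eq : (C ↘ Spec (.of Fq)).appLE ⊤ U le_top =
    (C ↘ Spec (.of Fq)).appTop ≫ C.presheaf.map (homOfLE le_top).op := rfl
  rw [openConstants, stalkConstants, appLE_eq, Category.assoc, Category.assoc]
  congr 2
  exact TopCat.Presheaf.germ_res ..

lemma fromSpec_comp_over {U : C.Opens} (hU : IsAffineOpen U) :
    hU.fromSpec ≫ (C ↘ Spec (.of Fq)) = Spec.map (openConstants Fq C U) := by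
  rw [openConstants, Spec.map_comp,
    ← IsAffineOpen.SpecMap_appLE_fromSpec (C ↘ Spec (.of Fq)) (isAffineOpen_top _) hU le_top]
  congr 1
  rw [IsAffineOpen.fromSpec_top, Scheme.isoSpec_Spec_inv]

lemma fromSpecStalk_comp_over (x : C) :
    C.fromSpecStalk x ≫ (C ↘ Spec (.of Fq)) = Spec.map (stalkConstants Fq C x) := by
  obtain ⟨U, hU, hxU, -⟩ := exists_isAffineOpen_mem_and_subset (TopologicalSpace.Opens.mem_top x)
  rw [← hU.fromSpecStalk_eq_fromSpecStalk hxU, IsAffineOpen.fromSpecStalk, Category.assoc,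
    fromSpec_comp_over, ← Spec.map_comp, openConstants_germ]

variable [IsIntegral C]

lemma algebraMap_stalkConstants (x : C) (c : Fq) :
    algebraMap (C.presheaf.stalk x) C.functionField (stalkConstants Fq C x c) =
      algebraMap Fq C.functionField c := by
  have : stalkConstants Fq C x ≫ C.presheaf.stalkSpecializes (genericPoint_specializes x) =
      stalkConstants Fq C (genericPoint C) := by
    rw [stalkConstants, stalkConstants, Category.assoc, Category.assoc]
    congr 2
    exact TopCat.Presheaf.germ_stalkSpecializes ..
  exact congrArg (fun f => f.hom c) this

lemma algebraMap_openConstants (U : C.Opens) [Nonempty U] (c : Fq) :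
    algebraMap Γ(C, U) C.functionField (openConstants Fq C U c) = algebraMap Fq C.functionField c :=
  congrArg (fun f => f.hom c) (openConstants_germ Fq
    (((genericPoint_spec C).mem_open_set_iff U.isOpen).2 (by simpa using ‹Nonempty U›)))

end Constants

section FunctionField
variable (Fq : Type u) [Field Fq] (C : Scheme.{u}) [C.Over (Spec (.of Fq))] [IsIntegral C]

theorem irreducible_map_functionField [Finite Fq] [GeometricallyIrreducible (C ↘ Spec (.of Fq))]
    {p : Fq[X]} (hp : Irreducible p) : Irreducible (p.map (algebraMap Fq C.functionField)) := by
  obtain ⟨U, hU, hxU, -⟩ :=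
    exists_isAffineOpen_mem_and_subset (TopologicalSpace.Opens.mem_top (genericPoint C))
  have : Nonempty U := ⟨⟨_, hxU⟩⟩
  let : Algebra Fq Γ(C, U) := (openConstants Fq C U).hom.toAlgebra
  have : IsScalarTower Fq Γ(C, U) C.functionField :=
    .of_algebraMap_eq fun c => (algebraMap_openConstants Fq U c).symm
  have : IsFractionRing Γ(C, U) C.functionField :=
    functionField_isFractionRing_of_isAffineOpen C U hU
  refine irreducible_map_of_isNilpotent (A := Γ(C, U)) hp
    (PerfectField.separable_of_irreducible hp) fun a b hab => ?_
  have := Fact.mk hp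
  have : Surjective (hU.fromSpec ≫ (C ↘ Spec (.of Fq))) :=
    ⟨fun y => ⟨Nonempty.some inferInstance, Subsingleton.elim (α := PrimeSpectrum Fq) _ _⟩⟩
  have hgeom : GeometricallyIrreducible (hU.fromSpec ≫ (C ↘ Spec (.of Fq))) := inferInstance
  rw [fromSpec_comp_over] at hgeom
  have irreducibleSpace := hgeom.geometrically_irreducibleSpace (K := AdjoinRoot p) _ _ _
    (isPullback_SpecMap_of_isPushout _ _ _ _
      (CommRingCat.isPushout_tensorProduct Fq Γ(C, U) (AdjoinRoot p)))
  have isPrime := PrimeSpectrum.irreducibleSpace_iff_isPrime_nilradical.1 irreducibleSpace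
  simp only [← mem_nilradical]
  exact isPrime.mem_or_mem (hab ▸ zero_mem _)

variable {C} in
omit [IsIntegral C] in
lemma exists_isStandardSmooth [SmoothOfRelativeDimension 1 (C ↘ Spec (.of Fq))] (x : C) :
    ∃ U : C.Opens, IsAffineOpen U ∧ x ∈ U ∧
      (openConstants Fq C U).hom.IsStandardSmoothOfRelativeDimension 1 := by
  obtain ⟨V, hV, U, hU, hx, e, hf⟩ :=
    SmoothOfRelativeDimension.exists_isStandardSmoothOfRelativeDimension (n := 1)
      (f := C ↘ Spec (.of Fq)) x
  refine ⟨U, hU, hx, ?_⟩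
  obtain rfl : V = ⊤ := by
    ext y
    obtain rfl : y = (C ↘ Spec (.of Fq)) x := Subsingleton.elim (α := PrimeSpectrum Fq) _ _
    exact ⟨fun _ => trivial, fun _ => e hx⟩
  exact RingHom.isStandardSmoothOfRelativeDimension_respectsIso.2 _
    (Scheme.ΓSpecIso (.of Fq)).symm.commRingCatIsoToRingEquiv hf

instance isFunctionFieldOfCurve_functionField [SmoothOfRelativeDimension 1 (C ↘ Spec (.of Fq))] :
    IsFunctionFieldOfCurve Fq C.functionField := by
  obtain ⟨U, hU, hx, hsmooth⟩ := exists_isStandardSmooth Fq (genericPoint C)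
  have : Nonempty U := ⟨⟨_, hx⟩⟩
  let : Algebra Fq Γ(C, U) := (openConstants Fq C U).hom.toAlgebra
  have : Algebra.IsStandardSmoothOfRelativeDimension 1 Fq Γ(C, U) := hsmooth
  have : IsScalarTower Fq Γ(C, U) C.functionField :=
    .of_algebraMap_eq fun c => (algebraMap_openConstants Fq U c).symm
  have : IsFractionRing Γ(C, U) C.functionField :=
    functionField_isFractionRing_of_isAffineOpen C U hU
  exact .of_smooth Fq Γ(C, U)

variable {C}

include Fq in
lemma isDiscreteValuationRing_stalk [SmoothOfRelativeDimension 1 (C ↘ Spec (.of Fq))] {x : C}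
    (hx : x ≠ genericPoint C) : IsDiscreteValuationRing (C.presheaf.stalk x) := by
  obtain ⟨U, hU, hxU, hsmooth⟩ := exists_isStandardSmooth Fq x
  have : Nonempty U := ⟨⟨_, hxU⟩⟩
  let : Algebra Fq Γ(C, U) := (openConstants Fq C U).hom.toAlgebra
  have : Algebra.IsStandardSmoothOfRelativeDimension 1 Fq Γ(C, U) := hsmooth
  let : Algebra Γ(C, U) (C.presheaf.stalk x) :=
    TopCat.Presheaf.algebra_section_stalk C.presheaf ⟨x, hxU⟩
  have : IsLocalization.AtPrime (C.presheaf.stalk x) (hU.primeIdealOf ⟨x, hxU⟩).asIdeal :=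
    hU.isLocalization_stalk ⟨x, hxU⟩
  refine isDiscreteValuationRing_of_smooth Fq (q := (hU.primeIdealOf ⟨x, hxU⟩).asIdeal)
    (fun h => hx ?_) _
  have primeIdealOf_eq : hU.primeIdealOf ⟨x, hxU⟩ = genericPoint (Spec Γ(C, U)) := by
    rw [genericPoint_eq_bot_of_affine]
    exact PrimeSpectrum.ext h
  rw [← hU.primeIdealOf_genericPoint] at primeIdealOf_eq
  have := congrArg hU.fromSpec primeIdealOf_eq
  rwa [hU.fromSpec_primeIdealOf, hU.fromSpec_primeIdealOf] at this

end FunctionField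

lemma mem_iff_mem_range_of_isLocalHom {R K S : Type*} [CommRing R] [IsDomain R] [ValuationRing R]
    [Field K] [Algebra R K] [IsFractionRing R K] [SetLike S K] [SubringClass S K] {O : S}
    (φ : R →+* O) [IsLocalHom φ] (hφ : ∀ y, (φ y : K) = algebraMap R K y) (f : K) :
    f ∈ O ↔ f ∈ Set.range (algebraMap R K) := by
  refine ⟨fun hf => ?_, ?_⟩
  · rcases ValuationRing.isInteger_or_isInteger R f with h | ⟨y, hy⟩
    · exact h
    rcases eq_or_ne f 0 with rfl | hf0
    · exact ⟨0, map_zero _⟩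
    have isUnit_map : IsUnit (φ y) := by
      refine IsUnit.of_mul_eq_one (⟨f, hf⟩ : O) (Subtype.ext ?_)
      change (φ y : K) * f = 1
      rw [hφ, hy, inv_mul_cancel₀ hf0]
    obtain ⟨z, rfl⟩ := isUnit_of_map_unit φ _ isUnit_map
    refine ⟨↑z⁻¹, ?_⟩
    rw [← inv_inv f, ← hy]
    exact eq_inv_of_mul_eq_one_left (by rw [← map_mul, Units.inv_mul, map_one])
  · rintro ⟨y, rfl⟩
    rw [← hφ]
    exact (φ y).2

section Centers
variable {C : Scheme.{u}} [IsIntegral C]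

lemma algebraMap_stalk_surjective {c : C} (hc : c = genericPoint C) :
    Function.Surjective (algebraMap (C.presheaf.stalk c) C.functionField) := by
  subst hc
  exact fun k => ⟨k, congrArg (fun f => f.hom k)
    (TopCat.Presheaf.stalkSpecializes_refl C.presheaf (genericPoint C))⟩

/-- The point `c` is the center of the place `v`: its local ring is the valuation ring of `v`.
A geometric point `x` lies over `v` exactly if `x.center` is the center of `v`. -/
def Place.IsCenter (v : Place C.functionField) (c : C) : Prop :=
  ∀ f : C.functionField, v.val f ≤ 1 ↔
    f ∈ Set.range (algebraMap (C.presheaf.stalk c) C.functionField)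

namespace Place.IsCenter

variable {v : Place C.functionField} {c : C} (h : v.IsCenter c)

/-- The local ring of the center of `v` is the valuation ring of `v`. -/
def ringEquiv : C.presheaf.stalk c ≃+* v.val.valuationSubring :=
  RingEquiv.ofBijective
    ((algebraMap (C.presheaf.stalk c) C.functionField).codRestrict
      v.val.valuationSubring.toSubring fun y => (h _).2 ⟨y, rfl⟩)
    ⟨fun x y hxy => IsFractionRing.injective (C.presheaf.stalk c) C.functionField
      (congrArg Subtype.val hxy), fun f => by
        obtain ⟨y, hy⟩ := (h f).1 f.2
        exact ⟨y, Subtype.ext hy⟩⟩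

/-- The morphism to the curve from the spectrum of the valuation ring of `v`. -/
def toHom : Spec (.of v.val.valuationSubring) ⟶ C :=
  Spec.map (CommRingCat.ofHom h.ringEquiv.toRingHom) ≫ C.fromSpecStalk c

instance isIso_specMap : IsIso (Spec.map (CommRingCat.ofHom h.ringEquiv.toRingHom)) :=
  inferInstanceAs (IsIso (Scheme.Spec.mapIso h.ringEquiv.toCommRingCatIso.op).hom)

instance mono_toHom : Mono h.toHom := by
  rw [toHom]; infer_instance

lemma toHom_closedPoint : h.toHom (IsLocalRing.closedPoint v.val.valuationSubring) = c := by
  have : IsLocalHom (CommRingCat.ofHom h.ringEquiv.toRingHom).hom :=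
    inferInstanceAs (IsLocalHom (RingHomClass.toRingHom h.ringEquiv))
  have specMap_closedPoint : Spec.map (CommRingCat.ofHom h.ringEquiv.toRingHom)
    (IsLocalRing.closedPoint v.val.valuationSubring) = IsLocalRing.closedPoint _ :=
    Spec_closedPoint ..
  exact (congrArg (C.fromSpecStalk c) specMap_closedPoint).trans Scheme.fromSpecStalk_closedPoint

lemma specMap_algebraMap_toHom :
    Spec.map (CommRingCat.ofHom (algebraMap v.val.valuationSubring C.functionField)) ≫ h.toHom =
      C.fromSpecStalk (genericPoint C) := by
  rw [toHom, ← Category.assoc, ← Spec.map_comp,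
    ← Scheme.SpecMap_stalkSpecializes_fromSpecStalk (genericPoint_specializes c)]
  rfl

variable (Fq : Type u) [Field Fq] [Fintype Fq] [C.Over (Spec (.of Fq))]

lemma ringEquiv_stalkConstants (a : Fq) :
    h.ringEquiv (stalkConstants Fq C c a) = v.constants Fq a :=
  Subtype.ext (algebraMap_stalkConstants Fq c a)

lemma toHom_comp_over :
    h.toHom ≫ (C ↘ Spec (.of Fq)) = Spec.map (CommRingCat.ofHom (v.constants Fq)) := by
  rw [toHom, Category.assoc, fromSpecStalk_comp_over, ← Spec.map_comp]
  congr 1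
  ext a
  exact congrArg Subtype.val (h.ringEquiv_stalkConstants Fq a)

end Place.IsCenter

namespace Place
variable (v : Place C.functionField) (Fq : Type u) [Field Fq] [C.Over (Spec (.of Fq))]

/-- The square of the valuative criterion at a place of the function field. -/
def valuativeCommSq [Fintype Fq] : ValuativeCommSq (C ↘ Spec (.of Fq)) where
  R := v.val.valuationSubring
  K := C.functionField
  i₁ := C.fromSpecStalk (genericPoint C)
  i₂ := Spec.map (CommRingCat.ofHom (v.constants Fq))
  commSq := ⟨by
    rw [fromSpecStalk_comp_over, ← Spec.map_comp]
    rfl⟩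

variable {v} in
include Fq in
lemma IsCenter.toHom_eq [Finite Fq] [IsSeparated (C ↘ Spec (.of Fq))] {c d : C}
    (hc : v.IsCenter c) (hd : v.IsCenter d) : hc.toHom = hd.toHom := by
  have := Fintype.ofFinite Fq
  have h := (IsSeparated.valuativeCriterion (C ↘ Spec (.of Fq))) (v.valuativeCommSq Fq)
  let lift : ∀ {c : C}, v.IsCenter c → (v.valuativeCommSq Fq).commSq.LiftStruct := fun h =>
    ⟨h.toHom, h.specMap_algebraMap_toHom, h.toHom_comp_over Fq⟩
  exact congrArg CommSq.LiftStruct.l (h.elim (lift hc) (lift hd))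

include Fq in
lemma exists_lift [Finite Fq] [UniversallyClosed (C ↘ Spec (.of Fq))] :
    ∃ l : Spec (.of v.val.valuationSubring) ⟶ C,
      Spec.map (CommRingCat.ofHom (algebraMap v.val.valuationSubring C.functionField)) ≫ l =
        C.fromSpecStalk (genericPoint C) := by
  have := Fintype.ofFinite Fq
  have existence : ValuativeCriterion.Existence (C ↘ Spec (.of Fq)) := by
    have : UniversallyClosed (C ↘ Spec (.of Fq)) := inferInstance
    rw [UniversallyClosed.eq_valuativeCriterion] at this
    exact this.1
  obtain ⟨⟨⟨l, hl, -⟩⟩⟩ := existence (v.valuativeCommSq Fq)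
  exact ⟨l, hl⟩

variable {v} in
lemma coe_stalkClosedPointTo {l : Spec (.of v.val.valuationSubring) ⟶ C}
    (hl : Spec.map (CommRingCat.ofHom (algebraMap v.val.valuationSubring C.functionField)) ≫ l =
      C.fromSpecStalk (genericPoint C)) (y) :
    ((Scheme.stalkClosedPointTo l).hom y : C.functionField) = algebraMap _ C.functionField y := by
  have hcomp : Scheme.stalkClosedPointTo l ≫
      CommRingCat.ofHom (algebraMap v.val.valuationSubring C.functionField) =
      C.presheaf.stalkSpecializes (genericPoint_specializes _) := by
    apply Spec.map_injective
    rw [← cancel_mono (C.fromSpecStalk _), Spec.map_comp, Category.assoc,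
      Scheme.Spec_stalkClosedPointTo_fromSpecStalk, Scheme.SpecMap_stalkSpecializes_fromSpecStalk]
    exact hl
  exact congrArg (fun f => f.hom y) hcomp

/- The valuative criterion gives a center in the sense of dominance of local rings; it is not the
generic point, so its local ring is itself a valuation ring, which has no proper dominating ring
in its fraction field. -/
lemma exists_isCenter [Finite Fq] [UniversallyClosed (C ↘ Spec (.of Fq))]
    [SmoothOfRelativeDimension 1 (C ↘ Spec (.of Fq))] : ∃ c : C, v.IsCenter c := by
  obtain ⟨l, hl⟩ := v.exists_lift Fq
  set c : C := l (IsLocalRing.closedPoint v.val.valuationSubring)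
  have hne : c ≠ genericPoint C := fun hc => by
    obtain ⟨k, hk⟩ := v.surjective (exp 1)
    obtain ⟨y, rfl⟩ := algebraMap_stalk_surjective hc k
    have hle : v.val _ ≤ 1 := ((Scheme.stalkClosedPointTo l).hom y).2
    rw [coe_stalkClosedPointTo hl, hk, ← exp_zero, exp_le_exp] at hle
    omega
  have := isDiscreteValuationRing_stalk Fq hne
  exact ⟨c, mem_iff_mem_range_of_isLocalHom (O := v.val.valuationSubring)
    (Scheme.stalkClosedPointTo l).hom (coe_stalkClosedPointTo hl)⟩

end Place

end Centers

/-! ### Points over a place -/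

lemma zpow_apply_algHom {F κ L : Type*} [CommSemiring F] [Semiring κ] [Semiring L] [Algebra F κ]
    [Algebra F L] {φ : κ →ₐ[F] L} {σ : L ≃ₐ[F] L} {τ : κ ≃ₐ[F] κ} (h : ∀ x, σ (φ x) = φ (τ x))
    (n : ℤ) (x : κ) : (σ ^ n) (φ x) = φ ((τ ^ n) x) := by
  have hinv : ∀ x, σ⁻¹ (φ x) = φ (τ⁻¹ x) := fun x =>
    σ.symm_apply_eq.2 (by rw [h]; exact congrArg φ (τ.apply_symm_apply x).symm)
  induction n using Int.induction_on generalizing x with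
  | zero => rfl
  | succ n ih => rw [zpow_add_one, zpow_add_one, AlgEquiv.mul_apply, h, ih, AlgEquiv.mul_apply]
  | pred n ih => rw [zpow_sub_one, zpow_sub_one, AlgEquiv.mul_apply, hinv, ih, AlgEquiv.mul_apply]

section FiniteFields
variable {F κ L : Type*} [Field F] [Fintype F] [Field κ] [Field L] [Algebra F κ] [Algebra F L]
  [Module.Finite F κ] [Algebra.IsAlgebraic F L]

lemma frobenius_zpow_apply (φ : κ →ₐ[F] L) (n : ℤ) (x : κ) :
    (FiniteField.frobeniusAlgEquivOfAlgebraic F L ^ n) (φ x) =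
      φ ((FiniteField.frobeniusAlgEquivOfAlgebraic F κ ^ n) x) :=
  zpow_apply_algHom (fun x => by simp) n x

lemma exists_eq_frobenius_zpow (φ ψ : κ →ₐ[F] L) : ∃ n : ℤ, ∀ x,
    ψ x = (FiniteField.frobeniusAlgEquivOfAlgebraic F L ^ n) (φ x) := by
  have := Module.finite_of_finite F (M := κ)
  let := φ.toRingHom.toAlgebra
  have : IsScalarTower F κ L := .of_algebraMap_eq' φ.comp_algebraMap.symm
  let σ := Normal.algHomEquivAut F L κ ψ
  have hσ : ∀ x, ψ x = φ (σ x) := fun x =>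
    (DFunLike.congr_fun ((Normal.algHomEquivAut F L κ).symm_apply_apply ψ) x).symm
  obtain ⟨n, hn⟩ := (FiniteField.bijective_frobeniusAlgEquivOfAlgebraic_pow F κ).2 σ
  refine ⟨n, fun x => ?_⟩
  rw [hσ, ← hn, frobenius_zpow_apply, zpow_natCast]

lemma frobenius_zpow_comp_eq_self_iff (φ : κ →ₐ[F] L) (n : ℤ) :
    (∀ x, (FiniteField.frobeniusAlgEquivOfAlgebraic F L ^ n) (φ x) = φ x) ↔
      (Module.finrank F κ : ℤ) ∣ n := by
  have := Module.finite_of_finite F (M := κ)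
  simp only [frobenius_zpow_apply]
  rw [← FiniteField.orderOf_frobeniusAlgEquivOfAlgebraic F κ, orderOf_dvd_iff_zpow_eq_one,
    AlgEquiv.ext_iff]
  exact forall_congr' fun x => φ.toRingHom.injective.eq_iff

end FiniteFields

namespace GeomPoint

section Stalk
variable {Fq : Type u} [Field Fq] {C : Scheme.{u}} [C.Over (Spec (.of Fq))]

variable (Fq C) in
/-- The action of the Galois group on the geometric points. -/
def galoisHom :
    (AlgebraicClosure Fq ≃ₐ[Fq] AlgebraicClosure Fq) →* Equiv.Perm (GeomPoint Fq C) where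
  toFun σ := ⟨galois σ, galois σ.symm,
    fun x => by rw [galois_galois, AlgEquiv.self_trans_symm, galois_refl],
    fun x => by rw [galois_galois, AlgEquiv.symm_trans_self, galois_refl]⟩
  map_one' := Equiv.ext galois_refl
  map_mul' σ τ := Equiv.ext fun x => (galois_galois σ τ x).symm

lemma frobenius_zpow [Fintype Fq] (n : ℤ) (x : GeomPoint Fq C) : (frobenius Fq C ^ n) x =
    galois (FiniteField.frobeniusAlgEquivOfAlgebraic Fq (AlgebraicClosure Fq) ^ n) x := by
  have frobenius_eq : frobenius Fq C =
    galoisHom Fq C (FiniteField.frobeniusAlgEquivOfAlgebraic Fq (AlgebraicClosure Fq)) := rfl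
  rw [frobenius_eq, ← map_zpow]
  rfl

/-- The homomorphism from the local ring given by a geometric point. -/
def stalkHom (x : GeomPoint Fq C) : C.presheaf.stalk x.center →+* AlgebraicClosure Fq :=
  (Scheme.stalkClosedPointTo x.1).hom

instance (x : GeomPoint Fq C) : IsLocalHom x.stalkHom :=
  inferInstanceAs (IsLocalHom (Scheme.stalkClosedPointTo x.1).hom)

lemma specMap_stalkHom (x : GeomPoint Fq C) :
    Spec.map (CommRingCat.ofHom x.stalkHom) ≫ C.fromSpecStalk x.center = x.1 :=
  Scheme.Spec_stalkClosedPointTo_fromSpecStalk x.1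

lemma stalkHom_stalkConstants (x : GeomPoint Fq C) (a : Fq) :
    x.stalkHom (stalkConstants Fq C x.center a) = algebraMap Fq (AlgebraicClosure Fq) a := by
  have h := x.2
  rw [← specMap_stalkHom, Category.assoc, fromSpecStalk_comp_over, ← Spec.map_comp] at h
  exact congrArg (fun f => f.hom a) (Spec.map_injective h)

variable [IsIntegral C] [SmoothOfRelativeDimension 1 (C ↘ Spec (.of Fq))]

/- Otherwise the point would embed the function field, which contains transcendental elements,
into `𝔽̄_q`. -/
lemma center_ne_genericPoint (x : GeomPoint Fq C) : x.center ≠ genericPoint C := fun hc => by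
  let e : C.presheaf.stalk x.center ≃+* C.functionField := RingEquiv.ofBijective _
    ⟨IsFractionRing.injective (C.presheaf.stalk x.center) C.functionField,
      algebraMap_stalk_surjective hc⟩
  have he : ∀ a, e.symm (algebraMap Fq C.functionField a) = stalkConstants Fq C x.center a :=
    fun a => e.symm_apply_eq.2 (algebraMap_stalkConstants Fq x.center a).symm
  let φ : C.functionField →ₐ[Fq] AlgebraicClosure Fq :=
    { x.stalkHom.comp e.symm.toRingHom with
      commutes' := fun a => (congrArg x.stalkHom (he a)).trans (x.stalkHom_stalkConstants a) }
  obtain ⟨t, ht⟩ := IsFunctionFieldOfCurve.exists_transcendental (F := Fq) (K := C.functionField)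
  exact ht ((isAlgebraic_algHom_iff φ φ.toRingHom.injective).1 (Algebra.IsAlgebraic.isAlgebraic _))

theorem existsUnique_liesOver (x : GeomPoint Fq C) :
    ∃! v : Place C.functionField, x.LiesOver v := by
  have := isDiscreteValuationRing_stalk Fq x.center_ne_genericPoint
  refine ⟨Place.ofDVR (C.presheaf.stalk x.center) C.functionField,
    Place.ofDVR_val_le_one_iff _ _, fun w hw => Place.eq_of_le_one_iff fun f => ?_⟩
  exact (hw f).trans (Place.ofDVR_val_le_one_iff _ _ f).symm

end Stalk

section Fibre
variable {Fq : Type u} [Field Fq] [Fintype Fq] {C : Scheme.{u}} [C.Over (Spec (.of Fq))]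
  [IsIntegral C] {v : Place C.functionField} {c : C} (h : v.IsCenter c)

/-- The geometric point over the place `v` given by an embedding of the residue field. -/
def ofResidue (φ : v.Residue →ₐ[Fq] AlgebraicClosure Fq) : GeomPoint Fq C :=
  ⟨Spec.map (CommRingCat.ofHom (φ.toRingHom.comp (IsLocalRing.residue v.val.valuationSubring))) ≫
    h.toHom, by
      rw [Category.assoc, h.toHom_comp_over, ← Spec.map_comp]
      congr 1
      ext a
      exact φ.commutes a⟩

lemma center_ofResidue (φ : v.Residue →ₐ[Fq] AlgebraicClosure Fq) : (ofResidue h φ).center = c := by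
  have : IsLocalHom (CommRingCat.ofHom
      (φ.toRingHom.comp (IsLocalRing.residue v.val.valuationSubring))).hom :=
    inferInstanceAs (IsLocalHom (φ.toRingHom.comp (IsLocalRing.residue v.val.valuationSubring)))
  have specMap_closedPoint : Spec.map (CommRingCat.ofHom
      (φ.toRingHom.comp (IsLocalRing.residue v.val.valuationSubring)))
      (IsLocalRing.closedPoint (AlgebraicClosure Fq)) = IsLocalRing.closedPoint _ :=
    Spec_closedPoint ..
  exact (congrArg h.toHom specMap_closedPoint).trans h.toHom_closedPoint

lemma liesOver_ofResidue (φ : v.Residue →ₐ[Fq] AlgebraicClosure Fq) :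
    (ofResidue h φ).LiesOver v := by
  have : v.IsCenter (ofResidue h φ).center := (center_ofResidue h φ).symm ▸ h
  exact this

lemma ofResidue_injective : Function.Injective (ofResidue (Fq := Fq) h) := fun φ ψ hφψ => by
  have hcomp := Spec.map_injective ((cancel_mono h.toHom).1 (congrArg Subtype.val hφψ))
  ext y
  obtain ⟨y, rfl⟩ := IsLocalRing.residue_surjective y
  exact congrArg (fun f => f.hom y) hcomp

lemma galois_ofResidue (σ : AlgebraicClosure Fq ≃ₐ[Fq] AlgebraicClosure Fq)
    (φ : v.Residue →ₐ[Fq] AlgebraicClosure Fq) :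
    galois σ (ofResidue h φ) = ofResidue h (σ.toAlgHom.comp φ) := by
  apply Subtype.ext
  change _ ≫ _ ≫ _ = _ ≫ _
  rw [← Category.assoc, ← Spec.map_comp]
  rfl

lemma frobenius_zpow_ofResidue (n : ℤ) (φ : v.Residue →ₐ[Fq] AlgebraicClosure Fq) :
    (frobenius Fq C ^ n) (ofResidue h φ) =
      ofResidue h ((FiniteField.frobeniusAlgEquivOfAlgebraic Fq
        (AlgebraicClosure Fq) ^ n).toAlgHom.comp φ) := by
  rw [frobenius_zpow, galois_ofResidue]

lemma exists_eq_ofResidue [IsSeparated (C ↘ Spec (.of Fq))] {x : GeomPoint Fq C}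
    (hx : x.LiesOver v) : ∃ φ : v.Residue →ₐ[Fq] AlgebraicClosure Fq, x = ofResidue h φ := by
  have hx' : v.IsCenter x.center := hx
  let ψ : v.val.valuationSubring →+* AlgebraicClosure Fq :=
    x.stalkHom.comp hx'.ringEquiv.symm.toRingHom
  have : IsLocalHom ψ :=
    ⟨fun f hf => (isUnit_map_iff hx'.ringEquiv.symm f).1 (isUnit_of_map_unit x.stalkHom _ hf)⟩
  have hψ : ∀ a, ψ (v.constants Fq a) = algebraMap Fq (AlgebraicClosure Fq) a := fun a => by
    rw [← hx'.ringEquiv_stalkConstants, ← x.stalkHom_stalkConstants]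
    exact congrArg x.stalkHom (hx'.ringEquiv.symm_apply_apply _)
  let φ : v.Residue →ₐ[Fq] AlgebraicClosure Fq :=
    { IsLocalRing.ResidueField.lift ψ with
      commutes' := hψ }
  have lift_comp_residue : φ.toRingHom.comp (IsLocalRing.residue v.val.valuationSubring) = ψ := rfl
  have symm_comp_self : hx'.ringEquiv.symm.toRingHom.comp hx'.ringEquiv.toRingHom = RingHom.id _ :=
    RingHom.ext hx'.ringEquiv.symm_apply_apply
  refine ⟨φ, Subtype.ext ?_⟩
  change x.1 = Spec.map (CommRingCat.ofHom _) ≫ h.toHom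
  rw [h.toHom_eq Fq hx', lift_comp_residue, Place.IsCenter.toHom, ← Category.assoc,
    ← Spec.map_comp, ← CommRingCat.ofHom_comp, RingHom.comp_assoc, symm_comp_self,
    RingHom.comp_id, specMap_stalkHom]

omit [Fintype Fq] in
variable (Fq v) in
theorem exists_liesOver [Finite Fq] [UniversallyClosed (C ↘ Spec (.of Fq))]
    [SmoothOfRelativeDimension 1 (C ↘ Spec (.of Fq))] : ∃ x : GeomPoint Fq C, x.LiesOver v := by
  have := Fintype.ofFinite Fq
  obtain ⟨c, h⟩ := v.exists_isCenter Fq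
  exact ⟨ofResidue h (IsAlgClosed.lift (R := Fq)), liesOver_ofResidue h _⟩

variable [IsSeparated (C ↘ Spec (.of Fq))] [SmoothOfRelativeDimension 1 (C ↘ Spec (.of Fq))]
  {x : GeomPoint Fq C} (hx : x.LiesOver v)
include hx

theorem LiesOver.liesOver_iff (y : GeomPoint Fq C) :
    y.LiesOver v ↔ ∃ n : ℤ, (frobenius Fq C ^ n) x = y := by
  have h : v.IsCenter x.center := hx
  obtain ⟨φ, hφ⟩ := exists_eq_ofResidue h hx
  have hφ' : ∀ n : ℤ, (frobenius Fq C ^ n) x = _ := fun n =>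
    (congrArg _ hφ).trans (frobenius_zpow_ofResidue h n φ)
  constructor
  · intro hy
    obtain ⟨ψ, hψ⟩ := exists_eq_ofResidue h hy
    obtain ⟨n, hn⟩ := exists_eq_frobenius_zpow φ ψ
    refine ⟨n, (hφ' n).trans ?_⟩
    rw [hψ]
    exact congrArg _ (AlgHom.ext fun a => (hn a).symm)
  · rintro ⟨n, rfl⟩
    rw [hφ']
    exact liesOver_ofResidue h _

theorem LiesOver.frobenius_zpow_eq_self_iff (n : ℤ) :
    (frobenius Fq C ^ n) x = x ↔ (v.deg Fq : ℤ) ∣ n := by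
  have h : v.IsCenter x.center := hx
  obtain ⟨φ, hφ⟩ := exists_eq_ofResidue h hx
  rw [congrArg (frobenius Fq C ^ n) hφ, frobenius_zpow_ofResidue, Place.deg,
    ← frobenius_zpow_comp_eq_self_iff φ]
  conv_lhs => rhs; rw [hφ]
  rw [(ofResidue_injective h).eq_iff, AlgHom.ext_iff]
  rfl

end Fibre

end GeomPoint

lemma ncard_range_zpow_smul {G X : Type*} [Group G] [MulAction G X] {g : G} {x : X} {d : ℕ}
    (h : ∀ n : ℤ, g ^ n • x = x ↔ (d : ℤ) ∣ n) : (Set.range fun n : ℤ => g ^ n • x).ncard = d := by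
  have minimalPeriod_eq : Function.minimalPeriod (g • ·) x = d :=
    Nat.dvd_right_iff_eq.1 fun m => by
      rw [← Int.natCast_dvd_natCast, ← MulAction.zpow_smul_eq_iff_minimalPeriod_dvd, h,
        Int.natCast_dvd_natCast]
  have range_eq : (Set.range fun n : ℤ => g ^ n • x) =
      MulAction.orbit (Subgroup.zpowers g) x := by
    ext y
    simp only [Set.mem_range, MulAction.mem_orbit_iff, Subtype.exists, Subgroup.mem_zpowers_iff,
      Subgroup.mk_smul, exists_prop, exists_exists_eq_and]
  rw [range_eq, ← Nat.card_coe_set_eq, Nat.card_congr (MulAction.orbitZPowersEquiv g x),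
    Nat.card_zmod, minimalPeriod_eq]

section Curve
variable (Fq : Type u) [Field Fq] [Fintype Fq] (C : Scheme.{u}) [C.Over (Spec (.of Fq))]
  [IsIntegral C] [SmoothOfRelativeDimension 1 (C ↘ Spec (.of Fq))]

theorem exists_not_dvd_deg_functionField [GeometricallyIrreducible (C ↘ Spec (.of Fq))]
    {ℓ : ℕ} (hℓ : 1 < ℓ) : ∃ v : Place C.functionField, ¬ ℓ ∣ v.deg Fq :=
  exists_not_dvd_deg (fun _ hp => irreducible_map_functionField Fq C hp) hℓ

namespace GeomPoint
variable {Fq C} [IsSeparated (C ↘ Spec (.of Fq))]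

section Fibre
variable {v : Place C.functionField} {x : GeomPoint Fq C} (hx : x.LiesOver v)
include hx

theorem LiesOver.setOf_liesOver : {y : GeomPoint Fq C | y.LiesOver v} =
    Set.range fun n : ℤ => (frobenius Fq C ^ n) x :=
  Set.ext hx.liesOver_iff

theorem LiesOver.ncard_setOf_liesOver : {y : GeomPoint Fq C | y.LiesOver v}.ncard = v.deg Fq := by
  rw [hx.setOf_liesOver]
  exact ncard_range_zpow_smul (g := frobenius Fq C) hx.frobenius_zpow_eq_self_iff

end Fibre

variable {s : Place C.functionField → GeomPoint Fq C} (hs : ∀ v, (s v).LiesOver v)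
include hs

lemma exists_eq_frobenius_zpow_section (x : GeomPoint Fq C) :
    ∃ v, ∃ n : ℤ, x = (frobenius Fq C ^ n) (s v) := by
  obtain ⟨v, hv, -⟩ := existsUnique_liesOver x
  obtain ⟨n, hn⟩ := ((hs v).liesOver_iff x).1 hv
  exact ⟨v, n, hn.symm⟩

lemma frobenius_zpow_section_eq_iff (v w : Place C.functionField) (n : ℤ) :
    (frobenius Fq C ^ n) (s v) = s w ↔ v = w ∧ (v.deg Fq : ℤ) ∣ n := by
  constructor
  · intro h
    have liesOver_v : (s w).LiesOver v := ((hs v).liesOver_iff _).2 ⟨n, h⟩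
    obtain rfl := (existsUnique_liesOver (s w)).unique liesOver_v (hs w)
    exact ⟨rfl, ((hs v).frobenius_zpow_eq_self_iff n).1 h⟩
  · rintro ⟨rfl, h⟩
    exact ((hs v).frobenius_zpow_eq_self_iff n).2 h

theorem existsUnique_equiv_of_section [GeometricallyIrreducible (C ↘ Spec (.of Fq))] :
    ∃! Φ : XiQuotient C.functionField Fq ≃ GeomPoint Fq C,
      (∀ (c : IdeleClass C.functionField) (n : ℤ), IdeleClass.norm Fq c = qUnit Fq ^ n →
        ∀ x : XiQuotient C.functionField Fq, Φ (c • x) = (frobenius Fq C ^ n) (Φ x)) ∧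
      ∀ v : Place C.functionField, Φ (XiQuotient.base Fq v) = s v :=
  XiQuotient.existsUnique_equiv Fq (fun _ => exists_not_dvd_deg_functionField Fq C)
    (exists_eq_frobenius_zpow_section hs) (frobenius_zpow_section_eq_iff hs)

end GeomPoint

end Curve

end

end AdeleClass

theorem proposition8p9 (Fq : Type u) [Field Fq] [Fintype Fq]
    (C : Scheme.{u}) [C.Over (Spec (.of Fq))] [IsIntegral C]
    [IsProper (C ↘ Spec (.of Fq))]
    [SmoothOfRelativeDimension 1 (C ↘ Spec (.of Fq))]
    [GeometricallyIrreducible (C ↘ Spec (.of Fq))] :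
    -- `K^*` embeds diagonally into the ideles
    (∀ k : C.functionFieldˣ, ∃ u : Idele C.functionField, ∀ v : Place C.functionField,
      (u : Adele C.functionField) v = ((k : C.functionField) : v.Completion)) ∧
    -- the norm of ideles descends to `C_K`; there its kernel is `C_{K,1}` and its range is `q^ℤ`
    ∃ nrm : IdeleClass C.functionField →* ℝ≥0ˣ,
      (∀ a : Idele C.functionField,
        nrm (a : IdeleClass C.functionField) = ideleNorm C.functionField Fq a) ∧
      nrm.ker = normOne C.functionField Fq ∧
      nrm.range = Subgroup.zpowers (qUnit Fq) ∧
      -- `N_v = q^(n_v ℤ)`, `N / N_v ≃ ℤ / n_v`, and the orbit of `a^(v)` is a copy of `N / N_v`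
      (∀ v : Place C.functionField,
        0 < v.deg Fq ∧
        v.normRange Fq = Subgroup.zpowers (qUnit Fq ^ v.deg Fq) ∧
        Nonempty ((nrm.range ⧸ (v.normRange Fq).subgroupOf nrm.range) ≃*
          Multiplicative (ZMod (v.deg Fq))) ∧
        MulAction.stabilizer (IdeleClass C.functionField) (XiQuotient.base Fq v) =
          (v.normRange Fq).comap nrm) ∧
      -- points and places: the fibre over `v` is one Frobenius orbit, of cardinality `n_v`
      (∀ x : GeomPoint Fq C, ∃! v : Place C.functionField, x.LiesOver v) ∧
      (∀ v : Place C.functionField,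
        {x : GeomPoint Fq C | x.LiesOver v}.ncard = v.deg Fq ∧
        ∃ x : GeomPoint Fq C, {y : GeomPoint Fq C | y.LiesOver v} =
          Set.range fun n : ℤ => (GeomPoint.frobenius Fq C ^ n) x) ∧
      -- the equivariant identification, compatible with the places
      (∃ Φ : XiQuotient C.functionField Fq ≃ GeomPoint Fq C,
        (∀ (c : IdeleClass C.functionField) (n : ℤ), nrm c = qUnit Fq ^ n →
          ∀ x : XiQuotient C.functionField Fq,
            Φ (c • x) = (GeomPoint.frobenius Fq C ^ n) (Φ x)) ∧
        ∀ v : Place C.functionField, (Φ (XiQuotient.base Fq v)).LiesOver v) ∧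
      -- it is determined by the choice of a point in each Frobenius orbit, which is arbitrary
      ∀ s : Place C.functionField → GeomPoint Fq C,
        (∀ v : Place C.functionField, (s v).LiesOver v) →
        ∃! Φ : XiQuotient C.functionField Fq ≃ GeomPoint Fq C,
          (∀ (c : IdeleClass C.functionField) (n : ℤ), nrm c = qUnit Fq ^ n →
            ∀ x : XiQuotient C.functionField Fq,
              Φ (c • x) = (GeomPoint.frobenius Fq C ^ n) (Φ x)) ∧
          ∀ v : Place C.functionField, Φ (XiQuotient.base Fq v) = s v := by
  have hrange := IdeleClass.range_norm Fq fun _ => exists_not_dvd_deg_functionField Fq C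
  refine ⟨exists_principal_idele Fq, IdeleClass.norm Fq, IdeleClass.norm_mk Fq,
    IdeleClass.ker_norm Fq, hrange, fun v => ⟨v.deg_pos Fq, v.normRange_eq Fq, ?_,
      XiQuotient.stabilizer_base Fq v⟩, GeomPoint.existsUnique_liesOver, fun v => ?_, ?_,
    fun s hs => GeomPoint.existsUnique_equiv_of_section hs⟩
  · rw [hrange, v.normRange_eq Fq]
    exact nonempty_zpowers_quotient_mulEquiv (qUnit_zpow_injective Fq) _
  · obtain ⟨x, hx⟩ := GeomPoint.exists_liesOver Fq v
    exact ⟨hx.ncard_setOf_liesOver, x, hx.setOf_liesOver⟩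
  · choose s hs using fun v => GeomPoint.exists_liesOver (C := C) Fq v
    obtain ⟨Φ, ⟨hΦ, hbase⟩, -⟩ := GeomPoint.existsUnique_equiv_of_section hs
    exact ⟨Φ, hΦ, fun v => (hbase v).symm ▸ hs v⟩
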